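/- Let $\mathfrak g$ be a complex semisimple Lie algebra with Killing form $\langle\,,\rangle_{\mathfrak g}$, $\mathfrak t\subset\mathfrak g$ a Cartan subalgebra, $\triangle_+$ a system of positive roots, $\mathfrak n=\bigoplus_{\alpha\in\triangle_+}\mathfrak g_\alpha$, and let $\mathcal P_+\subset\mathfrak t^*$ be the monoid of dominant integral weights. For $\alpha\in\triangle_+$ choose root vectors $e_{\pm\alpha}\in\mathfrak g_{\pm\alpha}$ with $\langle e_\alpha,e_{-\alpha}\rangle_{\mathfrak g}=1$, and let $$\Lambda_{st}=\tfrac12\sum_{\alpha\in\triangle_+}e_{-\alpha}\wedge e_\alpha\in\wedge^2\mathfrak g,\qquad x\wedge y=x\otimes y-y\otimes x .$$ Let $G$ be the connected and simply connected complex semisimple algebraic group with Lie algebra $\mathfrak g$, and $N\subset G$ the connected subgroup with Lie algebra $\mathfrak n$. For $x\in\mathfrak g$ let $x^L,x^R$ be the left and right invariant vector fields on $G$ with value $x$ at the identity; for $\Lambda=\sum_i x_i\otimes y_i\in\mathfrak g\otimes\mathfrak g$ put $\Lambda^L(f\wedge g)=\sum_i x_i^L(f)\,y_i^L(g)$, and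 likewise $\Lambda^R$. The standard Poisson bracket on $\mathbb C[G]$ is $\{f,g\}=\Lambda_{st}^L(f\wedge g)-\Lambda_{st}^R(f\wedge g)$. Put $$\mathbb C[N\backslash G]=\{f\in\mathbb C[G]: f(ng)=f(g),\ n\in N,\ g\in G\},$$ $$\mathbb C[G]^{\varpi}=\{f\in\mathbb C[G]: f(\exp(x)ng)=e^{-\varpi(x)}f(g),\ x\in\mathfrak t,\ n\in N,\ g\in G\}.$$ 1) For all $f,g\in\mathbb C[N\backslash G]$ one has $\{f,g\}=\Lambda_{st}^L(f\wedge g)\in\mathbb C[N\backslash G]$; thus the Poisson structure descends to $N\backslash G$, i.e. $\{\,,\}$ restricts to a Poisson bracket on $\mathbb C[N\backslash G]$. 2) For $\varpi\in\mathcal P_+$ let $V(\varpi)$ be the irreducible representation of $\mathfrak g$ (and of $G$) with highest weight $\varpi$. For a highest weight vector $v$ of $V(\varpi)^*$ and $\xi\in V(\varpi)$ let $\Phi_{\varpi}(\xi)\in\mathbb C[G]$ be the matrix coefficient $\Phi_\varpi(\xi)(g)=\langle g\cdot\xi,v\rangle$; it lies in $\mathbb C[G]^{\eta}$, where $\eta$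 is the weight of $v$. Let $\varpi,\lambda\in\mathcal P_+$, fix highest weight vectors $v\in V(\varpi)^*$ and $w\in V(\lambda)^*$, and let $p_{\varpi,\lambda}:V(\varpi)\otimes V(\lambda)\to V(\varpi+\lambda)$ be the projection along the irreducible $\mathfrak g$-submodules of highest weight less than $\varpi+\lambda$. Then there is a (necessarily unique) $u\in V(\varpi+\lambda)^*$ with $\langle u,p_{\varpi,\lambda}(\xi\otimes\mu)\rangle=\langle v,\xi\rangle\langle w,\mu\rangle$ for all $\xi\in V(\varpi)$, $\mu\in V(\lambda)$; it is a highest weight vector, whose weight is the sum of the weights of $v$ and $w$, and, with $\Phi_\varpi,\Phi_\lambda,\Phi_{\varpi+\lambda}$ formed from $v,w,u$, $$\{\Phi_\varpi(\xi),\Phi_\lambda(\mu)\}=\Phi_{\varpi+\lambda}\bigl(p_{\varpi,\lambda}(\Lambda_{st}\cdot(\xi\otimes\mu))\bigr),\qquad \xi\in V(\varpi),\ \mu\in V(\lambda),$$ where $(x\otimes y)\cdot(\xi\otimes\mu)=x\xi\otimes y\mu$. In particular $\mathbb C[N\backslash G]$ is a $\mathcal P_+$-graded Poisson subalgebra of $(\mathbb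 C[G],\{\,,\})$: $\mathbb C[N\backslash G]=\bigoplus_{\varpi\in\mathcal P_+}\mathbb C[G]^{\varpi}$, $1\in\mathbb C[G]^0$, and for all $\varpi,\lambda\in\mathcal P_+$ both $\mathbb C[G]^{\varpi}\,\mathbb C[G]^{\lambda}$ and $\{\mathbb C[G]^{\varpi},\mathbb C[G]^{\lambda}\}$ lie in $\mathbb C[G]^{\varpi+\lambda}$. -/

import Mathlib

open scoped TensorProduct

noncomputable section

namespace PoissonLieGroup

/-! ### Affine algebraic groups over the complex numbers

An affine algebraic group `G` is given by its coordinate ring `A = ℂ[G]`, a finitely generated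
commutative Hopf algebra. Its points are the algebra homomorphisms `A → ℂ`; they form a group under
convolution, and a function `f : A` takes the value `g.ofConv f` at the point `g`. -/

section Group

variable (A : Type*) [CommRing A] [HopfAlgebra ℂ A]

/-- The group of complex points of `G`; the product is `(g * h)(f) = (g ⊗ h)(Δ f)`. -/
abbrev Points : Type _ := WithConv (A →ₐ[ℂ] ℂ)

/-- The analytic topology on the complex points: the coarsest one for which every regular function
`g ↦ f(g)` is continuous. -/
@[reducible]
def analyticTopology : TopologicalSpace (Points A) :=
  TopologicalSpace.induced (fun (g : Points A) (f : A) => g.ofConv f) Pi.topologicalSpace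

/-- The group of complex points is simply connected in the analytic topology. -/
def IsSimplyConnectedGroup : Prop :=
  @SimplyConnectedSpace (Points A) (analyticTopology A)

/-- The Lie algebra of `G`: the derivations `D` of `ℂ[G]` (algebraic vector fields on `G`) that
commute with left translations, `Δ ∘ D = (id ⊗ D) ∘ Δ`. -/
def lieAlg : LieSubalgebra ℂ (Derivation ℂ A A) where
  carrier := {D | Coalgebra.comul (R := ℂ) (A := A) ∘ₗ D.toLinearMap =
    LinearMap.lTensor A D.toLinearMap ∘ₗ Coalgebra.comul (R := ℂ) (A := A)}
  add_mem' := by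
    intro D E hD hE
    ext f
    have h1 := LinearMap.congr_fun hD f
    have h2 := LinearMap.congr_fun hE f
    simp only [LinearMap.comp_apply, Derivation.coeFn_coe] at h1 h2
    simp [h1, h2, LinearMap.lTensor_add]
  zero_mem' := by
    ext f
    simp
  smul_mem' := by
    intro c D hD
    ext f
    have h1 := LinearMap.congr_fun hD f
    simp only [LinearMap.comp_apply, Derivation.coeFn_coe] at h1
    simp [h1, LinearMap.lTensor_smul]
  lie_mem' := by
    intro D E hD hE
    have hD' : ∀ f : A, Coalgebra.comul (R := ℂ) (D f) =
        LinearMap.lTensor A (D : A →ₗ[ℂ] A) (Coalgebra.comul (R := ℂ) f) :=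
      fun f => LinearMap.congr_fun hD f
    have hE' : ∀ f : A, Coalgebra.comul (R := ℂ) (E f) =
        LinearMap.lTensor A (E : A →ₗ[ℂ] A) (Coalgebra.comul (R := ℂ) f) :=
      fun f => LinearMap.congr_fun hE f
    have hDE : ((⁅D, E⁆ : Derivation ℂ A A) : A →ₗ[ℂ] A) =
        (D : A →ₗ[ℂ] A) ∘ₗ (E : A →ₗ[ℂ] A) - (E : A →ₗ[ℂ] A) ∘ₗ (D : A →ₗ[ℂ] A) := by
      ext f
      exact Derivation.commutator_apply f
    ext f
    change Coalgebra.comul (R := ℂ) (((⁅D, E⁆ : Derivation ℂ A A) : A →ₗ[ℂ] A) f) =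
      LinearMap.lTensor A ((⁅D, E⁆ : Derivation ℂ A A) : A →ₗ[ℂ] A) (Coalgebra.comul (R := ℂ) f)
    rw [hDE]
    simp [LinearMap.lTensor_sub, LinearMap.lTensor_comp, hD', hE']

variable {A}

/-- `g = exp D`: the value of each regular function at `g` is given by its Taylor series
`f(exp D) = ∑ₖ (Dᵏ f)(1) / k!`. -/
def IsExp (D : lieAlg A) (g : Points A) : Prop :=
  ∀ f : A, HasSum
    (fun k : ℕ => ((k.factorial : ℂ))⁻¹ * Coalgebra.counit (R := ℂ) ((D : Derivation ℂ A A)^[k] f))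
    (g.ofConv f)

/-- A rational (algebraic) representation of `G` on `V`: a comodule `V → V ⊗ ℂ[G]`, `ξ ↦ ∑ ξ₀ ⊗ ξ₁`,
in which `g` acts by `g · ξ = ∑ ξ₁(g) ξ₀`. -/
structure RatRep (A : Type*) [CommRing A] [HopfAlgebra ℂ A]
    (V : Type*) [AddCommGroup V] [Module ℂ V] where
  /-- the coaction -/
  coact : V →ₗ[ℂ] V ⊗[ℂ] A
  coassoc : (TensorProduct.assoc ℂ V A A).toLinearMap ∘ₗ LinearMap.rTensor A coact ∘ₗ coact =
    LinearMap.lTensor V (Coalgebra.comul (R := ℂ) (A := A)) ∘ₗ coact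
  counit : (TensorProduct.rid ℂ V).toLinearMap ∘ₗ
    LinearMap.lTensor V (Coalgebra.counit (R := ℂ) (A := A)) ∘ₗ coact = LinearMap.id

/-- The matrix coefficient `c_{ξ,v} ∈ ℂ[G]`, `c_{ξ,v}(g) = ⟨g · ξ, v⟩`, for `ξ ∈ V`, `v ∈ V*`. -/
def RatRep.coeff {V : Type*} [AddCommGroup V] [Module ℂ V] (ρ : RatRep A V)
    (v : V →ₗ[ℂ] ℂ) : V →ₗ[ℂ] A :=
  (TensorProduct.lid ℂ A).toLinearMap ∘ₗ LinearMap.rTensor A v ∘ₗ ρ.coact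

/-- The derivative of the action of `G` on `V` in the direction `D`. -/
def RatRep.deriv {V : Type*} [AddCommGroup V] [Module ℂ V] (ρ : RatRep A V)
    (D : lieAlg A) : V →ₗ[ℂ] V :=
  (TensorProduct.rid ℂ V).toLinearMap ∘ₗ
    LinearMap.lTensor V (Coalgebra.counit (R := ℂ) (A := A) ∘ₗ (D : Derivation ℂ A A).toLinearMap)
      ∘ₗ ρ.coact

end Group

/-! ### Poisson brackets -/

section Poisson

variable {A : Type*} [CommRing A] [Algebra ℂ A]

/-- A bilinear Lie bracket that is a derivation in each argument. -/
structure IsPoissonBracket (br : A →ₗ[ℂ] A →ₗ[ℂ] A) : Prop where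
  self_eq_zero : ∀ f, br f f = 0
  jacobi : ∀ f g h, br f (br g h) + br g (br h f) + br h (br f g) = 0
  leibniz : ∀ f g h, br f (g * h) = br f g * h + g * br f h

/-- `S` is a subalgebra closed under the Poisson bracket, it is the direct sum of the pieces `P i`,
and multiplication and bracket are both homogeneous of degree zero. -/
structure IsGradedPoissonSubalgebra {ι : Type*} [AddMonoid ι] (br : A →ₗ[ℂ] A →ₗ[ℂ] A)
    (S : Subalgebra ℂ A) (P : ι → Submodule ℂ A) : Prop where
  poisson : IsPoissonBracket br
  br_mem : ∀ f ∈ S, ∀ g ∈ S, br f g ∈ S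
  indep : iSupIndep P
  iSup_eq : ⨆ i, P i = Subalgebra.toSubmodule S
  one_mem : (1 : A) ∈ P 0
  mul_mem_add : ∀ i j, ∀ f ∈ P i, ∀ g ∈ P j, f * g ∈ P (i + j)
  br_mem_add : ∀ i j, ∀ f ∈ P i, ∀ g ∈ P j, br f g ∈ P (i + j)

end Poisson

/-! ### Semisimple Lie algebras and highest weights -/

section Lie

variable {𝔤 : Type*} [LieRing 𝔤] [LieAlgebra ℂ 𝔤] [FiniteDimensional ℂ 𝔤]
  [LieAlgebra.IsSemisimple ℂ 𝔤]
  {𝔱 : LieSubalgebra ℂ 𝔤} [𝔱.IsCartanSubalgebra]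
  (b : (LieAlgebra.IsKilling.rootSystem 𝔱).Base)

/-- The sum `𝔫` of the root spaces of the positive roots. -/
def nilradical : Submodule ℂ 𝔤 :=
  ⨆ α : {α : 𝔱.root // b.IsPos α}, (LieAlgebra.rootSpace 𝔱 (α.1.1 : 𝔱 → ℂ)).toSubmodule

/-- The monoid `𝒫₊` of dominant integral weights, that is, of the combinations with coefficients in
`ℕ` of the fundamental weights (the dual basis of the simple coroots). -/
def dominantWeights : AddSubmonoid (Module.Dual ℂ 𝔱) where
  carrier := {ϖ | ∀ i ∈ b.support, ∃ n : ℕ,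
    ϖ ((LieAlgebra.IsKilling.rootSystem 𝔱).coroot i) = n}
  add_mem' := by
    intro ϖ η hϖ hη i hi
    obtain ⟨m, hm⟩ := hϖ i hi
    obtain ⟨n, hn⟩ := hη i hi
    exact ⟨m + n, by rw [LinearMap.add_apply, hm, hn, Nat.cast_add]⟩
  zero_mem' := fun i _ => ⟨0, by simp⟩

/-- `μ < ϖ` in the usual partial order: `ϖ - μ` is a nonzero sum of simple roots. -/
def WeightLT (μ ϖ : Module.Dual ℂ 𝔱) : Prop :=
  μ ≠ ϖ ∧ ϖ - μ ∈
    AddSubmonoid.closure ((LieAlgebra.IsKilling.rootSystem 𝔱).root '' (b.support : Set 𝔱.root))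

/-- Root vectors `ep α ∈ 𝔤_α` and `em α ∈ 𝔤_{-α}`, for `α` positive, with `⟨ep α, em α⟩ = 1` for the
Killing form. (The values at the other roots are irrelevant.) -/
def IsRootVectors (ep em : 𝔱.root → 𝔤) : Prop :=
  ∀ α, b.IsPos α → ep α ∈ LieAlgebra.rootSpace 𝔱 (α.1 : 𝔱 → ℂ) ∧
    em α ∈ LieAlgebra.rootSpace 𝔱 (-(α.1 : 𝔱 → ℂ)) ∧ killingForm ℂ 𝔤 (ep α) (em α) = 1

open Classical in
/-- The standard skew-symmetric `r`-matrix `Λ_st = ½ ∑_{α > 0} e_{-α} ∧ e_α`, where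
`x ∧ y = x ⊗ y - y ⊗ x`. -/
def standardLambda (ep em : 𝔱.root → 𝔤) : 𝔤 ⊗[ℂ] 𝔤 :=
  (1 / 2 : ℂ) • ∑ α : 𝔱.root with b.IsPos α, (em α ⊗ₜ[ℂ] ep α - ep α ⊗ₜ[ℂ] em α)

section Modules

variable {V W U : Type*} [AddCommGroup V] [Module ℂ V] [LieRingModule 𝔤 V] [LieModule ℂ 𝔤 V]
  [AddCommGroup W] [Module ℂ W] [LieRingModule 𝔤 W] [LieModule ℂ 𝔤 W]
  [AddCommGroup U] [Module ℂ U] [LieRingModule 𝔤 U] [LieModule ℂ 𝔤 U]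

/-- `m` is a highest weight vector of weight `ϖ`. -/
structure IsHighestWeightVector (ϖ : Module.Dual ℂ 𝔱) (m : V) : Prop where
  ne_zero : m ≠ 0
  nilradical_lie : ∀ x ∈ nilradical b, ⁅x, m⁆ = 0
  cartan_lie : ∀ h : 𝔱, ⁅(h : 𝔤), m⁆ = ϖ h • m

variable (V) in
/-- `V` is (a copy of) the irreducible representation `V(ϖ)` of highest weight `ϖ`. -/
structure IsIrrep (ϖ : Module.Dual ℂ 𝔱) : Prop where
  irreducible : LieModule.IsIrreducible ℂ 𝔤 V
  exists_highestWeightVector : ∃ m : V, IsHighestWeightVector b ϖ m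

/-- `p` is the projection of `V` onto `U` along the sum of the irreducible submodules of highest
weight less than `ϖ`. -/
structure IsProjectionAlongLower (ϖ : Module.Dual ℂ 𝔱) (p : V →ₗ⁅ℂ,𝔤⁆ U) : Prop where
  surjective : Function.Surjective p
  ker_eq : p.ker = sSup {M : LieSubmodule ℂ 𝔤 V | ∃ μ, WeightLT b μ ϖ ∧ IsIrrep b M μ}

/-- The action of `𝔤 ⊗ 𝔤` on `V ⊗ W`: `(x ⊗ y) · (ξ ⊗ μ) = xξ ⊗ yμ`. -/
def tensorAct (𝔤 V W : Type*) [LieRing 𝔤] [LieAlgebra ℂ 𝔤]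
    [AddCommGroup V] [Module ℂ V] [LieRingModule 𝔤 V] [LieModule ℂ 𝔤 V]
    [AddCommGroup W] [Module ℂ W] [LieRingModule 𝔤 W] [LieModule ℂ 𝔤 W] :
    𝔤 ⊗[ℂ] 𝔤 →ₗ[ℂ] (V ⊗[ℂ] W →ₗ[ℂ] V ⊗[ℂ] W) :=
  TensorProduct.homTensorHomMap (RingHom.id ℂ) V W V W ∘ₗ
    TensorProduct.map (LieModule.toEnd ℂ 𝔤 V : 𝔤 →ₗ[ℂ] Module.End ℂ V)
      (LieModule.toEnd ℂ 𝔤 W : 𝔤 →ₗ[ℂ] Module.End ℂ W)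

end Modules

end Lie

/-! ### The standard Poisson bracket on `G` and the ring `ℂ[N\G]` -/

section Bracket

variable {𝔤 : Type*} [LieRing 𝔤] [LieAlgebra ℂ 𝔤]
  {A : Type*} [CommRing A] [HopfAlgebra ℂ A] (e : 𝔤 ≃ₗ⁅ℂ⁆ lieAlg A)

/-- The left invariant vector field `x^L`, `(x^L f)(g) = d/dt f(g exp(tx))` at `t = 0`. -/
def leftField : 𝔤 →ₗ[ℂ] Module.End ℂ A where
  toFun x := ((e x : Derivation ℂ A A) : A →ₗ[ℂ] A)
  map_add' x y := by ext f; simp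
  map_smul' c x := by ext f; simp

/-- The right invariant vector field `x^R`, `(x^R f)(g) = d/dt f(exp(tx) g)` at `t = 0`; it has the
same value at the identity as `x^L`. -/
def rightField : 𝔤 →ₗ[ℂ] Module.End ℂ A where
  toFun x := (TensorProduct.lid ℂ A).toLinearMap ∘ₗ
    LinearMap.rTensor A (Coalgebra.counit (R := ℂ) (A := A) ∘ₗ leftField e x) ∘ₗ
      Coalgebra.comul (R := ℂ) (A := A)
  map_add' x y := by
    simp [LinearMap.comp_add, LinearMap.add_comp, LinearMap.rTensor_add]
  map_smul' c x := by
    simp [LinearMap.comp_smul, LinearMap.smul_comp, LinearMap.rTensor_smul]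

/-- The bidifferential operator attached to an element of `𝔤 ⊗ 𝔤` by an action `φ` of `𝔤`:
`x ⊗ y` sends `(f, g)` to `(x f) (y g)`. -/
def bidiff (φ : 𝔤 →ₗ[ℂ] Module.End ℂ A) : 𝔤 ⊗[ℂ] 𝔤 →ₗ[ℂ] (A →ₗ[ℂ] A →ₗ[ℂ] A) :=
  TensorProduct.lift (LinearMap.mk₂ ℂ
    (fun x y => (LinearMap.mul ℂ A).compl₁₂ (φ x) (φ y))
    (fun x x' y => by ext f g; simp)
    (fun c x y => by ext f g; simp)
    (fun x y y' => by ext f g; simp [mul_add])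
    (fun c x y => by ext f g; simp))

/-- The bracket of the bivector field `Λ^L - Λ^R`. -/
def standardBracket (Λ : 𝔤 ⊗[ℂ] 𝔤) : A →ₗ[ℂ] A →ₗ[ℂ] A :=
  bidiff (leftField e) Λ - bidiff (rightField e) Λ

variable [FiniteDimensional ℂ 𝔤] [LieAlgebra.IsSemisimple ℂ 𝔤]
  {𝔱 : LieSubalgebra ℂ 𝔤} [𝔱.IsCartanSubalgebra]
  (b : (LieAlgebra.IsKilling.rootSystem 𝔱).Base)

/-- The connected subgroup `N` of `G` with Lie algebra `𝔫`, generated by `exp 𝔫`; it is the unipotent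
radical of the Borel subgroup with Lie algebra `𝔱 + 𝔫`. -/
def unipotentGroup : Subgroup (Points A) :=
  Subgroup.closure {n | ∃ x ∈ nilradical b, IsExp (e x) n}

/-- `ℂ[N\G]`: the regular functions `f` on `G` with `f(n g) = f(g)` for `n ∈ N`, `g ∈ G`. -/
def quotientRing : Subalgebra ℂ A where
  carrier := {f | ∀ n ∈ unipotentGroup e b, ∀ g : Points A, (n * g).ofConv f = g.ofConv f}
  mul_mem' := by
    intro f f' hf hf' n hn g
    rw [map_mul, map_mul, hf n hn g, hf' n hn g]
  add_mem' := by
    intro f f' hf hf' n hn g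
    rw [map_add, map_add, hf n hn g, hf' n hn g]
  algebraMap_mem' := by
    intro c n _ g
    rw [AlgHom.commutes, AlgHom.commutes]

/-- `ℂ[G]^ϖ`: the regular functions `f` on `G` with `f(exp(x) n g) = e^{-ϖ(x)} f(g)` for `x ∈ 𝔱`,
`n ∈ N`, `g ∈ G`. -/
def gradedPiece (ϖ : Module.Dual ℂ 𝔱) : Submodule ℂ A where
  carrier := {f | ∀ (x : 𝔱) (t : Points A), IsExp (e x) t → ∀ n ∈ unipotentGroup e b,
    ∀ g : Points A, (t * n * g).ofConv f = Complex.exp (-ϖ x) * g.ofConv f}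
  add_mem' := by
    intro f f' hf hf' x t ht n hn g
    rw [map_add, map_add, hf x t ht n hn g, hf' x t ht n hn g, mul_add]
  zero_mem' := by
    intro x t _ n _ g
    simp
  smul_mem' := by
    intro c f hf x t ht n hn g
    rw [map_smul, map_smul, hf x t ht n hn g, smul_eq_mul, smul_eq_mul]
    ring

/-- The action of `G` on `V` integrates the action of its Lie algebra `𝔤`. -/
def RatRep.Integrates {V : Type*} [AddCommGroup V] [Module ℂ V] [LieRingModule 𝔤 V]
    (ρ : RatRep A V) : Prop :=
  ∀ (x : 𝔤) (ξ : V), ρ.deriv (e x) ξ = ⁅x, ξ⁆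

end Bracket

end PoissonLieGroup

end

/-! The proof moves everything to the Lie algebra through one principle, `eq_zero_of_stable`: on a
connected group, a space of regular functions vanishing at the identity and stable under left
invariant derivations is zero (Taylor expansion plus Krull's intersection theorem). Hence two
constructions equivariant for the left invariant fields coincide once they agree at the identity.
Since every regular function lies in a finite-dimensional translation-stable space, exponentials
converge, and `mem_quotientRing_iff` and `mem_gradedPiece_iff` turn invariance under `N` and
semi-invariance under the torus into linear equations for right invariant fields.

On `ℂ[N\G]` each summand of `Λ^R` contains a right field from `𝔫`, so only `Λ^L` survives; left
fields commute with right fields, so they preserve the ring and its grading. For the Jacobi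
identity, the Jacobiator of `Λ^L - Λ^R` is the difference of the left and right trivector fields of
one Yang-Baxter tensor. Contraction with the Killing form turns `Λ_st` into the operator `1/2`, `0`,
`-1/2` on `𝔫`, `𝔱`, `𝔫₋`, which solves the modified Yang-Baxter equation. The tensor is then a
multiple of the Cartan 3-form, hence invariant, and an invariant tensor has equal left and right
trivector fields.

The grading comes from `nilInvariants_le_iSup`: on vectors killed by `e`, the identity `eⁿ fⁿ = n! ∏
(h - k)` and nilpotency of `f` make each simple coroot diagonalizable with eigenvalues in `ℕ`.

For matrix coefficients the point is that `v ⊗ w` kills the kernel of `p`. This is a comparison of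
lengths for a Weyl-invariant form: `v ⊗ w` can only pair with weights as long as its own, which is
at least as long as `ϖ + λ` because `ℂ[G]` is a domain (`weightForm_le_of_functional`), while every
weight of a lower constituent is strictly shorter (`weightForm_le`, `weightForm_lt_of_weightLT`).
Neither complete reducibility nor the longest Weyl group element is needed. -/

open scoped TensorProduct

noncomputable section

namespace PoissonLieGroup

/-! ### Convolution operators on a Hopf algebra -/

section Convolution

variable {A : Type*} [CommRing A] [HopfAlgebra ℂ A]

/-- The operator `f ↦ ∑ φ(f₂) f₁`, which commutes with left translations. -/
def convLeft (φ : A →ₗ[ℂ] ℂ) : A →ₗ[ℂ] A :=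
  (TensorProduct.rid ℂ A).toLinearMap ∘ₗ LinearMap.lTensor A φ ∘ₗ
    Coalgebra.comul (R := ℂ) (A := A)

/-- The operator `f ↦ ∑ φ(f₁) f₂`, which commutes with right translations. -/
def convRight (φ : A →ₗ[ℂ] ℂ) : A →ₗ[ℂ] A :=
  (TensorProduct.lid ℂ A).toLinearMap ∘ₗ LinearMap.rTensor A φ ∘ₗ
    Coalgebra.comul (R := ℂ) (A := A)

lemma convLeft_counit (f : A) : convLeft (Coalgebra.counit (R := ℂ) (A := A)) f = f := by
  simp [convLeft]

lemma convRight_counit (f : A) : convRight (Coalgebra.counit (R := ℂ) (A := A)) f = f := by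
  simp [convRight]

/-- Both sides are `(ψ ⊗ φ)(Δ f)`. This exchange is what allows an invariant operator to be
recovered from its value at the identity. -/
lemma apply_convLeft (φ ψ : A →ₗ[ℂ] ℂ) (f : A) : ψ (convLeft φ f) = φ (convRight ψ f) := by
  have : ψ ∘ₗ (TensorProduct.rid ℂ A).toLinearMap ∘ₗ LinearMap.lTensor A φ =
      φ ∘ₗ (TensorProduct.lid ℂ A).toLinearMap ∘ₗ LinearMap.rTensor A ψ := by
    ext x y
    simp [mul_comm]
  exact LinearMap.congr_fun this (Coalgebra.comul f)

lemma counit_convLeft (φ : A →ₗ[ℂ] ℂ) (f : A) :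
    Coalgebra.counit (R := ℂ) (convLeft φ f) = φ f := by
  rw [apply_convLeft, convRight_counit]

lemma counit_convRight (φ : A →ₗ[ℂ] ℂ) (f : A) :
    Coalgebra.counit (R := ℂ) (convRight φ f) = φ f := by
  rw [← apply_convLeft, convLeft_counit]

/-- Coassociativity: both sides are `∑ ψ(f₁) φ(f₃) f₂`. In particular left and right invariant
fields commute. -/
lemma convLeft_convRight (φ ψ : A →ₗ[ℂ] ℂ) (f : A) :
    convLeft φ (convRight ψ f) = convRight ψ (convLeft φ f) := by
  have key : ((TensorProduct.rid ℂ A).toLinearMap ∘ₗ LinearMap.lTensor A φ) ∘ₗ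
      ((TensorProduct.lid ℂ (A ⊗[ℂ] A)).toLinearMap ∘ₗ LinearMap.rTensor (A ⊗[ℂ] A) ψ) ∘ₗ
        (TensorProduct.assoc ℂ A A A).toLinearMap =
      ((TensorProduct.lid ℂ A).toLinearMap ∘ₗ LinearMap.rTensor A ψ) ∘ₗ
        ((TensorProduct.rid ℂ (A ⊗[ℂ] A)).toLinearMap ∘ₗ LinearMap.lTensor (A ⊗[ℂ] A) φ) := by
    apply TensorProduct.ext_threefold
    intro x y z
    simp only [LinearMap.comp_apply, LinearEquiv.coe_coe, LinearMap.lTensor_tmul,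
      TensorProduct.rid_tmul, LinearMap.rTensor_tmul, TensorProduct.smul_tmul', map_smul,
      TensorProduct.assoc_tmul, TensorProduct.lid_tmul]
    exact (smul_assoc (φ z) (ψ x) y).symm
  have h1 : ∀ t : A ⊗[ℂ] A, Coalgebra.comul (R := ℂ)
      ((TensorProduct.lid ℂ A) (LinearMap.rTensor A ψ t)) =
      (TensorProduct.lid ℂ (A ⊗[ℂ] A)) (LinearMap.rTensor (A ⊗[ℂ] A) ψ
        (LinearMap.lTensor A (Coalgebra.comul (R := ℂ)) t)) := by
    intro t
    induction t with
    | zero => simp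
    | tmul x y => simp
    | add x y hx hy => simp only [map_add, hx, hy]
  have h2 : ∀ t : A ⊗[ℂ] A, Coalgebra.comul (R := ℂ)
      ((TensorProduct.rid ℂ A) (LinearMap.lTensor A φ t)) =
      (TensorProduct.rid ℂ (A ⊗[ℂ] A)) (LinearMap.lTensor (A ⊗[ℂ] A) φ
        (LinearMap.rTensor A (Coalgebra.comul (R := ℂ)) t)) := by
    intro t
    induction t with
    | zero => simp
    | tmul x y => simp
    | add x y hx hy => simp only [map_add, hx, hy]
  have h3 := LinearMap.congr_fun key
    (LinearMap.rTensor A (Coalgebra.comul (R := ℂ)) (Coalgebra.comul (R := ℂ) f))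
  simp only [LinearMap.comp_apply, LinearEquiv.coe_coe, Coalgebra.coassoc_apply] at h3
  simp only [convLeft, convRight, LinearMap.comp_apply, LinearEquiv.coe_coe, h1, h2]
  exact h3

lemma eq_of_forall_dual {x y : A} (h : ∀ φ : A →ₗ[ℂ] ℂ, φ x = φ y) : x = y :=
  sub_eq_zero.mp ((Module.forall_dual_apply_eq_zero_iff ℂ (x - y)).mp fun φ => by
    rw [map_sub, h, sub_self])

/-- An operator commuting with all `convLeft φ` is determined by its values at the identity. -/
lemma eq_convRight_of_commute (T : A →ₗ[ℂ] A)
    (hT : ∀ φ f, T (convLeft φ f) = convLeft φ (T f)) :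
    T = convRight (Coalgebra.counit (R := ℂ) ∘ₗ T) := by
  ext f
  refine eq_of_forall_dual fun φ => ?_
  -- `φ (T f) = ε (convLeft φ (T f)) = ε (T (convLeft φ f))`, which involves only `ε ∘ T`.
  rw [← counit_convLeft φ (T f), ← hT, ← apply_convLeft, LinearMap.comp_apply]

lemma eq_convLeft_of_commute (T : A →ₗ[ℂ] A)
    (hT : ∀ φ f, T (convRight φ f) = convRight φ (T f)) :
    T = convLeft (Coalgebra.counit (R := ℂ) ∘ₗ T) := by
  ext f
  refine eq_of_forall_dual fun φ => ?_
  rw [← counit_convRight φ (T f), ← hT, apply_convLeft, LinearMap.comp_apply]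

lemma convRight_convRight (φ ψ : A →ₗ[ℂ] ℂ) (f : A) :
    convRight ψ (convRight φ f) = convRight (ψ ∘ₗ convRight φ) f := by
  have h := eq_convRight_of_commute (convRight ψ ∘ₗ convRight φ) (fun χ g => by
    simp [convLeft_convRight])
  have h2 : Coalgebra.counit (R := ℂ) ∘ₗ (convRight ψ ∘ₗ convRight φ) = ψ ∘ₗ convRight φ := by
    ext g
    simp [counit_convRight]
  rw [h2] at h
  exact LinearMap.congr_fun h f

/-- `d` is a point derivation at the identity. -/
def IsPointDerivation (d : A →ₗ[ℂ] ℂ) : Prop :=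
  ∀ f g, d (f * g) = Coalgebra.counit (R := ℂ) f * d g + Coalgebra.counit (R := ℂ) g * d f

lemma IsPointDerivation.convLeft_mul {d : A →ₗ[ℂ] ℂ} (hd : IsPointDerivation d) (f g : A) :
    convLeft d (f * g) = f * convLeft d g + g * convLeft d f := by
  -- On `A ⊗ A`, contraction with `d` is a derivation over contraction with the counit, and the
  -- latter returns `f` on `Δ f`.
  have key : ∀ s t : A ⊗[ℂ] A, (TensorProduct.rid ℂ A) (LinearMap.lTensor A d (s * t)) =
      (TensorProduct.rid ℂ A) (LinearMap.lTensor A (Coalgebra.counit (R := ℂ)) s) *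
        (TensorProduct.rid ℂ A) (LinearMap.lTensor A d t) +
      (TensorProduct.rid ℂ A) (LinearMap.lTensor A (Coalgebra.counit (R := ℂ)) t) *
        (TensorProduct.rid ℂ A) (LinearMap.lTensor A d s) := by
    intro s t
    induction s with
    | zero => simp
    | add x y hx hy => simp only [add_mul, map_add, hx, hy, mul_add]; ring
    | tmul x y =>
      induction t with
      | zero => simp
      | add x y hx hy => simp only [add_mul, map_add, hx, hy, mul_add]; ring
      | tmul z w =>
        simp only [Algebra.TensorProduct.tmul_mul_tmul, LinearMap.lTensor_tmul,
          TensorProduct.rid_tmul, hd y w, Algebra.smul_def, map_add, map_mul]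
        ring
  have h := key (Coalgebra.comul f) (Coalgebra.comul g)
  rw [← Bialgebra.comul_mul] at h
  simpa [convLeft] using h

lemma IsPointDerivation.convRight_mul {d : A →ₗ[ℂ] ℂ} (hd : IsPointDerivation d) (f g : A) :
    convRight d (f * g) = f * convRight d g + g * convRight d f := by
  have key : ∀ s t : A ⊗[ℂ] A, (TensorProduct.lid ℂ A) (LinearMap.rTensor A d (s * t)) =
      (TensorProduct.lid ℂ A) (LinearMap.rTensor A (Coalgebra.counit (R := ℂ)) s) *
        (TensorProduct.lid ℂ A) (LinearMap.rTensor A d t) +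
      (TensorProduct.lid ℂ A) (LinearMap.rTensor A (Coalgebra.counit (R := ℂ)) t) *
        (TensorProduct.lid ℂ A) (LinearMap.rTensor A d s) := by
    intro s t
    induction s with
    | zero => simp
    | add x y hx hy => simp only [add_mul, map_add, hx, hy, mul_add]; ring
    | tmul x y =>
      induction t with
      | zero => simp
      | add x y hx hy => simp only [add_mul, map_add, hx, hy, mul_add]; ring
      | tmul z w =>
        simp only [Algebra.TensorProduct.tmul_mul_tmul, LinearMap.rTensor_tmul,
          TensorProduct.lid_tmul, hd x z, Algebra.smul_def, map_add, map_mul]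
        ring
  have h := key (Coalgebra.comul f) (Coalgebra.comul g)
  rw [← Bialgebra.comul_mul] at h
  simpa [convRight] using h

lemma lieAlg_convRight (D : lieAlg A) (φ : A →ₗ[ℂ] ℂ) (f : A) :
    (D : Derivation ℂ A A) (convRight φ f) = convRight φ ((D : Derivation ℂ A A) f) := by
  have hD := LinearMap.congr_fun D.2 f
  simp only [LinearMap.comp_apply, Derivation.coeFn_coe] at hD
  have key : ∀ t : A ⊗[ℂ] A, (D : Derivation ℂ A A)
      ((TensorProduct.lid ℂ A) (LinearMap.rTensor A φ t)) =
      (TensorProduct.lid ℂ A) (LinearMap.rTensor A φ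
        (LinearMap.lTensor A ((D : Derivation ℂ A A) : A →ₗ[ℂ] A) t)) := by
    intro t
    induction t with
    | zero => simp
    | tmul x y => simp
    | add x y hx hy => simp only [map_add, hx, hy]
  simp only [convRight, LinearMap.comp_apply, LinearEquiv.coe_coe, key]
  rw [hD]

/-- The point derivation of a left invariant derivation. -/
def atOne (D : lieAlg A) : A →ₗ[ℂ] ℂ :=
  Coalgebra.counit (R := ℂ) ∘ₗ ((D : Derivation ℂ A A) : A →ₗ[ℂ] A)

lemma atOne_apply (D : lieAlg A) (f : A) :
    atOne D f = Coalgebra.counit (R := ℂ) ((D : Derivation ℂ A A) f) := rfl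

lemma isPointDerivation_atOne (D : lieAlg A) : IsPointDerivation (atOne D) := by
  intro f g
  simp [atOne_apply, Derivation.leibniz]

lemma lieAlg_eq_convLeft (D : lieAlg A) (f : A) :
    (D : Derivation ℂ A A) f = convLeft (atOne D) f :=
  LinearMap.congr_fun (eq_convLeft_of_commute ((D : Derivation ℂ A A) : A →ₗ[ℂ] A)
    (lieAlg_convRight D)) f

/-- A point derivation at the identity extends to a left invariant derivation. -/
def IsPointDerivation.toLieAlg {d : A →ₗ[ℂ] ℂ} (hd : IsPointDerivation d) : lieAlg A :=
  ⟨Derivation.mk' (convLeft d) (fun f g => by simpa using hd.convLeft_mul f g), by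
    change Coalgebra.comul (R := ℂ) (A := A) ∘ₗ convLeft d =
      LinearMap.lTensor A (convLeft d) ∘ₗ Coalgebra.comul (R := ℂ) (A := A)
    have h : ∀ t : A ⊗[ℂ] A, Coalgebra.comul (R := ℂ)
        ((TensorProduct.rid ℂ A) (LinearMap.lTensor A d t)) =
        (TensorProduct.rid ℂ (A ⊗[ℂ] A)) (LinearMap.lTensor (A ⊗[ℂ] A) d
          (LinearMap.rTensor A (Coalgebra.comul (R := ℂ)) t)) := by
      intro t
      induction t with
      | zero => simp
      | tmul x y => simp
      | add x y hx hy => simp only [map_add, hx, hy]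
    have h' : (TensorProduct.rid ℂ (A ⊗[ℂ] A)).toLinearMap ∘ₗ LinearMap.lTensor (A ⊗[ℂ] A) d =
        LinearMap.lTensor A ((TensorProduct.rid ℂ A).toLinearMap ∘ₗ LinearMap.lTensor A d) ∘ₗ
          (TensorProduct.assoc ℂ A A A).toLinearMap := by
      apply TensorProduct.ext_threefold
      intro x y z
      simp
    have h'' : ∀ t : A ⊗[ℂ] A, LinearMap.lTensor A (convLeft d) t =
        LinearMap.lTensor A ((TensorProduct.rid ℂ A).toLinearMap ∘ₗ LinearMap.lTensor A d)
          (LinearMap.lTensor A (Coalgebra.comul (R := ℂ)) t) := by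
      intro t
      rw [convLeft, ← LinearMap.comp_assoc, LinearMap.lTensor_comp, LinearMap.comp_apply]
    ext f
    rw [LinearMap.comp_apply, LinearMap.comp_apply, h'', ← Coalgebra.coassoc_apply]
    rw [convLeft, LinearMap.comp_apply, LinearMap.comp_apply]
    exact (h _).trans (LinearMap.congr_fun h' _)⟩

lemma IsPointDerivation.toLieAlg_apply {d : A →ₗ[ℂ] ℂ} (hd : IsPointDerivation d) (f : A) :
    (hd.toLieAlg : Derivation ℂ A A) f = convLeft d f := rfl

lemma points_mul_apply (g h : Points A) (f : A) :
    (g * h).ofConv f = h.ofConv (convRight g.ofConv.toLinearMap f) := by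
  have key : ∀ t : A ⊗[ℂ] A, Algebra.TensorProduct.lift g.ofConv h.ofConv (fun _ _ => .all ..) t =
      h.ofConv ((TensorProduct.lid ℂ A) (LinearMap.rTensor A g.ofConv.toLinearMap t)) := by
    intro t
    induction t with
    | zero => simp
    | tmul x y => simp
    | add x y hx hy => simp only [map_add, hx, hy]
  exact (AlgHom.convMul_apply g h f).trans (key _)

lemma points_mul_apply' (g h : Points A) (f : A) :
    (g * h).ofConv f = g.ofConv (convLeft h.ofConv.toLinearMap f) := by
  rw [points_mul_apply]
  exact (apply_convLeft h.ofConv.toLinearMap g.ofConv.toLinearMap f).symm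

/-- Every regular function lies in a finite-dimensional space stable under all `convRight φ`. -/
lemma exists_finiteDimensional_convRight_stable (f : A) :
    ∃ F : Submodule ℂ A, FiniteDimensional ℂ F ∧ f ∈ F ∧
      ∀ φ, ∀ g ∈ F, convRight φ g ∈ F := by
  -- The space of all convolutes of `f`; it is contained in the span of the finitely many right
  -- tensor factors of `Δ f`.
  let L : (A →ₗ[ℂ] ℂ) →ₗ[ℂ] A :=
    { toFun := fun φ => convRight φ f
      map_add' := fun φ ψ => by simp [convRight, LinearMap.rTensor_add]
      map_smul' := fun c φ => by simp [convRight, LinearMap.rTensor_smul] }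
  refine ⟨LinearMap.range L, ?_, ⟨_, convRight_counit f⟩, ?_⟩
  · let R := Coalgebra.Repr.arbitrary ℂ f
    have hle : LinearMap.range L ≤ Submodule.span ℂ (R.right '' R.index) := by
      rintro _ ⟨φ, rfl⟩
      change convRight φ f ∈ _
      rw [convRight, LinearMap.comp_apply, LinearMap.comp_apply, ← R.eq, map_sum, map_sum]
      refine Submodule.sum_mem _ fun i hi => ?_
      simp only [LinearMap.rTensor_tmul, LinearEquiv.coe_coe, TensorProduct.lid_tmul]
      exact Submodule.smul_mem _ _ (Submodule.subset_span ⟨i, hi, rfl⟩)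
    have : FiniteDimensional ℂ (Submodule.span ℂ (R.right '' R.index)) :=
      FiniteDimensional.span_of_finite ℂ (R.index.finite_toSet.image _)
    exact Submodule.finiteDimensional_of_le hle
  · rintro φ _ ⟨ψ, rfl⟩
    exact ⟨φ ∘ₗ convRight ψ, (convRight_convRight ψ φ f).symm⟩

end Convolution

/-! ### Subspaces stable under left invariant derivations -/

section Connected

variable {A : Type*} [CommRing A] [HopfAlgebra ℂ A]

variable (A) in
/-- The augmentation ideal. -/
def augIdeal : Ideal A := RingHom.ker (Bialgebra.counitAlgHom ℂ A)

lemma mem_augIdeal {f : A} : f ∈ augIdeal A ↔ Coalgebra.counit (R := ℂ) f = 0 := Iff.rfl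

lemma sub_algebraMap_counit_mem (f : A) :
    f - algebraMap ℂ A (Coalgebra.counit (R := ℂ) f) ∈ augIdeal A := by
  simp [mem_augIdeal]

/-- There are finitely many elements `y i` of the augmentation ideal and left invariant derivations
`D i` such that `∑ y i * D i` is the identity on the cotangent space at the identity. -/
lemma exists_dual_derivations [Algebra.FiniteType ℂ A] :
    ∃ (n : ℕ) (y : Fin n → A) (D : Fin n → lieAlg A), (∀ i, y i ∈ augIdeal A) ∧
      ∀ a ∈ augIdeal A, (∑ i, y i * (D i : Derivation ℂ A A) a) - a ∈ augIdeal A ^ 2 := by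
  have : IsNoetherianRing A := Algebra.FiniteType.isNoetherianRing ℂ A
  obtain ⟨s, hs⟩ := (isNoetherianRing_iff_ideal_fg A).mp inferInstance (augIdeal A)
  set M2 : Submodule ℂ A := (augIdeal A ^ 2).restrictScalars ℂ with hM2
  set π := M2.mkQ with hπ
  have hπ0 : ∀ a, π a = 0 ↔ a ∈ augIdeal A ^ 2 := fun a => by
    rw [hπ, Submodule.mkQ_apply, Submodule.Quotient.mk_eq_zero]; rfl
  have hsub : ∀ x ∈ s, x ∈ augIdeal A := fun x hx => hs ▸ Submodule.subset_span hx
  -- The cotangent space `I / I²`: since `A` acts on it through the counit, the complex span of the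
  -- ideal generators is already all of it.
  set W : Submodule ℂ (A ⧸ M2) := Submodule.span ℂ (π '' s) with hW
  have hWfin : FiniteDimensional ℂ W :=
    FiniteDimensional.span_of_finite ℂ (s.finite_toSet.image _)
  have hmem : ∀ a ∈ augIdeal A, π a ∈ W := by
    intro a ha
    rw [← hs] at ha
    induction ha using Submodule.span_induction with
    | mem x hx => exact Submodule.subset_span ⟨x, hx, rfl⟩
    | zero => simp
    | add x y _ _ hx hy => rw [map_add]; exact add_mem hx hy
    | smul c x hx' hx =>
      have hx2 : x ∈ augIdeal A := hs ▸ hx'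
      have : π (c • x) = (Coalgebra.counit (R := ℂ) c) • π x := by
        rw [← map_smul, ← sub_eq_zero, ← map_sub, hπ0, smul_eq_mul, Algebra.smul_def, ← sub_mul,
          pow_two]
        exact Ideal.mul_mem_mul (sub_algebraMap_counit_mem c) hx2
      rw [this]
      exact W.smul_mem _ hx
  have hlift : ∀ w ∈ W, ∃ a ∈ augIdeal A, π a = w := by
    intro w hw
    induction hw using Submodule.span_induction with
    | mem x hx => obtain ⟨a, ha, rfl⟩ := hx; exact ⟨a, hsub a ha, rfl⟩
    | zero => exact ⟨0, zero_mem _, map_zero _⟩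
    | add x y _ _ hx hy =>
      obtain ⟨a, ha, rfl⟩ := hx
      obtain ⟨b, hb, rfl⟩ := hy
      exact ⟨a + b, add_mem ha hb, map_add _ _ _⟩
    | smul c x _ hx =>
      obtain ⟨a, ha, rfl⟩ := hx
      exact ⟨c • a, by rw [Algebra.smul_def]; exact Ideal.mul_mem_left _ _ ha, map_smul _ _ _⟩
  obtain ⟨P, hP⟩ := W.subtype.exists_leftInverse_of_injective (by simp)
  have hP' : ∀ w : W, P w = w := fun w => LinearMap.congr_fun hP w
  let β := Module.finBasis ℂ W
  choose y hy hyβ using fun i => hlift (β i) (β i).2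
  -- Coordinates on `I / I²`, extended to `A` by removing the constant term and projecting `A / I²`
  -- onto `W`. They kill constants and `I²`, hence are point derivations.
  let d : Fin (Module.finrank ℂ W) → A →ₗ[ℂ] ℂ := fun i =>
    β.coord i ∘ₗ P ∘ₗ π ∘ₗ (LinearMap.id - Algebra.linearMap ℂ A ∘ₗ Coalgebra.counit (R := ℂ))
  have hd : ∀ i, IsPointDerivation (d i) := by
    intro i f g
    have h1 : π (f * g - algebraMap ℂ A (Coalgebra.counit (R := ℂ) (f * g))) =
        Coalgebra.counit (R := ℂ) f • π (g - algebraMap ℂ A (Coalgebra.counit (R := ℂ) g)) +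
        Coalgebra.counit (R := ℂ) g • π (f - algebraMap ℂ A (Coalgebra.counit (R := ℂ) f)) := by
      rw [← map_smul, ← map_smul, ← map_add, ← sub_eq_zero, ← map_sub, hπ0]
      have := Ideal.mul_mem_mul (sub_algebraMap_counit_mem f) (sub_algebraMap_counit_mem g)
      rw [← pow_two] at this
      convert this using 1
      simp only [Bialgebra.counit_mul, map_mul, Algebra.smul_def]
      ring
    have h2 : ∀ a, d i a = β.coord i (P (π (a - algebraMap ℂ A (Coalgebra.counit (R := ℂ) a)))) :=
      fun a => rfl
    rw [h2, h2, h2, h1]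
    simp only [map_add, map_smul, smul_eq_mul]
  refine ⟨_, y, fun i => (hd i).toLieAlg, hy, fun a ha => ?_⟩
  have hda : ∀ i, d i a = β.coord i ⟨π a, hmem a ha⟩ := by
    intro i
    have : P (π (a - algebraMap ℂ A (Coalgebra.counit (R := ℂ) a))) = ⟨π a, hmem a ha⟩ := by
      rw [mem_augIdeal.mp ha, map_zero, sub_zero]
      exact hP' ⟨π a, hmem a ha⟩
    exact congrArg (β.coord i) this
  have h1 : (∑ i, y i * algebraMap ℂ A (d i a)) - a ∈ augIdeal A ^ 2 := by
    rw [← hπ0, map_sub, map_sum]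
    have h3 : ∀ i, π (y i * algebraMap ℂ A (d i a)) =
        W.subtype (β.coord i ⟨π a, hmem a ha⟩ • β i) := by
      intro i
      rw [map_smul, Submodule.subtype_apply, ← hyβ, ← hda, ← map_smul, Algebra.smul_def, mul_comm]
    rw [Finset.sum_congr rfl fun i _ => h3 i, ← map_sum]
    simp only [Module.Basis.coord_apply, Module.Basis.sum_repr]
    simp
  -- `D i a` differs from its value at the identity by an element of `I`, and `y i` supplies a
  -- second factor in `I`.
  have h2 : (∑ i, y i * (convLeft (d i) a - algebraMap ℂ A (d i a))) ∈ augIdeal A ^ 2 := by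
    refine Ideal.sum_mem _ fun i _ => ?_
    rw [pow_two]
    refine Ideal.mul_mem_mul (hy i) ?_
    have := sub_algebraMap_counit_mem (convLeft (d i) a)
    rwa [counit_convLeft] at this
  have := add_mem h1 h2
  convert this using 1
  simp only [mul_sub, Finset.sum_sub_distrib]
  simp only [IsPointDerivation.toLieAlg_apply]
  ring

/-- On a connected group, a subspace of regular functions vanishing at the identity and stable under
all left invariant derivations is zero. -/
theorem eq_zero_of_stable [IsDomain A] [Algebra.FiniteType ℂ A] (S : Submodule ℂ A)
    (hS : ∀ D : lieAlg A, ∀ f ∈ S, (D : Derivation ℂ A A) f ∈ S)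
    (h0 : ∀ f ∈ S, Coalgebra.counit (R := ℂ) f = 0) : ∀ f ∈ S, f = 0 := by
  have : IsNoetherianRing A := Algebra.FiniteType.isNoetherianRing ℂ A
  obtain ⟨n, y, D, hy, hE⟩ := exists_dual_derivations (A := A)
  -- An Euler field: it acts on `I ^ k / I ^ (k + 1)` as multiplication by `k`, whether or not the
  -- graded ring is known to be polynomial.
  set E : A → A := fun a => ∑ i, y i * (D i : Derivation ℂ A A) a with hEdef
  have hEadd : ∀ a b, E (a + b) = E a + E b := fun a b => by
    simp [hEdef, mul_add, Finset.sum_add_distrib]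
  have hEmul : ∀ a b, E (a * b) = a * E b + b * E a := fun a b => by
    simp only [hEdef, Derivation.leibniz, smul_eq_mul, Finset.mul_sum, ← Finset.sum_add_distrib]
    exact Finset.sum_congr rfl fun i _ => by ring
  have hEmem : ∀ a, E a ∈ augIdeal A := fun a =>
    Ideal.sum_mem _ fun i _ => Ideal.mul_mem_right _ _ (hy i)
  have euler : ∀ k : ℕ, ∀ f ∈ augIdeal A ^ k, E f - k * f ∈ augIdeal A ^ (k + 1) := by
    intro k
    induction k with
    | zero =>
      intro f _
      simpa using hEmem f
    | succ k ih =>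
      intro f hf
      rw [pow_succ'] at hf
      refine Submodule.mul_induction_on hf ?_ ?_
      · intro a ha g hg
        have h1 : a * (E g - k * g) ∈ augIdeal A ^ (k + 1 + 1) := by
          rw [pow_succ' _ (k + 1)]
          exact Ideal.mul_mem_mul ha (ih g hg)
        have h2 : (E a - a) * g ∈ augIdeal A ^ (k + 1 + 1) := by
          rw [show k + 1 + 1 = 2 + k by ring, pow_add]
          exact Ideal.mul_mem_mul (hE a ha) hg
        have := add_mem h1 h2
        convert this using 1
        rw [hEmul]
        push_cast
        ring
      · intro a b ha hb
        have := add_mem ha hb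
        convert this using 1
        rw [hEadd]
        ring
  -- If `S ⊆ I ^ (k + 1)`, then every `D i f` is in there too, so `E f` lies one power deeper; but
  -- `E f` is `(k + 1) f` modulo that power, and `k + 1` is invertible.
  have hk : ∀ k : ℕ, ∀ f ∈ S, f ∈ augIdeal A ^ (k + 1) := by
    intro k
    induction k with
    | zero => intro f hf; simpa using mem_augIdeal.mpr (h0 f hf)
    | succ k ih =>
      intro f hf
      have h1 : E f ∈ augIdeal A ^ (k + 1 + 1) := by
        refine Ideal.sum_mem _ fun i _ => ?_
        rw [pow_succ' _ (k + 1)]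
        exact Ideal.mul_mem_mul (hy i) (ih _ (hS _ f hf))
      have h2 := sub_mem h1 (euler (k + 1) f (ih f hf))
      rw [sub_sub_cancel] at h2
      have h3 := Ideal.mul_mem_left _ (algebraMap ℂ A ((k + 1 : ℕ) : ℂ)⁻¹) h2
      rw [← mul_assoc, ← map_natCast (algebraMap ℂ A), ← map_mul, inv_mul_cancel₀
        (Nat.cast_ne_zero.mpr k.succ_ne_zero), map_one, one_mul] at h3
      exact h3
  intro f hf
  have hne : augIdeal A ≠ ⊤ := RingHom.ker_ne_top _
  -- Krull's intersection theorem; connectedness of the group enters here, as `A` being a domain.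
  have hbot := Ideal.iInf_pow_eq_bot_of_isDomain (augIdeal A) hne
  have : f ∈ ⨅ i : ℕ, augIdeal A ^ i := by
    rw [Ideal.mem_iInf]
    rintro (_ | i)
    · simp
    · exact hk i f hf
  rwa [hbot, Ideal.mem_bot] at this

/-- Regular functions are determined by their values at the points. -/
theorem eq_of_forall_point [IsDomain A] [Algebra.FiniteType ℂ A] {f f' : A}
    (h : ∀ g : Points A, g.ofConv f = g.ofConv f') : f = f' := by
  -- Nullstellensatz: all residue fields of `A` at maximal ideals are `ℂ`, so a function vanishing
  -- at every point lies in the Jacobson radical, which is zero.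
  have hJ : IsJacobsonRing A := isJacobsonRing_of_finiteType (A := ℂ)
  have hbot : (⊥ : Ideal A).jacobson = ⊥ :=
    hJ.out ((Ideal.isPrime_bot (α := A)).isRadical)
  have hmem : f - f' ∈ (⊥ : Ideal A).jacobson := by
    rw [Ideal.jacobson, Ideal.mem_sInf]
    rintro m ⟨-, hm⟩
    have hfin : Module.Finite ℂ (A ⧸ m) := by
      let _ : Field (A ⧸ m) := Ideal.Quotient.field m
      exact finite_of_finite_type_of_isJacobsonRing ℂ (A ⧸ m)
    have hbij : Function.Bijective (algebraMap ℂ (A ⧸ m)) := by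
      have := hm.isPrime
      exact IsAlgClosed.algebraMap_bijective_of_isIntegral
    let φ : A →ₐ[ℂ] ℂ :=
      ((AlgEquiv.ofBijective (Algebra.ofId ℂ (A ⧸ m)) hbij).symm : (A ⧸ m) →ₐ[ℂ] ℂ).comp
        (Ideal.Quotient.mkₐ ℂ m)
    have h1 := h (WithConv.toConv φ)
    have h2 : φ (f - f') = 0 := by
      rw [map_sub, sub_eq_zero]
      exact h1
    have h3 : Ideal.Quotient.mkₐ ℂ m (f - f') = 0 := by
      exact (EmbeddingLike.map_eq_zero_iff
        (f := (AlgEquiv.ofBijective (Algebra.ofId ℂ (A ⧸ m)) hbij).symm)).mp h2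
    exact Ideal.Quotient.eq_zero_iff_mem.mp h3
  rw [hbot, Ideal.mem_bot, sub_eq_zero] at hmem
  exact hmem

end Connected

/-! ### Exponentials -/

section Exponential

/-- The entire function is `φ(exp(tT) v)`. Coordinates on `V` move the question to the Banach
algebra of operators on `Fin n → ℂ`. -/
lemma exists_hasSum_exp {V : Type*} [AddCommGroup V] [Module ℂ V] [FiniteDimensional ℂ V]
    (T : Module.End ℂ V) (φ : V →ₗ[ℂ] ℂ) (v : V) :
    ∃ E : ℂ → ℂ, (∀ t, HasSum (fun k : ℕ => ((k.factorial : ℂ))⁻¹ * φ (((t • T) ^ k) v)) (E t)) ∧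
      HasDerivAt E (φ (T v)) 0 := by
  let L := (Module.finBasis ℂ V).equivFun
  let W := Fin (Module.finrank ℂ V) → ℂ
  let T' : W →L[ℂ] W := LinearMap.toContinuousLinearMap (L.toLinearMap ∘ₗ T ∘ₗ L.symm.toLinearMap)
  have hT' : ∀ w, T' w = L (T (L.symm w)) := fun w => rfl
  let ψ : (W →L[ℂ] W) →L[ℂ] ℂ := (LinearMap.toContinuousLinearMap (φ ∘ₗ L.symm.toLinearMap)) ∘L
    (ContinuousLinearMap.apply ℂ W (L v))
  have hψ : ∀ S, ψ S = φ (L.symm (S (L v))) := fun S => rfl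
  have hpow : ∀ (t : ℂ) (k : ℕ), L.symm (((t • T') ^ k) (L v)) = ((t • T) ^ k) v := by
    intro t k
    induction k with
    | zero => simp
    | succ k ih =>
      rw [pow_succ', pow_succ', mul_apply_eq_comp, Module.End.mul_apply, ← ih]
      simp [hT']
  refine ⟨fun t => ψ (NormedSpace.exp (t • T')), fun t => ?_, ?_⟩
  · have h := (NormedSpace.exp_series_hasSum_exp' (𝕂 := ℂ) (t • T')).mapL ψ
    convert h using 2 with k
    rw [map_smul, smul_eq_mul, hψ, hpow]
  · have h := hasDerivAt_exp_smul_const (𝕂 := ℂ) T' (0 : ℂ)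
    have h2 := ψ.hasFDerivAt.comp_hasDerivAt (0 : ℂ) h
    refine h2.congr_deriv ?_
    have h0 : (0 : ℂ) • T' = 0 := by ext; simp
    rw [h0, NormedSpace.exp_zero, one_mul, hψ, hT', LinearEquiv.symm_apply_apply,
      LinearEquiv.symm_apply_apply]

variable {A : Type*} [CommRing A] [HopfAlgebra ℂ A]

/-- Left and right fields agree at the identity and commute, so they can be exchanged one factor at
a time. The right-hand form lives on a finite-dimensional stable space, which gives convergence. -/
lemma counit_iterate (D : lieAlg A) (k : ℕ) (f : A) :
    Coalgebra.counit (R := ℂ) ((D : Derivation ℂ A A)^[k] f) =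
      Coalgebra.counit (R := ℂ) ((convRight (atOne D) ^ k) f) := by
  have hcomm : ∀ (k : ℕ) (f : A), (convRight (atOne D) ^ k) ((D : Derivation ℂ A A) f) =
      (D : Derivation ℂ A A) ((convRight (atOne D) ^ k) f) := by
    intro k
    induction k with
    | zero => simp
    | succ k ih =>
      intro f
      rw [pow_succ', Module.End.mul_apply, Module.End.mul_apply, ih, lieAlg_convRight]
  induction k generalizing f with
  | zero => simp
  | succ k ih =>
    rw [Function.iterate_succ_apply, ih, hcomm, pow_succ', Module.End.mul_apply, counit_convRight]
    rfl

/-- The exponential series of a right invariant vector field, evaluated by a functional. -/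
lemma exists_hasSum_convRight (D : lieAlg A) (φ : A →ₗ[ℂ] ℂ) (f : A) :
    ∃ E : ℂ → ℂ, (∀ t : ℂ, HasSum (fun k : ℕ => ((k.factorial : ℂ))⁻¹ *
      φ ((convRight (atOne (t • D)) ^ k) f)) (E t)) ∧
      HasDerivAt E (φ (convRight (atOne D) f)) 0 := by
  obtain ⟨F, hF, hfF, hstab⟩ := exists_finiteDimensional_convRight_stable f
  let T : Module.End ℂ F := (convRight (atOne D)).restrict (hstab (atOne D))
  obtain ⟨E, hE, hE'⟩ := exists_hasSum_exp T (φ ∘ₗ F.subtype) ⟨f, hfF⟩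
  have hT : ∀ x, F.subtype (T x) = convRight (atOne D) x := fun x => rfl
  have hsm : ∀ (t : ℂ), convRight (atOne (t • D)) = t • convRight (atOne D) := by
    intro t
    ext g
    have : atOne (t • D) = t • atOne D := by ext g; simp [atOne_apply]
    rw [this]
    simp [convRight, LinearMap.rTensor_smul]
  refine ⟨E, fun t => ?_, hE'⟩
  convert hE t using 3 with k
  have : ∀ x : F, ((convRight (atOne (t • D)) ^ k) x) = F.subtype (((t • T) ^ k) x) := by
    induction k with
    | zero => intro x; simp
    | succ k ih =>
      intro x
      rw [pow_succ', pow_succ', Module.End.mul_apply, Module.End.mul_apply, ih, hsm]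
      simp [T]
  rw [LinearMap.comp_apply, ← this]

/-- Against the factorials, this higher Leibniz rule becomes the Cauchy product that makes the
exponential an algebra homomorphism. -/
lemma derivation_iterate_mul (D : Derivation ℂ A A) (n : ℕ) (f g : A) :
    D^[n] (f * g) = ∑ ij ∈ Finset.HasAntidiagonal.antidiagonal n,
      (n.choose ij.1 : A) * (D^[ij.1] f * D^[ij.2] g) := by
  induction n with
  | zero => simp
  | succ n ih =>
    rw [Function.iterate_succ_apply', ih, map_sum,
      Finset.sum_antidiagonal_choose_succ_mul (fun i j => D^[i] f * D^[j] g),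
      ← Finset.sum_add_distrib]
    refine Finset.sum_congr rfl fun ij hij => ?_
    rw [Finset.HasAntidiagonal.mem_antidiagonal] at hij
    rw [← Nat.choose_symm_of_eq_add hij.symm, Function.iterate_succ_apply',
      Function.iterate_succ_apply', Derivation.leibniz, Derivation.leibniz,
      Derivation.map_natCast]
    simp only [smul_eq_mul]
    ring

/-- Every element of the Lie algebra exponentiates. -/
theorem exists_isExp (D : lieAlg A) : ∃ g : Points A, IsExp D g := by
  let a : A → ℕ → ℂ := fun f k =>
    ((k.factorial : ℂ))⁻¹ * Coalgebra.counit (R := ℂ) ((D : Derivation ℂ A A)^[k] f)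
  have ha : ∀ f, Summable (a f) := by
    intro f
    obtain ⟨E, hE, -⟩ := exists_hasSum_convRight D (Coalgebra.counit (R := ℂ)) f
    have := hE 1
    simp only [one_smul, ← counit_iterate] at this
    exact this.summable
  have hit0 : ∀ k, (D : Derivation ℂ A A)^[k] 0 = 0 := fun k =>
    Function.iterate_fixed (map_zero _) k
  have hconst : ∀ c : ℂ, ∀ k, k ≠ 0 → a (algebraMap ℂ A c) k = 0 := by
    rintro c (_ | k) hk
    · exact absurd rfl hk
    · simp [a, hit0]
  have hadd : ∀ k f g, (D : Derivation ℂ A A)^[k] (f + g) =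
      (D : Derivation ℂ A A)^[k] f + (D : Derivation ℂ A A)^[k] g := by
    intro k
    induction k with
    | zero => simp
    | succ k ih => intro f g; simp only [Function.iterate_succ_apply, map_add, ih]
  have hcomm : ∀ c : ℂ, ∑' k, a (algebraMap ℂ A c) k = c := by
    intro c
    rw [tsum_eq_single 0 fun k hk => hconst c k hk]
    simp [a]
  have hmul : ∀ f g, ∑' k, a (f * g) k = (∑' k, a f k) * ∑' k, a g k := by
    intro f g
    rw [tsum_mul_tsum_eq_tsum_sum_antidiagonal_of_summable_norm (ha f).norm (ha g).norm]
    refine tsum_congr fun n => ?_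
    simp only [a]
    rw [derivation_iterate_mul, map_sum, Finset.mul_sum]
    refine Finset.sum_congr rfl fun ij hij => ?_
    rw [Finset.HasAntidiagonal.mem_antidiagonal] at hij
    subst hij
    rw [Bialgebra.counit_mul, Bialgebra.counit_mul, Bialgebra.counit_natCast,
      Nat.cast_add_choose]
    have h1 : (((ij.1 + ij.2).factorial : ℕ) : ℂ) ≠ 0 := by exact_mod_cast Nat.factorial_ne_zero _
    have h2 : ((ij.1.factorial : ℕ) : ℂ) ≠ 0 := by exact_mod_cast Nat.factorial_ne_zero _
    have h3 : ((ij.2.factorial : ℕ) : ℂ) ≠ 0 := by exact_mod_cast Nat.factorial_ne_zero _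
    field_simp
  refine ⟨WithConv.toConv
    { toFun := fun f => ∑' k, a f k
      map_one' := by simpa using hcomm 1
      map_mul' := hmul
      map_zero' := by simpa using hcomm 0
      map_add' := fun f g => by
        rw [← (ha f).tsum_add (ha g)]
        exact tsum_congr fun k => by simp only [a, hadd, map_add, mul_add]
      commutes' := hcomm }, fun f => (ha f).hasSum⟩

/-- Left translation by an exponential is the exponential of the right invariant vector field. -/
lemma IsExp.hasSum_mul {D : lieAlg A} {g : Points A} (hg : IsExp D g) (h : Points A) (f : A) :
    HasSum (fun k : ℕ => ((k.factorial : ℂ))⁻¹ * h.ofConv ((convRight (atOne D) ^ k) f))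
      ((g * h).ofConv f) := by
  rw [points_mul_apply']
  convert hg (convLeft h.ofConv.toLinearMap f) using 3 with k
  have hcomm : ∀ (k : ℕ) (f : A),
      (convRight (atOne D) ^ k) (convLeft h.ofConv.toLinearMap f) =
      convLeft h.ofConv.toLinearMap ((convRight (atOne D) ^ k) f) := by
    intro k
    induction k with
    | zero => simp
    | succ k ih =>
      intro f
      rw [pow_succ', Module.End.mul_apply, Module.End.mul_apply, ih, convLeft_convRight]
  rw [counit_iterate, hcomm, counit_convLeft]
  rfl

lemma isExp_zero : IsExp (0 : lieAlg A) 1 := by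
  intro f
  have h : ∀ k : ℕ, k ≠ 0 → ((k.factorial : ℂ))⁻¹ *
      Coalgebra.counit (R := ℂ) (((0 : lieAlg A) : Derivation ℂ A A)^[k] f) = 0 := by
    rintro (_ | k) hk
    · exact absurd rfl hk
    · rw [Function.iterate_succ_apply']
      simp
  have := hasSum_single 0 h
  simpa using this

end Exponential

/-! ### Invariance under subgroups and infinitesimal invariance -/

section Invariance

variable {𝔤 : Type*} [LieRing 𝔤] [LieAlgebra ℂ 𝔤]
  {A : Type*} [CommRing A] [HopfAlgebra ℂ A] (e : 𝔤 ≃ₗ⁅ℂ⁆ lieAlg A)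

lemma rightField_eq (x : 𝔤) : rightField e x = convRight (atOne (e x)) := rfl

lemma leftField_eq (x : 𝔤) : leftField e x = convLeft (atOne (e x)) :=
  LinearMap.ext fun f => lieAlg_eq_convLeft (e x) f

lemma leftField_apply (x : 𝔤) (f : A) : leftField e x f = (e x : Derivation ℂ A A) f := rfl

lemma leftField_rightField (x y : 𝔤) (f : A) :
    leftField e x (rightField e y f) = rightField e y (leftField e x f) := by
  rw [leftField_eq, rightField_eq, convLeft_convRight]

lemma counit_rightField (x : 𝔤) (f : A) : Coalgebra.counit (R := ℂ) (rightField e x f) =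
    Coalgebra.counit (R := ℂ) (leftField e x f) := by
  rw [leftField_eq, rightField_eq, counit_convLeft, counit_convRight]

lemma leftField_mul (x : 𝔤) (f g : A) :
    leftField e x (f * g) = f * leftField e x g + g * leftField e x f := by
  simp only [leftField_apply, Derivation.leibniz, smul_eq_mul]

lemma rightField_mul (x : 𝔤) (f g : A) :
    rightField e x (f * g) = f * rightField e x g + g * rightField e x f :=
  (isPointDerivation_atOne (e x)).convRight_mul f g

lemma leftField_lie (x y : 𝔤) (f : A) : leftField e ⁅x, y⁆ f =
    leftField e x (leftField e y f) - leftField e y (leftField e x f) := by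
  simp only [leftField_apply, LieEquiv.map_lie, LieSubalgebra.coe_bracket,
    Derivation.commutator_apply]

/-- The order is reversed because right fields form an anti-homomorphism. The commutator commutes
with left convolutions, so only its value at the identity matters, and there right fields may be
traded for left ones. -/
lemma rightField_lie (x y : 𝔤) (f : A) : rightField e ⁅x, y⁆ f =
    rightField e y (rightField e x f) - rightField e x (rightField e y f) := by
  have h := eq_convRight_of_commute
    (rightField e y ∘ₗ rightField e x - rightField e x ∘ₗ rightField e y) (fun φ g => by
      simp [rightField_eq, convLeft_convRight])
  have h2 : Coalgebra.counit (R := ℂ) ∘ₗ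
      (rightField e y ∘ₗ rightField e x - rightField e x ∘ₗ rightField e y) =
      atOne (e ⁅x, y⁆) := by
    ext g
    change _ = Coalgebra.counit (R := ℂ) (leftField e ⁅x, y⁆ g)
    simp [counit_rightField, leftField_rightField, leftField_lie]
  rw [h2] at h
  exact (LinearMap.congr_fun h f).symm

/-- The function is an eigenvector, with eigenvalue `c`, for left translations by `exp (t x)`. -/
lemma rightField_eq_smul_of_forall_exp [IsDomain A] [Algebra.FiniteType ℂ A] {x : 𝔤} {f : A} (c : ℂ)
    (hf : ∀ (t : ℂ) (g : Points A), IsExp (e (t • x)) g → ∀ h : Points A,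
      (g * h).ofConv f = Complex.exp (t * c) * h.ofConv f) :
    rightField e x f = c • f := by
  refine eq_of_forall_point fun h => ?_
  obtain ⟨E, hE, hE'⟩ := exists_hasSum_convRight (e x) h.ofConv.toLinearMap f
  -- The series for `f(exp(tx) h)` also equals `exp(tc) f(h)`; comparing derivatives at `t = 0`
  -- gives the eigenvalue equation.
  have hEt : E = fun t => Complex.exp (t * c) * h.ofConv f := by
    ext t
    obtain ⟨g, hg⟩ := exists_isExp (e (t • x))
    rw [← hf t g hg h]
    have h1 := hg.hasSum_mul h f
    have h2 := hE t
    rw [← map_smul] at h2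
    exact h2.unique h1
  have h3 : HasDerivAt (fun t : ℂ => Complex.exp (t * c) * h.ofConv f)
      (Complex.exp (0 * c) * (1 * c) * h.ofConv f) 0 :=
    (((hasDerivAt_id (0 : ℂ)).mul_const c).cexp).mul_const _
  rw [hEt] at hE'
  have := hE'.unique h3
  rw [map_smul, smul_eq_mul, rightField_eq]
  simpa using this

lemma exp_mul_apply_of_rightField_eq_smul {x : 𝔤} {f : A} {c : ℂ} (hf : rightField e x f = c • f)
    {g : Points A} (hg : IsExp (e x) g) (h : Points A) :
    (g * h).ofConv f = Complex.exp c * h.ofConv f := by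
  have hk : ∀ k : ℕ, (convRight (atOne (e x)) ^ k) f = c ^ k • f := by
    intro k
    induction k with
    | zero => simp
    | succ k ih =>
      rw [pow_succ', Module.End.mul_apply, ih, map_smul, ← rightField_eq, hf, smul_smul, pow_succ]
  have h1 := hg.hasSum_mul h f
  have h2 := (NormedSpace.exp_series_hasSum_exp' (𝕂 := ℂ) c).mul_right (h.ofConv f)
  rw [← Complex.exp_eq_exp_ℂ] at h2
  simp only [hk, map_smul, smul_eq_mul] at h1 h2
  refine h1.unique ?_
  simpa only [mul_assoc] using h2

variable [FiniteDimensional ℂ 𝔤] [LieAlgebra.IsSemisimple ℂ 𝔤]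
  {𝔱 : LieSubalgebra ℂ 𝔤} [𝔱.IsCartanSubalgebra]
  (b : (LieAlgebra.IsKilling.rootSystem 𝔱).Base)

/-- Invariance under one-parameter subgroups differentiates to the right field equation and
integrates back from it; generation of `N` by exponentials does the rest. -/
theorem mem_quotientRing_iff [IsDomain A] [Algebra.FiniteType ℂ A] {f : A} :
    f ∈ quotientRing e b ↔ ∀ x ∈ nilradical b, rightField e x f = 0 := by
  constructor
  · intro hf x hx
    have := rightField_eq_smul_of_forall_exp e (x := x) (f := f) 0 fun t g hg h => by
      rw [mul_zero, Complex.exp_zero, one_mul]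
      exact hf g (Subgroup.subset_closure ⟨t • x, Submodule.smul_mem _ _ hx, hg⟩) h
    rwa [zero_smul] at this
  · intro hf n hn
    induction hn using Subgroup.closure_induction with
    | mem n hn =>
      obtain ⟨x, hx, hn⟩ := hn
      intro h
      have := exp_mul_apply_of_rightField_eq_smul e (c := 0)
        ((hf x hx).trans (zero_smul ℂ f).symm) hn h
      rwa [Complex.exp_zero, one_mul] at this
    | one => intro h; rw [one_mul]
    | mul m n _ _ hm hn => intro h; rw [mul_assoc, hm, hn]
    | inv n _ hn => intro h; rw [← hn (n⁻¹ * h), mul_inv_cancel_left]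

theorem mem_gradedPiece_iff [IsDomain A] [Algebra.FiniteType ℂ A] {ϖ : Module.Dual ℂ 𝔱} {f : A} :
    f ∈ gradedPiece e b ϖ ↔ (∀ x ∈ nilradical b, rightField e x f = 0) ∧
      ∀ h : 𝔱, rightField e (h : 𝔤) f = -ϖ h • f := by
  constructor
  · intro hf
    constructor
    · rw [← mem_quotientRing_iff]
      intro n hn g
      -- The choice `x = 0`, `t = 1` isolates `N`-invariance; the choice `n = 1` below isolates the
      -- torus.
      have := hf 0 1 (by simpa using isExp_zero) n hn g
      simpa using this
    · intro h
      refine rightField_eq_smul_of_forall_exp e (-ϖ h) fun t g hg k => ?_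
      have := hf (t • h) g (by simpa using hg) 1 (one_mem _) k
      rw [mul_one, map_smul, smul_eq_mul] at this
      rw [this, mul_neg]
  · rintro ⟨h1, h2⟩ x t ht n hn g
    rw [mul_assoc, exp_mul_apply_of_rightField_eq_smul e (h2 x) ht,
      (mem_quotientRing_iff e b).mpr h1 n hn g]

end Invariance

/-! ### The Jacobi identity for brackets of bivector fields -/

section Jacobiator

lemma sum_bilin_swap {ι V M : Type*} [Fintype ι] [AddCommGroup V] [Module ℂ V]
    [AddCommGroup M] [Module ℂ M] {a b : ι → V}
    (hab : ∑ s, a s ⊗ₜ[ℂ] b s = -∑ s, b s ⊗ₜ[ℂ] a s) (B : V →ₗ[ℂ] V →ₗ[ℂ] M) :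
    ∑ s, B (a s) (b s) = -∑ s, B (b s) (a s) := by
  have := congrArg (TensorProduct.lift B) hab
  simpa using this

variable {ι V A : Type*} [Fintype ι] [AddCommGroup V] [Module ℂ V] [CommRing A] [Algebra ℂ A]

/-- With `P f g h` the terms whose second derivative falls on `h`, skew-symmetry gives `{f,{g,h}} =
P f g h - P f h g`. In the cyclic sum the second derivatives pair off into commutators, which is
`T`. -/
lemma jacobiator_eq (φ : V →ₗ[ℂ] Module.End ℂ A)
    (hφ : ∀ v f g, φ v (f * g) = f * φ v g + g * φ v f) {a b : ι → V}
    (hab : ∑ s, a s ⊗ₜ[ℂ] b s = -∑ s, b s ⊗ₜ[ℂ] a s) (br : A → A → A)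
    (hbr : ∀ f g, br f g = ∑ s, φ (a s) f * φ (b s) g) (T : A → A → A → A)
    (hT : ∀ f g h, T f g h = ∑ s, ∑ t, φ (a s) f * φ (a t) g *
      (φ (b s) (φ (b t) h) - φ (b t) (φ (b s) h))) (f g h : A) :
    br f (br g h) + br g (br h f) + br h (br f g) = T f g h + T g h f + T h f g := by
  set P : A → A → A → A := fun f g h =>
    ∑ s, ∑ t, φ (a s) f * φ (a t) g * φ (b s) (φ (b t) h) with hP
  have h1 : ∀ f g h, br f (br g h) = P f g h - P f h g := by
    intro f g h
    have h2 : ∀ s, ∑ t, φ (b t) h * φ (b s) (φ (a t) g) =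
        -∑ t, φ (a t) h * φ (b s) (φ (b t) g) := by
      intro s
      exact neg_eq_iff_eq_neg.mp (sum_bilin_swap hab
        ((LinearMap.mul ℂ A).compl₁₂ (φ.flip h) ((φ (b s)) ∘ₗ φ.flip g))).symm
    simp only [hbr, map_sum, hφ, Finset.sum_add_distrib, hP, mul_add, h2, Finset.mul_sum, mul_neg,
      sub_eq_add_neg, ← Finset.sum_neg_distrib, mul_assoc]
  have h3 : ∀ f g h, T f g h = P f g h - P g f h := by
    intro f g h
    simp only [hT, hP, mul_sub, Finset.sum_sub_distrib]
    congr 1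
    rw [Finset.sum_comm]
    exact Finset.sum_congr rfl fun s _ => Finset.sum_congr rfl fun t _ => by ring
  rw [h1, h1, h1, h3, h3, h3]
  ring

end Jacobiator

/-! ### Invariant tensors -/

section Invariant

variable {𝔤 : Type*} [LieRing 𝔤] [LieAlgebra ℂ 𝔤]

/-- The pairing of `𝔤 ⊗ 𝔤 ⊗ 𝔤` with a triple of linear forms. -/
def triplePairing (x y z : 𝔤 →ₗ[ℂ] ℂ) : 𝔤 ⊗[ℂ] (𝔤 ⊗[ℂ] 𝔤) →ₗ[ℂ] ℂ :=
  LinearMap.mul' ℂ ℂ ∘ₗ TensorProduct.map x (LinearMap.mul' ℂ ℂ ∘ₗ TensorProduct.map y z)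

@[simp]
lemma triplePairing_tmul (x y z : 𝔤 →ₗ[ℂ] ℂ) (u v w : 𝔤) :
    triplePairing x y z (u ⊗ₜ[ℂ] (v ⊗ₜ[ℂ] w)) = x u * (y v * z w) := by
  simp [triplePairing]

lemma eq_zero_of_triplePairing [FiniteDimensional ℂ 𝔤] {t : 𝔤 ⊗[ℂ] (𝔤 ⊗[ℂ] 𝔤)}
    (h : ∀ x y z, triplePairing x y z t = 0) : t = 0 := by
  let β := Module.finBasis ℂ 𝔤
  let B := β.tensorProduct (β.tensorProduct β)
  refine B.ext_elem fun ⟨i, j, k⟩ => ?_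
  rw [map_zero, Finsupp.zero_apply, ← h (β.coord i) (β.coord j) (β.coord k)]
  have : B.coord (i, j, k) = triplePairing (β.coord i) (β.coord j) (β.coord k) := by
    apply TensorProduct.ext'
    intro x t
    induction t with
    | zero => simp
    | add s t hs ht => simp only [TensorProduct.tmul_add, map_add, hs, ht]
    | tmul y z =>
      simp only [B, Module.Basis.coord_apply, Module.Basis.tensorProduct_repr_tmul_apply,
        triplePairing_tmul, smul_eq_mul]
      ring
  exact LinearMap.congr_fun this t

/-- The tensor `[r₁₂, r₁₃] + [r₁₂, r₂₃] + [r₁₃, r₂₃]` of the classical Yang-Baxter equation,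
for a skew-symmetric `r = ∑ a s ⊗ b s`. -/
def yangBaxter {ι : Type*} [Fintype ι] (a b : ι → 𝔤) : 𝔤 ⊗[ℂ] (𝔤 ⊗[ℂ] 𝔤) :=
  ∑ s, ∑ t, (a s ⊗ₜ[ℂ] (a t ⊗ₜ[ℂ] ⁅b s, b t⁆) + ⁅b s, b t⁆ ⊗ₜ[ℂ] (a s ⊗ₜ[ℂ] a t) +
    a t ⊗ₜ[ℂ] (⁅b s, b t⁆ ⊗ₜ[ℂ] a s))

lemma killingForm_lie_left (x y z : 𝔤) :
    killingForm ℂ 𝔤 ⁅x, y⁆ z = -killingForm ℂ 𝔤 y ⁅x, z⁆ := by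
  rw [← lie_skew, map_neg, LinearMap.neg_apply]
  congr 1
  exact LieModule.traceForm_apply_lie_apply ℂ 𝔤 𝔤 y x z

variable [FiniteDimensional ℂ 𝔤] [LieAlgebra.IsKilling ℂ 𝔤]

lemma exists_killingForm_eq (φ : 𝔤 →ₗ[ℂ] ℂ) : ∃ x, killingForm ℂ 𝔤 x = φ :=
  ⟨(LinearMap.BilinForm.toDual _ (LieAlgebra.IsKilling.killingForm_nondegenerate ℂ 𝔤)).symm φ, by
    ext y
    simp⟩

/-- If the contraction `ρ` of a skew-symmetric `r` with the Killing form satisfies the modified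
classical Yang-Baxter equation, then `yangBaxter` is an invariant tensor. -/
lemma lie_yangBaxter {ι : Type*} [Fintype ι] (a b : ι → 𝔤) (ρ : 𝔤 → 𝔤)
    (hρ : ∀ x, ρ x = ∑ s, killingForm ℂ 𝔤 x (a s) • b s)
    (hskew : ∀ x y, killingForm ℂ 𝔤 (ρ x) y = -killingForm ℂ 𝔤 x (ρ y)) (c : ℂ)
    (hyb : ∀ x y, ⁅ρ x, ρ y⁆ - ρ (⁅ρ x, y⁆ + ⁅x, ρ y⁆) = c • ⁅x, y⁆) (u : 𝔤) :
    ⁅u, yangBaxter a b⁆ = 0 := by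
  set κ := killingForm ℂ 𝔤 with hκ
  have hsymm : ∀ x y, κ x y = κ y x := fun x y => LieModule.traceForm_comm ℂ 𝔤 𝔤 x y
  have hbr : ∀ x y, ⁅ρ x, ρ y⁆ = ∑ s, ∑ t, (κ x (a s) * κ y (a t)) • ⁅b s, b t⁆ := by
    intro x y
    rw [hρ, hρ, sum_lie]
    simp only [lie_sum]
    refine Finset.sum_congr rfl fun s _ => Finset.sum_congr rfl fun t _ => ?_
    rw [smul_lie, lie_smul, smul_smul]
  -- Under the Killing form the tensor becomes `c` times the Cartan 3-form: skewness of `ρ` and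
  -- invariance of `κ` move all three terms onto `z`, where the Yang-Baxter equation applies.
  have hC : ∀ x y z, triplePairing (κ x) (κ y) (κ z) (yangBaxter a b) = c * κ z ⁅x, y⁆ := by
    intro x y z
    have h1 : triplePairing (κ x) (κ y) (κ z) (yangBaxter a b) =
        κ z ⁅ρ x, ρ y⁆ + κ x ⁅ρ y, ρ z⁆ + κ y ⁅ρ z, ρ x⁆ := by
      simp only [yangBaxter, map_sum, map_add, triplePairing_tmul, hbr, map_smul, smul_eq_mul,
        Finset.sum_add_distrib]
      congr 1
      · congr 1 <;> exact Finset.sum_congr rfl fun s _ => Finset.sum_congr rfl fun t _ => by ring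
      · exact Finset.sum_congr rfl fun s _ => Finset.sum_congr rfl fun t _ => by ring
    have h2 : κ x ⁅ρ y, ρ z⁆ = -κ z (ρ ⁅x, ρ y⁆) := by
      rw [← neg_eq_iff_eq_neg, ← killingForm_lie_left, hsymm z, hskew, ← lie_skew, map_neg,
        LinearMap.neg_apply, hsymm]
    have h3 : κ y ⁅ρ z, ρ x⁆ = -κ z (ρ ⁅ρ x, y⁆) := by
      rw [← lie_skew (ρ z), map_neg, ← killingForm_lie_left, hsymm z, hskew, neg_neg]
    rw [h1, h2, h3, ← smul_eq_mul, ← map_smul, ← hyb]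
    have h4 : ρ (⁅ρ x, y⁆ + ⁅x, ρ y⁆) = ρ ⁅ρ x, y⁆ + ρ ⁅x, ρ y⁆ := by
      simp only [hρ, map_add, LinearMap.add_apply, add_smul, Finset.sum_add_distrib]
    rw [h4, map_sub, map_add]
    ring
  have hlie : ∀ x y z (t : 𝔤 ⊗[ℂ] (𝔤 ⊗[ℂ] 𝔤)), triplePairing (κ x) (κ y) (κ z) ⁅u, t⁆ =
      -(triplePairing (κ ⁅u, x⁆) (κ y) (κ z) t + triplePairing (κ x) (κ ⁅u, y⁆) (κ z) t +
        triplePairing (κ x) (κ y) (κ ⁅u, z⁆) t) := by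
    intro x y z t
    induction t with
    | zero => simp
    | add s t hs ht => rw [lie_add]; simp only [map_add, hs, ht]; ring
    | tmul p t =>
      induction t with
      | zero => simp
      | add s t hs ht =>
        rw [TensorProduct.tmul_add, lie_add]; simp only [map_add, hs, ht]; ring
      | tmul q r =>
        rw [TensorProduct.LieModule.lie_tmul_right, TensorProduct.LieModule.lie_tmul_right]
        simp only [TensorProduct.tmul_add, map_add, triplePairing_tmul, hκ, killingForm_lie_left]
        ring
  refine eq_zero_of_triplePairing fun x y z => ?_
  obtain ⟨x, rfl⟩ := exists_killingForm_eq x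
  obtain ⟨y, rfl⟩ := exists_killingForm_eq y
  obtain ⟨z, rfl⟩ := exists_killingForm_eq z
  rw [← hκ, hlie, hC, hC, hC, hκ, killingForm_lie_left, leibniz_lie u x y, map_add]
  ring

end Invariant

/-! ### Trivector fields of invariant tensors and the Poisson property -/

section TriDiff

variable {𝔤 : Type*} [LieRing 𝔤] [LieAlgebra ℂ 𝔤]
  {A : Type*} [CommRing A] [HopfAlgebra ℂ A]

/-- The tridifferential operator attached to an element of `𝔤 ⊗ 𝔤 ⊗ 𝔤`. -/
def tridiff (φ : 𝔤 →ₗ[ℂ] Module.End ℂ A) (f g h : A) : 𝔤 ⊗[ℂ] (𝔤 ⊗[ℂ] 𝔤) →ₗ[ℂ] A :=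
  LinearMap.mul' ℂ A ∘ₗ TensorProduct.map (φ.flip f)
    (LinearMap.mul' ℂ A ∘ₗ TensorProduct.map (φ.flip g) (φ.flip h))

@[simp]
lemma tridiff_tmul (φ : 𝔤 →ₗ[ℂ] Module.End ℂ A) (f g h : A) (x y z : 𝔤) :
    tridiff φ f g h (x ⊗ₜ[ℂ] (y ⊗ₜ[ℂ] z)) = φ x f * (φ y g * φ z h) := by
  simp [tridiff]

variable (e : 𝔤 ≃ₗ⁅ℂ⁆ lieAlg A)

lemma tridiff_leftField_lie (u : 𝔤) (t : 𝔤 ⊗[ℂ] (𝔤 ⊗[ℂ] 𝔤)) (f g h : A) :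
    tridiff (leftField e) f g h ⁅u, t⁆ = leftField e u (tridiff (leftField e) f g h t) -
      tridiff (leftField e) (leftField e u f) g h t -
      tridiff (leftField e) f (leftField e u g) h t -
      tridiff (leftField e) f g (leftField e u h) t := by
  induction t with
  | zero => simp
  | add s t hs ht => rw [lie_add]; simp only [map_add, hs, ht]; ring
  | tmul p t =>
    induction t with
    | zero => simp
    | add s t hs ht =>
      rw [TensorProduct.tmul_add, lie_add]; simp only [map_add, hs, ht]; ring
    | tmul q r =>
      rw [TensorProduct.LieModule.lie_tmul_right, TensorProduct.LieModule.lie_tmul_right]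
      simp only [TensorProduct.tmul_add, map_add, tridiff_tmul, leftField_lie, leftField_mul]
      ring

lemma leftField_tridiff_rightField (u : 𝔤) (t : 𝔤 ⊗[ℂ] (𝔤 ⊗[ℂ] 𝔤)) (f g h : A) :
    leftField e u (tridiff (rightField e) f g h t) =
      tridiff (rightField e) (leftField e u f) g h t +
      tridiff (rightField e) f (leftField e u g) h t +
      tridiff (rightField e) f g (leftField e u h) t := by
  induction t with
  | zero => simp
  | add s t hs ht => simp only [map_add, hs, ht]; ring
  | tmul p t =>
    induction t with
    | zero => simp
    | add s t hs ht => rw [TensorProduct.tmul_add]; simp only [map_add, hs, ht]; ring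
    | tmul q r =>
      simp only [tridiff_tmul, leftField_mul, leftField_rightField]
      ring

lemma counit_tridiff (t : 𝔤 ⊗[ℂ] (𝔤 ⊗[ℂ] 𝔤)) (f g h : A) :
    Coalgebra.counit (R := ℂ) (tridiff (rightField e) f g h t) =
      Coalgebra.counit (R := ℂ) (tridiff (leftField e) f g h t) := by
  induction t with
  | zero => simp
  | add s t hs ht => simp only [map_add, hs, ht]
  | tmul p t =>
    induction t with
    | zero => simp
    | add s t hs ht => rw [TensorProduct.tmul_add]; simp only [map_add, hs, ht]
    | tmul q r => simp only [tridiff_tmul, Bialgebra.counit_mul, counit_rightField]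

/-- An invariant tensor defines the same left and right invariant tridifferential operator. -/
lemma tridiff_eq_of_invariant [IsDomain A] [Algebra.FiniteType ℂ A] (t : 𝔤 ⊗[ℂ] (𝔤 ⊗[ℂ] 𝔤))
    (ht : ∀ u : 𝔤, ⁅u, t⁆ = 0) (f g h : A) :
    tridiff (leftField e) f g h t = tridiff (rightField e) f g h t := by
  -- A left field acts on the defect `Z` by the three-term Leibniz rule: on the left operator
  -- because `t` is invariant, on the right one because left and right fields commute. The span of
  -- all defects is thus stable, and it vanishes at the identity.
  set Z : A → A → A → A := fun f g h =>
    tridiff (leftField e) f g h t - tridiff (rightField e) f g h t with hZ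
  let S : Submodule ℂ A := Submodule.span ℂ {z | ∃ f g h, z = Z f g h}
  have hZu : ∀ (u : 𝔤) f g h, leftField e u (Z f g h) = Z (leftField e u f) g h +
      Z f (leftField e u g) h + Z f g (leftField e u h) := by
    intro u f g h
    have h1 := tridiff_leftField_lie e u t f g h
    rw [ht, map_zero] at h1
    simp only [hZ, map_sub, leftField_tridiff_rightField]
    linear_combination -h1
  have hZmem : ∀ f g h, Z f g h ∈ S := fun f g h => Submodule.subset_span ⟨f, g, h, rfl⟩
  refine sub_eq_zero.mp (eq_zero_of_stable S ?_ ?_ _ (hZmem f g h))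
  · intro D z hz
    obtain ⟨u, rfl⟩ := e.surjective D
    change leftField e u z ∈ S
    induction hz using Submodule.span_induction with
    | mem z hz =>
      obtain ⟨f, g, h, rfl⟩ := hz
      rw [hZu]
      exact add_mem (add_mem (hZmem _ _ _) (hZmem _ _ _)) (hZmem _ _ _)
    | zero => rw [map_zero]; exact zero_mem _
    | add x y _ _ hx hy => rw [map_add]; exact add_mem hx hy
    | smul c x _ hx => rw [map_smul]; exact S.smul_mem _ hx
  · intro z hz
    induction hz using Submodule.span_induction with
    | mem z hz =>
      obtain ⟨f, g, h, rfl⟩ := hz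
      simp only [hZ, map_sub, counit_tridiff, sub_self]
    | zero => exact map_zero _
    | add x y _ _ hx hy => rw [map_add, hx, hy, add_zero]
    | smul c x _ hx => rw [map_smul, hx, smul_zero]

@[simp]
lemma bidiff_tmul (φ : 𝔤 →ₗ[ℂ] Module.End ℂ A) (x y : 𝔤) (f g : A) :
    bidiff φ (x ⊗ₜ[ℂ] y) f g = φ x f * φ y g := by
  simp [bidiff]

/-- The bracket of the bivector field `Λ^L - Λ^R` is Poisson if the Yang-Baxter tensor of the
skew-symmetric tensor `Λ` is invariant. -/
lemma isPoissonBracket_standardBracket [IsDomain A] [Algebra.FiniteType ℂ A]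
    {ι : Type*} [Fintype ι] {a b : ι → 𝔤}
    (hab : ∑ s, a s ⊗ₜ[ℂ] b s = -∑ s, b s ⊗ₜ[ℂ] a s)
    (hinv : ∀ u : 𝔤, ⁅u, yangBaxter a b⁆ = 0) :
    IsPoissonBracket (standardBracket e (∑ s, a s ⊗ₜ[ℂ] b s)) := by
  have hbr : ∀ f g, standardBracket e (∑ s, a s ⊗ₜ[ℂ] b s) f g =
      ∑ s, leftField e (a s) f * leftField e (b s) g -
        ∑ s, rightField e (a s) f * rightField e (b s) g := by
    intro f g
    simp [standardBracket, LinearMap.sum_apply]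
  refine ⟨fun f => ?_, fun f g h => ?_, fun f g h => ?_⟩
  · have h1 : ∀ φ : 𝔤 →ₗ[ℂ] Module.End ℂ A, ∑ s, φ (a s) f * φ (b s) f = 0 := by
      intro φ
      have h2 := sum_bilin_swap hab ((LinearMap.mul ℂ A).compl₁₂ (φ.flip f) (φ.flip f))
      simp only [LinearMap.compl₁₂_apply, LinearMap.flip_apply, LinearMap.mul_apply'] at h2
      have h3 : ∑ s, φ (b s) f * φ (a s) f = ∑ s, φ (a s) f * φ (b s) f :=
        Finset.sum_congr rfl fun s _ => mul_comm _ _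
      rw [h3] at h2
      have h4 : (2 : ℂ) • ∑ s, φ (a s) f * φ (b s) f = 0 := by
        rw [two_smul]; exact eq_neg_iff_add_eq_zero.mp h2
      exact (smul_eq_zero.mp h4).resolve_left two_ne_zero
    rw [hbr, h1, h1, sub_zero]
  · let φ : 𝔤 × 𝔤 →ₗ[ℂ] Module.End ℂ A := (leftField e).coprod (rightField e)
    let a' : ι ⊕ ι → 𝔤 × 𝔤 := Sum.elim (fun s => (a s, 0)) (fun s => -(0, a s))
    let b' : ι ⊕ ι → 𝔤 × 𝔤 := Sum.elim (fun s => (b s, 0)) (fun s => (0, b s))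
    have hφ : ∀ v f g, φ v (f * g) = f * φ v g + g * φ v f := by
      intro v f g
      simp only [φ, LinearMap.coprod_apply, LinearMap.add_apply, leftField_mul, rightField_mul]
      ring
    have hab' : ∑ s, a' s ⊗ₜ[ℂ] b' s = -∑ s, b' s ⊗ₜ[ℂ] a' s := by
      have h1 := congrArg (TensorProduct.map (LinearMap.inl ℂ 𝔤 𝔤) (LinearMap.inl ℂ 𝔤 𝔤)) hab
      have h2 := congrArg (TensorProduct.map (LinearMap.inr ℂ 𝔤 𝔤) (LinearMap.inr ℂ 𝔤 𝔤)) hab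
      simp only [map_sum, map_neg, TensorProduct.map_tmul, LinearMap.inl_apply,
        LinearMap.inr_apply] at h1 h2
      simp only [Fintype.sum_sum_type, a', b', Sum.elim_inl, Sum.elim_inr, TensorProduct.neg_tmul,
        TensorProduct.tmul_neg, Finset.sum_neg_distrib, h1, h2]
      abel
    have hj := jacobiator_eq φ hφ hab'
      (fun f g => standardBracket e (∑ s, a s ⊗ₜ[ℂ] b s) f g) (fun f g => by
        rw [hbr, sub_eq_add_neg, ← Finset.sum_neg_distrib]
        simp [Fintype.sum_sum_type, a', b', φ])
      (fun f g h => ∑ s, ∑ t, leftField e (a s) f * leftField e (a t) g *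
          leftField e ⁅b s, b t⁆ h - ∑ s, ∑ t, rightField e (a s) f * rightField e (a t) g *
          rightField e ⁅b s, b t⁆ h) (fun f g h => by
        simp [Fintype.sum_sum_type, a', b', φ, leftField_rightField, leftField_lie, rightField_lie,
          Finset.sum_sub_distrib, mul_sub, Finset.sum_add_distrib]
        ring) f g h
    beta_reduce at hj
    rw [hj]
    have key : ∀ φ : 𝔤 →ₗ[ℂ] Module.End ℂ A, tridiff φ f g h (yangBaxter a b) =
        (∑ s, ∑ t, φ (a s) f * φ (a t) g * φ ⁅b s, b t⁆ h) +
        (∑ s, ∑ t, φ (a s) g * φ (a t) h * φ ⁅b s, b t⁆ f) +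
        (∑ s, ∑ t, φ (a s) h * φ (a t) f * φ ⁅b s, b t⁆ g) := by
      intro φ
      simp only [yangBaxter, map_sum, map_add, tridiff_tmul, Finset.sum_add_distrib]
      congr 1
      · congr 1 <;> exact Finset.sum_congr rfl fun s _ => Finset.sum_congr rfl fun t _ => by ring
      · exact Finset.sum_congr rfl fun s _ => Finset.sum_congr rfl fun t _ => by ring
    have h5 := tridiff_eq_of_invariant e _ hinv f g h
    rw [key, key] at h5
    linear_combination h5
  · simp only [hbr, leftField_mul, rightField_mul, mul_add, Finset.sum_add_distrib, sub_mul, mul_sub,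
      Finset.sum_mul, Finset.mul_sum]
    have h1 : ∀ φ : 𝔤 →ₗ[ℂ] Module.End ℂ A, ∑ s, φ (a s) f * (g * φ (b s) h) =
        ∑ s, g * (φ (a s) f * φ (b s) h) := fun φ => Finset.sum_congr rfl fun s _ => by ring
    have h2 : ∀ φ : 𝔤 →ₗ[ℂ] Module.End ℂ A, ∑ s, φ (a s) f * (h * φ (b s) g) =
        ∑ s, φ (a s) f * φ (b s) g * h := fun φ => Finset.sum_congr rfl fun s _ => by ring
    simp only [h1, h2]
    ring

end TriDiff

/-! ### The triangular decomposition -/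

section Triangular

open LieAlgebra LieAlgebra.IsKilling

variable {𝔤 : Type*} [LieRing 𝔤] [LieAlgebra ℂ 𝔤] [FiniteDimensional ℂ 𝔤]
  [LieAlgebra.IsSemisimple ℂ 𝔤]
  {𝔱 : LieSubalgebra ℂ 𝔤} [𝔱.IsCartanSubalgebra]
  (b : (rootSystem 𝔱).Base)

/-- The sum of the root spaces of the negative roots. -/
def negNilradical : Submodule ℂ 𝔤 :=
  ⨆ α : {α : 𝔱.root // b.IsPos α}, (rootSpace 𝔱 (-(α.1.1 : 𝔱 → ℂ))).toSubmodule

variable {b}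

lemma mem_nilradical {α : 𝔱.root} (hα : b.IsPos α) {x : 𝔤}
    (hx : x ∈ rootSpace 𝔱 (α.1 : 𝔱 → ℂ)) : x ∈ nilradical b :=
  Submodule.mem_iSup_of_mem (p := fun α : {α : 𝔱.root // b.IsPos α} =>
    (rootSpace 𝔱 (α.1.1 : 𝔱 → ℂ)).toSubmodule) ⟨α, hα⟩ hx

lemma mem_negNilradical {α : 𝔱.root} (hα : b.IsPos α) {x : 𝔤}
    (hx : x ∈ rootSpace 𝔱 (-(α.1 : 𝔱 → ℂ))) : x ∈ negNilradical b :=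
  Submodule.mem_iSup_of_mem (p := fun α : {α : 𝔱.root // b.IsPos α} =>
    (rootSpace 𝔱 (-(α.1.1 : 𝔱 → ℂ))).toSubmodule) ⟨α, hα⟩ hx

lemma nilradical_induction {p : 𝔤 → Prop} (h0 : p 0) (hadd : ∀ x y, p x → p y → p (x + y))
    (hpos : ∀ α : 𝔱.root, b.IsPos α → ∀ x ∈ rootSpace 𝔱 (α.1 : 𝔱 → ℂ), p x) :
    ∀ x ∈ nilradical b, p x := by
  intro x hx
  refine Submodule.iSup_induction _ (motive := p) hx (fun α x hx => hpos α.1 α.2 x hx) h0 hadd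

lemma negNilradical_induction {p : 𝔤 → Prop} (h0 : p 0) (hadd : ∀ x y, p x → p y → p (x + y))
    (hneg : ∀ α : 𝔱.root, b.IsPos α → ∀ x ∈ rootSpace 𝔱 (-(α.1 : 𝔱 → ℂ)), p x) :
    ∀ x ∈ negNilradical b, p x := by
  intro x hx
  refine Submodule.iSup_induction _ (motive := p) hx (fun α x hx => hneg α.1 α.2 x hx) h0 hadd

/-- The negative of a root. -/
def negRoot (α : 𝔱.root) : 𝔱.root := ⟨-α.1, by
  have := α.2
  simp only [Finset.mem_filter, Finset.mem_univ, true_and] at this ⊢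
  exact LieModule.Weight.IsNonZero.neg this⟩

lemma coe_negRoot (α : 𝔱.root) : ((negRoot α).1 : 𝔱 → ℂ) = -(α.1 : 𝔱 → ℂ) := rfl

lemma root_negRoot (α : 𝔱.root) :
    (rootSystem 𝔱).root (negRoot α) = -(rootSystem 𝔱).root α := rfl

lemma height_negRoot (α : 𝔱.root) : b.height (negRoot α) = -b.height α := by
  rw [← b.height_reflectionPerm_self]
  congr 1
  apply (rootSystem 𝔱).root.injective
  change _ = (rootSystem 𝔱).root ((rootSystem 𝔱).reflectionPerm α α)
  rw [root_negRoot, RootPairing.root_reflectionPerm, RootPairing.reflection_apply_self]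

lemma isPos_or_negRoot (α : 𝔱.root) : b.IsPos α ∨ b.IsPos (negRoot α) := by
  rw [b.isPos_iff, b.isPos_iff, height_negRoot]
  have := b.height_ne_zero α
  omega

lemma not_isPos_negRoot {α : 𝔱.root} (hα : b.IsPos α) : ¬ b.IsPos (negRoot α) := by
  rw [b.isPos_iff] at *
  rw [height_negRoot]
  omega

lemma add_ne_zero_of_isPos {α β : 𝔱.root} (hα : b.IsPos α) (hβ : b.IsPos β) :
    (α.1 : 𝔱 → ℂ) + (β.1 : 𝔱 → ℂ) ≠ 0 := by
  intro h
  have : β = negRoot α := by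
    apply Subtype.ext
    apply DFunLike.coe_injective
    rw [coe_negRoot]
    exact (neg_eq_of_add_eq_zero_right h).symm
  exact not_isPos_negRoot hα (this ▸ hβ)

lemma ne_zero_of_root (α : 𝔱.root) : (α.1 : 𝔱 → ℂ) ≠ 0 := by
  simp

/-- An induction principle along `𝔤 = 𝔫₋ + 𝔱 + 𝔫`. -/
lemma triangular_induction (b : (rootSystem 𝔱).Base) {p : 𝔤 → Prop}
    (hadd : ∀ x y, p x → p y → p (x + y)) (hcart : ∀ h : 𝔱, p h)
    (hpos : ∀ x ∈ nilradical b, p x) (hneg : ∀ x ∈ negNilradical b, p x) (x : 𝔤) : p x := by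
  have hx : x ∈ ⨆ χ : LieModule.Weight ℂ 𝔱 𝔤, LieModule.genWeightSpace 𝔤 χ := by
    rw [LieModule.iSup_genWeightSpace_eq_top' ℂ 𝔱 𝔤]
    trivial
  have h0 : p 0 := by simpa using hcart 0
  refine LieSubmodule.iSup_induction _ (motive := p) hx (fun χ y hy => ?_) h0 hadd
  by_cases hχ : χ.IsZero
  · have hχ0 : (χ : 𝔱 → ℂ) = 0 := hχ
    rw [hχ0] at hy
    have : y ∈ 𝔱.toLieSubmodule := by
      rw [← rootSpace_zero_eq ℂ 𝔤 𝔱]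
      exact hy
    exact hcart ⟨y, by simpa using this⟩
  · let α : 𝔱.root := ⟨χ, by simpa using hχ⟩
    rcases isPos_or_negRoot (b := b) α with hα | hα
    · exact hpos y (mem_nilradical hα hy)
    · refine hneg y (mem_negNilradical hα ?_)
      rw [coe_negRoot, neg_neg]
      exact hy

lemma lie_cartan_mem_nilradical (h : 𝔱) : ∀ x ∈ nilradical b, ⁅(h : 𝔤), x⁆ ∈ nilradical b := by
  refine nilradical_induction (by simp) (fun x y hx hy => by rw [lie_add]; exact add_mem hx hy) ?_
  intro α hα x hx
  have : ⁅(h : 𝔤), x⁆ = (α.1 : 𝔱 → ℂ) h • x := lie_eq_smul_of_mem_rootSpace hx h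
  rw [this]
  exact Submodule.smul_mem _ _ (mem_nilradical hα hx)

lemma lie_cartan_mem_negNilradical (h : 𝔱) :
    ∀ x ∈ negNilradical b, ⁅(h : 𝔤), x⁆ ∈ negNilradical b := by
  refine negNilradical_induction (by simp)
    (fun x y hx hy => by rw [lie_add]; exact add_mem hx hy) ?_
  intro α hα x hx
  have : ⁅(h : 𝔤), x⁆ = (-(α.1 : 𝔱 → ℂ)) h • x := lie_eq_smul_of_mem_rootSpace hx h
  rw [this]
  exact Submodule.smul_mem _ _ (mem_negNilradical hα hx)

lemma exists_root_add {α β : 𝔱.root} (hα : b.IsPos α) (hβ : b.IsPos β)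
    (h : rootSpace 𝔱 ((α.1 : 𝔱 → ℂ) + (β.1 : 𝔱 → ℂ)) ≠ ⊥) :
    ∃ γ : 𝔱.root, b.IsPos γ ∧ (γ.1 : 𝔱 → ℂ) = (α.1 : 𝔱 → ℂ) + (β.1 : 𝔱 → ℂ) := by
  let γ : 𝔱.root := ⟨⟨_, h⟩, by
    simp only [Finset.mem_filter, Finset.mem_univ, true_and]
    exact add_ne_zero_of_isPos hα hβ⟩
  refine ⟨γ, hα.add hβ ?_, rfl⟩
  ext h
  rfl

lemma lie_mem_nilradical {x y : 𝔤} (hx : x ∈ nilradical b) (hy : y ∈ nilradical b) :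
    ⁅x, y⁆ ∈ nilradical b := by
  refine nilradical_induction (p := fun x => ⁅x, y⁆ ∈ nilradical b) (by simp)
    (fun x z hx hz => by rw [add_lie]; exact add_mem hx hz) ?_ x hx
  intro α hα x hx
  refine nilradical_induction (p := fun y => ⁅x, y⁆ ∈ nilradical b) (by simp)
    (fun x y hx hy => by rw [lie_add]; exact add_mem hx hy) ?_ y hy
  intro β hβ y hy
  have hxy : ⁅x, y⁆ ∈ rootSpace 𝔱 ((α.1 : 𝔱 → ℂ) + (β.1 : 𝔱 → ℂ)) :=
    lie_mem_genWeightSpace_of_mem_genWeightSpace hx hy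
  by_cases h : rootSpace 𝔱 ((α.1 : 𝔱 → ℂ) + (β.1 : 𝔱 → ℂ)) = ⊥
  · rw [h, LieSubmodule.mem_bot] at hxy
    rw [hxy]
    exact zero_mem _
  · obtain ⟨γ, hγ, hγ'⟩ := exists_root_add hα hβ h
    rw [← hγ'] at hxy
    exact mem_nilradical hγ hxy

lemma lie_mem_negNilradical {x y : 𝔤} (hx : x ∈ negNilradical b) (hy : y ∈ negNilradical b) :
    ⁅x, y⁆ ∈ negNilradical b := by
  refine negNilradical_induction (p := fun x => ⁅x, y⁆ ∈ negNilradical b) (by simp)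
    (fun x z hx hz => by rw [add_lie]; exact add_mem hx hz) ?_ x hx
  intro α hα x hx
  refine negNilradical_induction (p := fun y => ⁅x, y⁆ ∈ negNilradical b) (by simp)
    (fun x y hx hy => by rw [lie_add]; exact add_mem hx hy) ?_ y hy
  intro β hβ y hy
  have hxy : ⁅x, y⁆ ∈ rootSpace 𝔱 (-(α.1 : 𝔱 → ℂ) + -(β.1 : 𝔱 → ℂ)) :=
    lie_mem_genWeightSpace_of_mem_genWeightSpace hx hy
  rw [← neg_add] at hxy
  by_cases h : rootSpace 𝔱 (-((α.1 : 𝔱 → ℂ) + (β.1 : 𝔱 → ℂ))) = ⊥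
  · rw [h, LieSubmodule.mem_bot] at hxy
    rw [hxy]
    exact zero_mem _
  · obtain ⟨γ, hγ, hγ'⟩ := exists_root_add hα hβ (by
      have := (-(⟨_, h⟩ : LieModule.Weight ℂ 𝔱 𝔤)).genWeightSpace_ne_bot
      rwa [LieModule.Weight.coe_neg, LieModule.Weight.coe_weight_mk, neg_neg] at this)
    rw [← hγ'] at hxy
    exact mem_negNilradical hγ hxy

end Triangular

/-! ### The standard r-matrix -/

section RMatrix

open LieAlgebra LieAlgebra.IsKilling

variable {𝔤 : Type*} [LieRing 𝔤] [LieAlgebra ℂ 𝔤] [FiniteDimensional ℂ 𝔤]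
  [LieAlgebra.IsSemisimple ℂ 𝔤]
  {𝔱 : LieSubalgebra ℂ 𝔤} [𝔱.IsCartanSubalgebra]
  {b : (rootSystem 𝔱).Base} {ep em : 𝔱.root → 𝔤}

open Classical in
variable (b ep em) in
/-- The contraction of the standard r-matrix with the Killing form. -/
def rOperator (x : 𝔤) : 𝔤 := (1 / 2 : ℂ) • ∑ α : 𝔱.root with b.IsPos α,
  (killingForm ℂ 𝔤 x (em α) • ep α - killingForm ℂ 𝔤 x (ep α) • em α)

lemma rOperator_add (x y : 𝔤) :
    rOperator b ep em (x + y) = rOperator b ep em x + rOperator b ep em y := by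
  simp only [rOperator, map_add, LinearMap.add_apply, add_smul, ← smul_add,
    ← Finset.sum_add_distrib]
  congr 1
  exact Finset.sum_congr rfl fun _ _ => by abel

lemma rOperator_smul (c : ℂ) (x : 𝔤) :
    rOperator b ep em (c • x) = c • rOperator b ep em x := by
  simp only [rOperator, map_smul, LinearMap.smul_apply, smul_assoc, ← smul_sub,
    ← Finset.smul_sum]
  rw [smul_comm]

lemma rOperator_skew (x y : 𝔤) : killingForm ℂ 𝔤 (rOperator b ep em x) y =
    -killingForm ℂ 𝔤 x (rOperator b ep em y) := by
  simp only [rOperator, map_smul, map_sum, map_sub, LinearMap.smul_apply, LinearMap.sum_apply,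
    LinearMap.sub_apply, ← smul_neg, ← Finset.sum_neg_distrib]
  congr 1
  refine Finset.sum_congr rfl fun α _ => ?_
  rw [LieModule.traceForm_comm ℂ 𝔤 𝔤 y, LieModule.traceForm_comm ℂ 𝔤 𝔤 y]
  simp only [smul_eq_mul]
  ring

variable (he : IsRootVectors b ep em)
include he

lemma rOperator_cartan (h : 𝔱) : rOperator b ep em (h : 𝔤) = 0 := by
  have hh : (h : 𝔤) ∈ rootSpace 𝔱 (0 : 𝔱 → ℂ) := by
    rw [rootSpace_zero_eq]
    simp
  rw [rOperator, Finset.sum_eq_zero, smul_zero]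
  intro α hα
  obtain ⟨h1, h2, -⟩ := he α (by simpa using hα)
  rw [killingForm_apply_eq_zero_of_mem_rootSpace_of_add_ne_zero ℂ 𝔤 𝔱 hh h1
      (by rw [zero_add]; exact ne_zero_of_root α),
    killingForm_apply_eq_zero_of_mem_rootSpace_of_add_ne_zero ℂ 𝔤 𝔱 hh h2
      (by rw [zero_add, neg_ne_zero]; exact ne_zero_of_root α)]
  simp

omit he in
lemma root_eq_of_coe_eq {α β : 𝔱.root} (h : (α.1 : 𝔱 → ℂ) = (β.1 : 𝔱 → ℂ)) : α = β :=
  Subtype.ext (DFunLike.coe_injective h)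

lemma exists_smul_ep {α : 𝔱.root} (hα : b.IsPos α) {x : 𝔤}
    (hx : x ∈ rootSpace 𝔱 (α.1 : 𝔱 → ℂ)) : ∃ c : ℂ, x = c • ep α := by
  obtain ⟨h1, h2, h3⟩ := he α hα
  have hne : (⟨ep α, h1⟩ : rootSpace 𝔱 (α.1 : 𝔱 → ℂ)) ≠ 0 := by
    intro h
    rw [LieSubmodule.mk_eq_zero] at h
    rw [h, map_zero, LinearMap.zero_apply] at h3
    exact zero_ne_one h3
  obtain ⟨c, hc⟩ := (finrank_eq_one_iff_of_nonzero' _ hne).mp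
    (finrank_rootSpace_eq_one α.1 (ne_zero_of_root α)) ⟨x, hx⟩
  exact ⟨c, (congrArg Subtype.val hc).symm⟩

lemma exists_smul_em {α : 𝔱.root} (hα : b.IsPos α) {x : 𝔤}
    (hx : x ∈ rootSpace 𝔱 (-(α.1 : 𝔱 → ℂ))) : ∃ c : ℂ, x = c • em α := by
  obtain ⟨h1, h2, h3⟩ := he α hα
  have hne : (⟨em α, h2⟩ : rootSpace 𝔱 (-(α.1 : 𝔱 → ℂ))) ≠ 0 := by
    intro h
    rw [LieSubmodule.mk_eq_zero] at h
    rw [h, map_zero] at h3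
    exact zero_ne_one h3
  obtain ⟨c, hc⟩ := (finrank_eq_one_iff_of_nonzero' _ hne).mp
    (finrank_rootSpace_eq_one (-α.1) (LieModule.Weight.IsNonZero.neg (ne_zero_of_root α))) ⟨x, hx⟩
  exact ⟨c, (congrArg Subtype.val hc).symm⟩

lemma killingForm_ep_em {α β : 𝔱.root} (hα : b.IsPos α) (hβ : b.IsPos β) (h : α ≠ β) :
    killingForm ℂ 𝔤 (ep α) (em β) = 0 :=
  killingForm_apply_eq_zero_of_mem_rootSpace_of_add_ne_zero ℂ 𝔤 𝔱 (he α hα).1 (he β hβ).2.1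
    fun h' => h (root_eq_of_coe_eq (add_neg_eq_zero.mp h'))

lemma killingForm_ep_ep {α β : 𝔱.root} (hα : b.IsPos α) (hβ : b.IsPos β) :
    killingForm ℂ 𝔤 (ep α) (ep β) = 0 :=
  killingForm_apply_eq_zero_of_mem_rootSpace_of_add_ne_zero ℂ 𝔤 𝔱 (he α hα).1 (he β hβ).1
    (add_ne_zero_of_isPos hα hβ)

lemma killingForm_em_em {α β : 𝔱.root} (hα : b.IsPos α) (hβ : b.IsPos β) :
    killingForm ℂ 𝔤 (em α) (em β) = 0 :=
  killingForm_apply_eq_zero_of_mem_rootSpace_of_add_ne_zero ℂ 𝔤 𝔱 (he α hα).2.1 (he β hβ).2.1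
    (by rw [← neg_add, neg_ne_zero]; exact add_ne_zero_of_isPos hα hβ)

/-- Root spaces are lines and the chosen vectors are dual under the Killing form, so only the
summand of the same root survives. With the two companion lemmas, the operator is `1/2`, `0`, `-1/2`
on `𝔫`, `𝔱`, `𝔫₋`. -/
lemma rOperator_nilradical :
    ∀ x ∈ nilradical b, rOperator b ep em x = (1 / 2 : ℂ) • x := by
  refine nilradical_induction (by simp [rOperator])
    (fun x y hx hy => by rw [rOperator_add, hx, hy, smul_add]) ?_
  intro β hβ x hx
  obtain ⟨c, rfl⟩ := exists_smul_ep he hβ hx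
  rw [rOperator_smul, smul_comm, rOperator, Finset.sum_eq_single β]
  · rw [(he β hβ).2.2, killingForm_ep_ep he hβ hβ, one_smul, zero_smul, sub_zero]
  · intro α hα hne
    have hα' : b.IsPos α := by simpa using hα
    rw [killingForm_ep_em he hβ hα' hne.symm, killingForm_ep_ep he hβ hα', zero_smul, zero_smul,
      sub_zero]
  · intro h
    exact absurd (by simpa using hβ) h

lemma rOperator_negNilradical :
    ∀ x ∈ negNilradical b, rOperator b ep em x = -((1 / 2 : ℂ) • x) := by
  refine negNilradical_induction (by simp [rOperator])
    (fun x y hx hy => by rw [rOperator_add, hx, hy, smul_add, neg_add]) ?_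
  intro β hβ x hx
  obtain ⟨c, rfl⟩ := exists_smul_em he hβ hx
  rw [rOperator_smul, smul_comm, rOperator, Finset.sum_eq_single β]
  · rw [LieModule.traceForm_comm ℂ 𝔤 𝔤 _ (ep β), killingForm_em_em he hβ hβ]
    have := (he β hβ).2.2
    rw [killingForm] at this
    rw [this]
    simp
  · intro α hα hne
    have hα' : b.IsPos α := by simpa using hα
    have := killingForm_ep_em he hα' hβ hne
    rw [killingForm, LieModule.traceForm_comm] at this
    rw [killingForm_em_em he hβ hα', killingForm, this, zero_smul, zero_smul, sub_zero]
  · intro h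
    exact absurd (by simpa using hβ) h

/-- The modified classical Yang-Baxter equation for the standard r-matrix. -/
lemma rOperator_yangBaxter (x y : 𝔤) :
    ⁅rOperator b ep em x, rOperator b ep em y⁆ -
      rOperator b ep em (⁅rOperator b ep em x, y⁆ + ⁅x, rOperator b ep em y⁆) =
      (-1 / 4 : ℂ) • ⁅x, y⁆ := by
  set R := rOperator b ep em with hR
  have hneg : ∀ x, R (-x) = -R x := fun x => by
    rw [← neg_one_smul ℂ x, hR, rOperator_smul, neg_one_smul]
  -- The identity is antisymmetric, so each mixed pair among `𝔱`, `𝔫`, `𝔫₋` is checked in one order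
  -- only.
  have hsymm : ∀ x y, ⁅R x, R y⁆ - R (⁅R x, y⁆ + ⁅x, R y⁆) = (-1 / 4 : ℂ) • ⁅x, y⁆ →
      ⁅R y, R x⁆ - R (⁅R y, x⁆ + ⁅y, R x⁆) = (-1 / 4 : ℂ) • ⁅y, x⁆ := by
    intro x y h
    rw [← lie_skew (R y) (R x), ← lie_skew y x, ← lie_skew (R y) x, ← lie_skew y (R x), smul_neg,
      ← h, ← neg_add, hneg, add_comm ⁅x, R y⁆]
    abel
  have hcn : ∀ (h : 𝔱), ∀ x ∈ nilradical b,
      ⁅R h, R x⁆ - R (⁅R h, x⁆ + ⁅(h : 𝔤), R x⁆) = (-1 / 4 : ℂ) • ⁅(h : 𝔤), x⁆ := by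
    intro h x hx
    rw [hR, rOperator_cartan he, rOperator_nilradical he x hx, zero_lie, zero_lie, zero_add,
      lie_smul, rOperator_smul, rOperator_nilradical he _ (lie_cartan_mem_nilradical h x hx)]
    module
  have hcm : ∀ (h : 𝔱), ∀ x ∈ negNilradical b,
      ⁅R h, R x⁆ - R (⁅R h, x⁆ + ⁅(h : 𝔤), R x⁆) = (-1 / 4 : ℂ) • ⁅(h : 𝔤), x⁆ := by
    intro h x hx
    rw [hR, rOperator_cartan he, rOperator_negNilradical he x hx, zero_lie, zero_lie, zero_add,
      lie_neg, ← hR, hneg, lie_smul, hR, rOperator_smul,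
      rOperator_negNilradical he _ (lie_cartan_mem_negNilradical h x hx)]
    module
  -- The eigenvalues `1/2` and `-1/2` cancel inside the outer operator, so the components of `⁅x,
  -- y⁆` need not be known; the remaining product is the constant `-1/4`.
  have hnm : ∀ x ∈ nilradical b, ∀ y ∈ negNilradical b,
      ⁅R x, R y⁆ - R (⁅R x, y⁆ + ⁅x, R y⁆) = (-1 / 4 : ℂ) • ⁅x, y⁆ := by
    intro x hx y hy
    rw [hR, rOperator_nilradical he x hx, rOperator_negNilradical he y hy, smul_lie, smul_lie,
      lie_neg, lie_smul, add_neg_cancel]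
    have h0 : rOperator b ep em (0 : 𝔤) = 0 := by simpa using rOperator_smul (0 : ℂ) (0 : 𝔤)
    rw [h0]
    module
  revert x
  refine triangular_induction b ?_ ?_ ?_ ?_
  · intro x x' hx hx'
    rw [hR] at *
    simp only [rOperator_add, add_lie, smul_add] at *
    rw [← hx, ← hx']
    abel
  · intro h
    revert y
    refine triangular_induction b ?_ ?_ ?_ ?_
    · intro y y' hy hy'
      rw [hR] at *
      simp only [rOperator_add, lie_add, smul_add] at *
      rw [← hy, ← hy']
      abel
    · intro h'
      have h0 : R (0 : 𝔤) = 0 := by simpa using rOperator_smul (0 : ℂ) (0 : 𝔤)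
      have h1 : ⁅(h : 𝔤), (h' : 𝔤)⁆ = 0 := by
        rw [← LieSubalgebra.coe_bracket, trivial_lie_zero]
        rfl
      rw [hR, rOperator_cartan he, rOperator_cartan he, ← hR, h1]
      simp [h0]
    · exact fun x hx => hcn h x hx
    · exact fun x hx => hcm h x hx
  · intro x hx
    revert y
    refine triangular_induction b ?_ ?_ ?_ ?_
    · intro y y' hy hy'
      rw [hR] at *
      simp only [rOperator_add, lie_add, smul_add] at *
      rw [← hy, ← hy']
      abel
    · exact fun h => hsymm _ _ (hcn h x hx)
    · intro y hy
      rw [hR, rOperator_nilradical he x hx, rOperator_nilradical he y hy, smul_lie, smul_lie,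
        lie_smul, rOperator_add, rOperator_smul,
        rOperator_nilradical he _ (lie_mem_nilradical hx hy)]
      module
    · exact fun y hy => hnm x hx y hy
  · intro x hx
    revert y
    refine triangular_induction b ?_ ?_ ?_ ?_
    · intro y y' hy hy'
      rw [hR] at *
      simp only [rOperator_add, lie_add, smul_add] at *
      rw [← hy, ← hy']
      abel
    · exact fun h => hsymm _ _ (hcm h x hx)
    · exact fun y hy => hsymm _ _ (hnm y hy x hx)
    · intro y hy
      rw [hR, rOperator_negNilradical he x hx, rOperator_negNilradical he y hy]
      simp only [neg_lie, lie_neg, smul_lie, lie_smul]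
      rw [rOperator_add, ← hR, hneg, hR, rOperator_smul,
        rOperator_negNilradical he _ (lie_mem_negNilradical hx hy)]
      module

end RMatrix

/-! ### The standard bracket satisfies the Jacobi identity -/

section StandardBracket

open LieAlgebra LieAlgebra.IsKilling

variable {𝔤 : Type*} [LieRing 𝔤] [LieAlgebra ℂ 𝔤] [FiniteDimensional ℂ 𝔤]
  [LieAlgebra.IsSemisimple ℂ 𝔤]
  {𝔱 : LieSubalgebra ℂ 𝔤} [𝔱.IsCartanSubalgebra]
  {b : (rootSystem 𝔱).Base} {ep em : 𝔱.root → 𝔤}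
  {A : Type*} [CommRing A] [HopfAlgebra ℂ A] (e : 𝔤 ≃ₗ⁅ℂ⁆ lieAlg A)

/-- The standard bracket is a Poisson bracket on `ℂ[G]`. -/
theorem isPoissonBracket_standardLambda [IsDomain A] [Algebra.FiniteType ℂ A]
    (he : IsRootVectors b ep em) :
    IsPoissonBracket (standardBracket e (standardLambda b ep em)) := by
  classical
  -- Two copies of the positive roots absorb the signs and the factor `1/2`, so that `Λ_st = ∑ p ⊗
  -- q` and its Killing contraction is `rOperator`.
  let ι := {α : 𝔱.root // b.IsPos α}
  let p : ι ⊕ ι → 𝔤 := Sum.elim (fun α => (1 / 2 : ℂ) • em α.1) (fun α => -((1 / 2 : ℂ) • ep α.1))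
  let q : ι ⊕ ι → 𝔤 := Sum.elim (fun α => ep α.1) (fun α => em α.1)
  have hsum : ∀ {M : Type _} [AddCommGroup M] (F : 𝔱.root → M),
      ∑ α : 𝔱.root with b.IsPos α, F α = ∑ α : ι, F α.1 := by
    intro M _ F
    rw [← Finset.sum_subtype_eq_sum_filter]
    exact Finset.sum_congr (by ext; simp) fun _ _ => rfl
  have hΛ : standardLambda b ep em = ∑ s, p s ⊗ₜ[ℂ] q s := by
    rw [standardLambda, Fintype.sum_sum_type]
    simp only [p, q, Sum.elim_inl, Sum.elim_inr, Finset.sum_sub_distrib, smul_sub,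
      Finset.smul_sum, TensorProduct.neg_tmul, Finset.sum_neg_distrib, TensorProduct.smul_tmul',
      ← sub_eq_add_neg]
    rw [hsum, hsum]
  rw [hΛ]
  refine isPoissonBracket_standardBracket e ?_ fun u => ?_
  · simp only [Fintype.sum_sum_type, p, q, Sum.elim_inl, Sum.elim_inr, TensorProduct.neg_tmul,
      TensorProduct.tmul_neg, Finset.sum_neg_distrib, TensorProduct.smul_tmul]
    abel
  · refine lie_yangBaxter p q (rOperator b ep em) (fun x => ?_) rOperator_skew (-1 / 4)
      (rOperator_yangBaxter he) u
    simp only [rOperator, Fintype.sum_sum_type, p, q, Sum.elim_inl, Sum.elim_inr, map_neg,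
      map_smul, smul_eq_mul, neg_smul, Finset.sum_neg_distrib, mul_smul, ← Finset.smul_sum,
      Finset.sum_sub_distrib, smul_sub, ← sub_eq_add_neg]
    rw [hsum, hsum]

end StandardBracket

/-! ### Joint eigenspaces -/

section JointEigenspace

variable {T M : Type*} [AddCommGroup M] [Module ℂ M]

/-- The joint eigenspace of a family of endomorphisms. -/
def jointEigenspace (φ : T → Module.End ℂ M) (χ : T → ℂ) : Submodule ℂ M :=
  ⨅ t, (φ t).eigenspace (χ t)

lemma mem_jointEigenspace {φ : T → Module.End ℂ M} {χ : T → ℂ} {m : M} :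
    m ∈ jointEigenspace φ χ ↔ ∀ t, φ t m = χ t • m := by
  simp [jointEigenspace]

/-- Two distinct characters differ at some `t`; `φ t - a t` removes the `a`-component and rescales
the others, so a relation can be shortened. The endomorphisms need not commute. -/
lemma iSupIndep_jointEigenspace (φ : T → Module.End ℂ M) : iSupIndep (jointEigenspace φ) := by
  classical
  rw [iSupIndep_iff_finsetSum_eq_zero_imp_eq_zero]
  intro s
  induction s using Finset.induction_on with
  | empty => simp
  | insert a s ha ih =>
    intro v hv h0
    have hs : ∀ i ∈ s, v i = 0 := by
      intro j hj
      obtain ⟨t, ht⟩ : ∃ t, j t ≠ a t := by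
        by_contra! h
        exact ha ((funext h : j = a) ▸ hj)
      have h1 := ih (fun i => (i t - a t) • v i)
        (fun i hi => Submodule.smul_mem _ _ (hv i (Finset.mem_insert_of_mem hi))) (by
          have h2 : (φ t - a t • 1) (∑ i ∈ insert a s, v i) = 0 := by rw [h0, map_zero]
          rw [map_sum, Finset.sum_insert ha] at h2
          have h3 : ∀ i ∈ insert a s, (φ t - a t • 1) (v i) = (i t - a t) • v i := by
            intro i hi
            have := mem_jointEigenspace.mp (hv i hi) t
            simp [this, sub_smul]
          rw [h3 a (Finset.mem_insert_self _ _), sub_self, zero_smul, zero_add] at h2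
          rw [← h2]
          exact Finset.sum_congr rfl fun i hi => (h3 i (Finset.mem_insert_of_mem hi)).symm) j hj
      exact (smul_eq_zero.mp h1).resolve_left (sub_ne_zero.mpr ht)
    intro i hi
    rcases Finset.mem_insert.mp hi with rfl | hi
    · rwa [Finset.sum_insert ha, Finset.sum_eq_zero hs, add_zero] at h0
    · exact hs i hi

open Polynomial in
lemma exists_sum_eigenvectors {T : Module.End ℂ M} {P : Submodule ℂ M}
    (hP : ∀ m ∈ P, T m ∈ P) (N : ℕ) : ∀ m ∈ P,
      aeval T (∏ k ∈ Finset.range N, (X - C (k : ℂ))) m = 0 →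
      ∃ g : ℕ → M, (∀ k < N, g k ∈ P ∧ T (g k) = (k : ℂ) • g k) ∧
        m = ∑ k ∈ Finset.range N, g k := by
  induction N with
  | zero => intro m _ h; exact ⟨0, by simp, by simpa using h⟩
  | succ N ih =>
    intro m hm h
    rw [Finset.prod_range_succ, map_mul, Module.End.mul_apply] at h
    have hT : aeval T (X - C (N : ℂ)) m = T m - (N : ℂ) • m := by
      simp [Nat.cast_smul_eq_nsmul]
    rw [hT] at h
    obtain ⟨g, hg, hgm⟩ := ih _ (sub_mem (hP m hm) (Submodule.smul_mem _ _ hm)) h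
    have hne : ∀ k < N, (k : ℂ) - N ≠ 0 := fun k hk => by
      rw [sub_ne_zero]
      exact_mod_cast hk.ne
    -- The induction hypothesis splits `T m - N m`. Dividing its `k`-th component by `k - N` gives
    -- the components of `m` below `N`, and what remains of `m` is an eigenvector for `N`.
    let g' : ℕ → M := fun k => if k < N then ((k : ℂ) - N)⁻¹ • g k else
      m - ∑ k ∈ Finset.range N, ((k : ℂ) - N)⁻¹ • g k
    have h1 : ∀ k < N, g' k = ((k : ℂ) - N)⁻¹ • g k := fun k hk => if_pos hk
    have h2 : g' N = m - ∑ k ∈ Finset.range N, ((k : ℂ) - N)⁻¹ • g k := if_neg (lt_irrefl _)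
    refine ⟨g', fun k hk => ?_, ?_⟩
    · rcases Nat.lt_succ_iff_lt_or_eq.mp hk with hk | rfl
      · rw [h1 k hk]
        refine ⟨Submodule.smul_mem _ _ (hg k hk).1, ?_⟩
        rw [map_smul, (hg k hk).2, smul_comm]
      · rw [h2]
        refine ⟨sub_mem hm (Submodule.sum_mem _ fun j hj => Submodule.smul_mem _ _
          (hg j (Finset.mem_range.mp hj)).1), ?_⟩
        rw [map_sub, map_sum, smul_sub, sub_eq_sub_iff_sub_eq_sub, hgm, Finset.smul_sum,
          ← Finset.sum_sub_distrib]
        refine Finset.sum_congr rfl fun j hj => ?_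
        have hj := Finset.mem_range.mp hj
        rw [map_smul, (hg j hj).2, smul_comm, ← sub_smul, smul_smul,
          mul_inv_cancel₀ (hne j hj), one_smul]
    · rw [Finset.sum_range_succ, h2,
        Finset.sum_congr rfl fun k hk => h1 k (Finset.mem_range.mp hk)]
      abel

end JointEigenspace

/-! ### Representations of `𝔰𝔩₂` -/

section SlTwo

variable {L M : Type*} [LieRing L] [LieAlgebra ℂ L] [AddCommGroup M] [Module ℂ M]
  [LieRingModule L M] [LieModule ℂ L M] {h e f : L}

open LieModule

lemma lie_h_pow_f (t : IsSl2Triple h e f) (k : ℕ) (m : M) :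
    ⁅h, (toEnd ℂ L M f ^ k) m⁆ =
      (toEnd ℂ L M f ^ k) ⁅h, m⁆ - (2 * k : ℂ) • (toEnd ℂ L M f ^ k) m := by
  induction k with
  | zero => simp
  | succ k ih =>
    rw [pow_succ', Module.End.mul_apply, Module.End.mul_apply, toEnd_apply_apply,
      toEnd_apply_apply, leibniz_lie h, t.lie_lie_smul_f ℂ, ih, lie_sub, lie_smul, neg_lie,
      smul_lie]
    push_cast
    module

lemma lie_e_pow_succ_f (t : IsSl2Triple h e f) {m : M} (hm : ⁅e, m⁆ = 0) (k : ℕ) :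
    ⁅e, (toEnd ℂ L M f ^ (k + 1)) m⁆ =
      (k + 1 : ℂ) • (toEnd ℂ L M f ^ k) (⁅h, m⁆ - (k : ℂ) • m) := by
  induction k with
  | zero => simp [leibniz_lie e, t.lie_e_f, hm]
  | succ k ih =>
    rw [pow_succ', Module.End.mul_apply, toEnd_apply_apply, leibniz_lie e, t.lie_e_f, ih,
      lie_h_pow_f t, lie_smul, ← toEnd_apply_apply ℂ L M f, ← Module.End.mul_apply, ← pow_succ']
    simp only [map_sub, map_smul]
    push_cast
    module

-- The vector `m` need not be a weight vector: `h` enters as an operator, so the identity becomes a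
-- polynomial equation for `h` once a power of `f` vanishes.
open Polynomial in
lemma pow_e_pow_f (t : IsSl2Triple h e f) {K : Submodule ℂ M} (he : ∀ m ∈ K, ⁅e, m⁆ = 0)
    (hh : ∀ m ∈ K, ⁅h, m⁆ ∈ K) (n : ℕ) : ∀ m ∈ K,
    (toEnd ℂ L M e ^ n) ((toEnd ℂ L M f ^ n) m) = (n.factorial : ℂ) •
      aeval (toEnd ℂ L M h) (∏ k ∈ Finset.range n, (X - C (k : ℂ))) m := by
  induction n with
  | zero => intro m _; simp
  | succ n ih =>
    intro m hm
    rw [pow_succ (toEnd ℂ L M e), Module.End.mul_apply, toEnd_apply_apply,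
      lie_e_pow_succ_f t (he m hm), map_smul,
      ih _ (sub_mem (hh m hm) (Submodule.smul_mem _ _ hm)), Finset.prod_range_succ, map_mul,
      Module.End.mul_apply, smul_smul, Nat.factorial_succ]
    simp [Nat.cast_smul_eq_nsmul]

/-- If `f ^ N = 0`, `pow_e_pow_f` shows that `∏ (h - k)` over `k < N` kills `K`. The roots are
distinct natural numbers, so diagonalizability and dominance come out together. -/
lemma le_iSup_eigenspace_h (t : IsSl2Triple h e f) (hf : IsNilpotent (toEnd ℂ L M f))
    {K : Submodule ℂ M} (he : ∀ m ∈ K, ⁅e, m⁆ = 0) (hh : ∀ m ∈ K, ⁅h, m⁆ ∈ K) :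
    K ≤ ⨆ k : ℕ, K ⊓ (toEnd ℂ L M h).eigenspace (k : ℂ) := by
  intro m hm
  obtain ⟨N, hN⟩ := hf
  have h0 := pow_e_pow_f t he hh N m hm
  rw [hN, LinearMap.zero_apply, map_zero, eq_comm, smul_eq_zero] at h0
  obtain ⟨g, hg, rfl⟩ := exists_sum_eigenvectors (T := toEnd ℂ L M h) hh N m hm
    (h0.resolve_left (by exact_mod_cast N.factorial_ne_zero))
  refine Submodule.sum_mem _ fun k hk => Submodule.mem_iSup_of_mem k ?_
  have := hg k (Finset.mem_range.mp hk)
  exact ⟨this.1, Module.End.mem_eigenspace_iff.mpr this.2⟩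

/-- For the opposite triple `m` is primitive of weight `n`, and the string coefficient `(k + 1)(n -
k)` does not vanish for `k < n`. -/
lemma pow_e_ne_zero (t : IsSl2Triple h e f) {m : M} (hm : m ≠ 0) (hf : ⁅f, m⁆ = 0) {n : ℕ}
    (hn : ⁅h, m⁆ = -(n : ℂ) • m) : (toEnd ℂ L M e ^ n) m ≠ 0 := by
  have P : IsSl2Triple.HasPrimitiveVectorWith t.symm m (n : ℂ) :=
    ⟨hm, by rw [neg_lie, hn, neg_smul, neg_neg], hf⟩
  have key : ∀ k ≤ n, (toEnd ℂ L M e ^ k) m ≠ 0 := by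
    intro k
    induction k with
    | zero => intro _; simpa using hm
    | succ k ih =>
      intro hk h0
      have h1 := P.lie_e_pow_succ_toEnd_f k
      rw [h0, lie_zero, eq_comm, smul_eq_zero, mul_eq_zero, sub_eq_zero, Nat.cast_inj] at h1
      rcases h1 with (h1 | h1) | h1
      · exact Nat.cast_add_one_ne_zero k h1
      · omega
      · exact ih (by omega) h1
  exact key n le_rfl

end SlTwo

/-! ### Weight vectors -/

section Weights

open LieAlgebra LieAlgebra.IsKilling

variable {𝔤 : Type*} [LieRing 𝔤] [LieAlgebra ℂ 𝔤] [FiniteDimensional ℂ 𝔤]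
  [LieAlgebra.IsSemisimple ℂ 𝔤]
  {𝔱 : LieSubalgebra ℂ 𝔤} [𝔱.IsCartanSubalgebra]
  {b : (rootSystem 𝔱).Base}
  {M : Type*} [AddCommGroup M] [Module ℂ M] [LieRingModule 𝔤 M] [LieModule ℂ 𝔤 M]

variable (𝔱 M) in
/-- The space of vectors of weight `χ`. -/
def weightVectors (χ : Module.Dual ℂ 𝔱) : Submodule ℂ M :=
  jointEigenspace (fun h : 𝔱 => LieModule.toEnd ℂ 𝔤 M h) χ

lemma mem_weightVectors {χ : Module.Dual ℂ 𝔱} {m : M} :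
    m ∈ weightVectors 𝔱 M χ ↔ ∀ h : 𝔱, ⁅(h : 𝔤), m⁆ = χ h • m :=
  mem_jointEigenspace

variable (𝔱 M) in
lemma iSupIndep_weightVectors : iSupIndep (weightVectors 𝔱 M) :=
  (iSupIndep_jointEigenspace (fun h : 𝔱 => LieModule.toEnd ℂ 𝔤 M h)).comp DFunLike.coe_injective

lemma isNonZero_root (α : 𝔱.root) : α.1.IsNonZero := LieSubalgebra.isNonZero_coe_root α

variable (𝔱) in
lemma exists_sl2Triple (α : 𝔱.root) : ∃ e f : 𝔤,
    IsSl2Triple (((rootSystem 𝔱).coroot α : 𝔱) : 𝔤) e f ∧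
      e ∈ rootSpace 𝔱 (α.1 : 𝔱 → ℂ) ∧ f ∈ rootSpace 𝔱 (-(α.1 : 𝔱 → ℂ)) := by
  obtain ⟨h, e, f, t, he, hf⟩ := exists_isSl2Triple_of_weight_isNonZero (isNonZero_root α)
  have := t.h_eq_coroot (isNonZero_root α) he hf
  subst this
  exact ⟨e, f, t, he, hf⟩

lemma lie_mem_weightVectors {α : 𝔱.root} {x : 𝔤} (hx : x ∈ rootSpace 𝔱 (α.1 : 𝔱 → ℂ))
    {χ : Module.Dual ℂ 𝔱} {m : M} (hm : m ∈ weightVectors 𝔱 M χ) :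
    ⁅x, m⁆ ∈ weightVectors 𝔱 M (χ + (rootSystem 𝔱).root α) := by
  rw [mem_weightVectors] at *
  intro h
  have h1 : ⁅(h : 𝔤), x⁆ = (α.1 : 𝔱 → ℂ) h • x := lie_eq_smul_of_mem_rootSpace hx h
  rw [leibniz_lie, h1, hm, lie_smul, smul_lie, ← add_smul, add_comm]
  rfl

lemma lie_mem_weightVectors_neg {α : 𝔱.root} {x : 𝔤} (hx : x ∈ rootSpace 𝔱 (-(α.1 : 𝔱 → ℂ)))
    {χ : Module.Dual ℂ 𝔱} {m : M} (hm : m ∈ weightVectors 𝔱 M χ) :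
    ⁅x, m⁆ ∈ weightVectors 𝔱 M (χ - (rootSystem 𝔱).root α) := by
  rw [sub_eq_add_neg, ← root_negRoot]
  exact lie_mem_weightVectors (α := negRoot α) hx hm

variable (b M) in
/-- The vectors killed by `𝔫`. -/
def nilInvariants : Submodule ℂ M where
  carrier := {m | ∀ x ∈ nilradical b, ⁅x, m⁆ = 0}
  add_mem' h h' x hx := by rw [lie_add, h x hx, h' x hx, add_zero]
  zero_mem' x _ := lie_zero x
  smul_mem' c m h x hx := by rw [lie_smul, h x hx, smul_zero]

lemma lie_cartan_mem_nilInvariants (h : 𝔱) {m : M} (hm : m ∈ nilInvariants b M) :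
    ⁅(h : 𝔤), m⁆ ∈ nilInvariants b M := by
  intro x hx
  rw [leibniz_lie, hm x hx, lie_zero, add_zero, ← lie_skew, neg_lie,
    hm _ (lie_cartan_mem_nilradical h x hx), neg_zero]

lemma lie_cartan_comm (h k : 𝔱) (m : M) : ⁅(h : 𝔤), ⁅(k : 𝔤), m⁆⁆ = ⁅(k : 𝔤), ⁅(h : 𝔤), m⁆⁆ := by
  have : ⁅(h : 𝔤), (k : 𝔤)⁆ = 0 := by
    rw [← LieSubalgebra.coe_bracket, trivial_lie_zero]
    rfl
  rw [leibniz_lie, this, zero_lie, zero_add]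

/-- The simple coroots are diagonalized one after another; as they commute, each step preserves the
eigenspaces already found. They form a basis of `𝔱`, so the eigenvalues `c` assemble into a dominant
weight. -/
lemma nilInvariants_le_iSup [FiniteDimensional ℂ M] :
    nilInvariants b M ≤
      ⨆ ϖ : dominantWeights b, nilInvariants b M ⊓ weightVectors 𝔱 M (ϖ : Module.Dual ℂ 𝔱) := by
  classical
  let K (s : Finset 𝔱.root) (c : 𝔱.root → ℕ) : Submodule ℂ M := nilInvariants b M ⊓
    ⨅ i : s, (LieModule.toEnd ℂ 𝔤 M ((rootSystem 𝔱).coroot i : 𝔱)).eigenspace (c i : ℂ)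
  have hK : ∀ s c m, m ∈ K s c ↔ m ∈ nilInvariants b M ∧
      ∀ i ∈ s, ⁅(((rootSystem 𝔱).coroot i : 𝔱) : 𝔤), m⁆ = (c i : ℂ) • m := by
    intro s c m
    simp [K]
  have key : ∀ s ⊆ b.support, nilInvariants b M ≤ ⨆ c, K s c := by
    intro s
    induction s using Finset.induction_on with
    | empty =>
      intro _ m hm
      exact Submodule.mem_iSup_of_mem 0 ((hK _ _ _).mpr ⟨hm, by simp⟩)
    | insert j s hj ih =>
      intro hs
      refine (ih fun i hi => hs (Finset.mem_insert_of_mem hi)).trans (iSup_le fun c => ?_)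
      obtain ⟨e, f, t, he, hf⟩ := exists_sl2Triple 𝔱 j
      have hpos := b.isPos_of_mem_support (hs (Finset.mem_insert_self j s))
      refine (le_iSup_eigenspace_h t (LieModule.isNilpotent_toEnd_of_mem_rootSpace M 𝔱
        (neg_ne_zero.mpr (ne_zero_of_root j)) hf) (K := K s c) (fun m hm => ?_)
        (fun m hm => ?_)).trans (iSup_le fun k m hm => ?_)
      · exact ((hK _ _ _).mp hm).1 e (mem_nilradical hpos he)
      · rw [hK] at hm ⊢
        refine ⟨lie_cartan_mem_nilInvariants _ hm.1, fun i hi => ?_⟩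
        rw [lie_cartan_comm, hm.2 i hi, lie_smul]
      · obtain ⟨hm, hk⟩ := hm
        rw [SetLike.mem_coe, hK] at hm
        refine Submodule.mem_iSup_of_mem (Function.update c j k) ((hK _ _ _).mpr ⟨hm.1, ?_⟩)
        intro i hi
        rcases Finset.mem_insert.mp hi with rfl | hi
        · simpa using hk
        · rw [Function.update_of_ne (ne_of_mem_of_not_mem hi hj)]
          exact hm.2 i hi
  refine (key b.support subset_rfl).trans (iSup_le fun c m hm => ?_)
  rw [hK] at hm
  let ϖ : Module.Dual ℂ 𝔱 := b.toCoweightBasis.constr ℂ fun i => (c i : ℂ)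
  have hϖ : ∀ i (hi : i ∈ b.support), ϖ ((rootSystem 𝔱).coroot i) = c i := by
    intro i hi
    have := b.toCoweightBasis.constr_basis ℂ (fun i => (c i : ℂ)) ⟨i, hi⟩
    rwa [b.toCoweightBasis_apply] at this
  refine Submodule.mem_iSup_of_mem ⟨ϖ, fun i hi => ⟨c i, hϖ i hi⟩⟩ ⟨hm.1, ?_⟩
  rw [SetLike.mem_coe, mem_weightVectors]
  let φ : 𝔱 →ₗ[ℂ] M := (LinearMap.flip (LieModule.toEnd ℂ 𝔤 M : 𝔤 →ₗ[ℂ] Module.End ℂ M) m) ∘ₗ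
    𝔱.toSubmodule.subtype
  have : φ = ϖ.smulRight m := by
    refine b.toCoweightBasis.ext fun i => ?_
    rw [b.toCoweightBasis_apply, LinearMap.smulRight_apply, hϖ i i.2]
    exact hm.2 i i.2
  exact fun h => LinearMap.congr_fun this h

end Weights

/-! ### Highest weight modules -/

section HighestWeight

open LieAlgebra LieAlgebra.IsKilling

variable {𝔤 : Type*} [LieRing 𝔤] [LieAlgebra ℂ 𝔤] [FiniteDimensional ℂ 𝔤]
  [LieAlgebra.IsSemisimple ℂ 𝔤]
  {𝔱 : LieSubalgebra ℂ 𝔤} [𝔱.IsCartanSubalgebra]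
  {b : (rootSystem 𝔱).Base}
  {M : Type*} [AddCommGroup M] [Module ℂ M] [LieRingModule 𝔤 M] [LieModule ℂ 𝔤 M]

variable (b) in
/-- The sums of simple roots. -/
abbrev rootCone : AddSubmonoid (Module.Dual ℂ 𝔱) :=
  AddSubmonoid.closure ((rootSystem 𝔱).root '' (b.support : Set 𝔱.root))

lemma root_mem_rootCone {α : 𝔱.root} (hα : b.IsPos α) : (rootSystem 𝔱).root α ∈ rootCone b := by
  refine hα.induction_on_add (p := fun α => (rootSystem 𝔱).root α ∈ rootCone b)
    (fun i hi => AddSubmonoid.subset_closure ⟨i, hi, rfl⟩) fun i j k hk hi hj => ?_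
  · rw [hk]
    exact add_mem hi (AddSubmonoid.subset_closure ⟨j, hj, rfl⟩)

variable (b) in
/-- The vectors obtained from `v` by applying at most `n` elements of `𝔫₋`. -/
def descend (v : M) : ℕ → Submodule ℂ M
  | 0 => Submodule.span ℂ {v}
  | n + 1 => descend v n ⊔
      Submodule.span ℂ {y | ∃ f ∈ negNilradical b, ∃ s ∈ descend v n, ⁅f, s⁆ = y}

lemma descend_le_succ (v : M) (n : ℕ) : descend b v n ≤ descend b v (n + 1) := le_sup_left

lemma lie_neg_mem_descend {v : M} {n : ℕ} {f : 𝔤} (hf : f ∈ negNilradical b) {s : M}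
    (hs : s ∈ descend b v n) : ⁅f, s⁆ ∈ descend b v (n + 1) :=
  Submodule.mem_sup_right (Submodule.subset_span ⟨f, hf, s, hs, rfl⟩)

lemma lie_mem_descend_succ {v : M} {n : ℕ}
    (h1 : ∀ h : 𝔱, ∀ s ∈ descend b v n, ⁅(h : 𝔤), s⁆ ∈ descend b v n)
    (h2 : ∀ x ∈ nilradical b, ∀ s ∈ descend b v n, ⁅x, s⁆ ∈ descend b v n)
    (x : 𝔤) {s : M} (hs : s ∈ descend b v n) : ⁅x, s⁆ ∈ descend b v (n + 1) :=
  triangular_induction b (p := fun x => ⁅x, s⁆ ∈ descend b v (n + 1))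
    (fun x y hx hy => by rw [add_lie]; exact add_mem hx hy)
    (fun h => descend_le_succ v n (h1 h s hs)) (fun x hx => descend_le_succ v n (h2 x hx s hs))
    (fun f hf => lie_neg_mem_descend hf hs) x

/-- In `x f s = ⁅x, f⁆ s + f x s` the commutator can be any element of `𝔤`; this is why the second
hypothesis concerns all `y`. -/
lemma stable_descend_succ {v : M} {n : ℕ} {x : 𝔤}
    (h1 : ∀ s ∈ descend b v n, ⁅x, s⁆ ∈ descend b v n)
    (h2 : ∀ y : 𝔤, ∀ s ∈ descend b v n, ⁅y, s⁆ ∈ descend b v (n + 1)) :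
    ∀ s ∈ descend b v (n + 1), ⁅x, s⁆ ∈ descend b v (n + 1) := by
  suffices descend b v (n + 1) ≤ (descend b v (n + 1)).comap (LieModule.toEnd ℂ 𝔤 M x) from
    fun s hs => this hs
  refine sup_le (fun s hs => descend_le_succ v n (h1 s hs)) (Submodule.span_le.mpr ?_)
  rintro _ ⟨f, hf, s, hs, rfl⟩
  change ⁅x, ⁅f, s⁆⁆ ∈ descend b v (n + 1)
  rw [leibniz_lie]
  exact add_mem (h2 _ s hs) (lie_neg_mem_descend hf (h1 s hs))

variable {ν : Module.Dual ℂ 𝔱} {v : M}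

/-- This does the work of the Poincaré-Birkhoff-Witt theorem: it shows that lowering operators alone
generate the submodule of a highest weight vector. -/
lemma lie_mem_descend (hv : IsHighestWeightVector b ν v) (n : ℕ) :
    (∀ h : 𝔱, ∀ s ∈ descend b v n, ⁅(h : 𝔤), s⁆ ∈ descend b v n) ∧
      ∀ x ∈ nilradical b, ∀ s ∈ descend b v n, ⁅x, s⁆ ∈ descend b v n := by
  induction n with
  | zero =>
    refine ⟨fun h s hs => ?_, fun x hx s hs => ?_⟩ <;>
      obtain ⟨c, rfl⟩ := Submodule.mem_span_singleton.mp hs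
    · rw [lie_smul, hv.cartan_lie]
      exact Submodule.smul_mem _ _ (Submodule.smul_mem _ _ (Submodule.mem_span_singleton_self v))
    · rw [lie_smul, hv.nilradical_lie x hx, smul_zero]
      exact zero_mem _
  | succ n ih =>
    have h2 : ∀ y : 𝔤, ∀ s ∈ descend b v n, ⁅y, s⁆ ∈ descend b v (n + 1) :=
      fun y s hs => lie_mem_descend_succ ih.1 ih.2 y hs
    exact ⟨fun h => stable_descend_succ (ih.1 h) h2,
      fun x hx => stable_descend_succ (ih.2 x hx) h2⟩

lemma exists_mem_descend (hv : IsHighestWeightVector b ν v) {y : M}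
    (hy : y ∈ LieSubmodule.lieSpan ℂ 𝔤 {v}) : ∃ n, y ∈ descend b v n := by
  have hmono : Monotone (descend b v) := monotone_nat_of_le_succ (descend_le_succ v)
  induction hy using LieSubmodule.lieSpan_induction with
  | mem x hx => exact ⟨0, Submodule.subset_span hx⟩
  | zero => exact ⟨0, zero_mem _⟩
  | add x y _ _ hx hy =>
    obtain ⟨m, hm⟩ := hx
    obtain ⟨n, hn⟩ := hy
    exact ⟨max m n, add_mem (hmono (le_max_left m n) hm) (hmono (le_max_right m n) hn)⟩
  | smul c x _ hx =>
    obtain ⟨m, hm⟩ := hx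
    exact ⟨m, Submodule.smul_mem _ c hm⟩
  | lie x y _ hy =>
    obtain ⟨m, hm⟩ := hy
    exact ⟨m + 1, lie_mem_descend_succ (lie_mem_descend hv m).1 (lie_mem_descend hv m).2 x hm⟩

lemma lieSpan_le_iSup_weightVectors (hv : IsHighestWeightVector b ν v) :
    (LieSubmodule.lieSpan ℂ 𝔤 {v}).toSubmodule ≤ ⨆ β : rootCone b,
      (LieSubmodule.lieSpan ℂ 𝔤 {v}).toSubmodule ⊓
        weightVectors 𝔱 M (ν - (β : Module.Dual ℂ 𝔱)) := by
  set S := LieSubmodule.lieSpan ℂ 𝔤 {v}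
  set W := ⨆ β : rootCone b, S.toSubmodule ⊓ weightVectors 𝔱 M (ν - (β : Module.Dual ℂ 𝔱)) with hW
  suffices ∀ n, descend b v n ≤ W by
    intro y hy
    obtain ⟨n, hn⟩ := exists_mem_descend hv hy
    exact this n hn
  intro n
  induction n with
  | zero =>
    rw [descend, Submodule.span_singleton_le_iff_mem]
    refine Submodule.mem_iSup_of_mem 0 ⟨LieSubmodule.subset_lieSpan (Set.mem_singleton v), ?_⟩
    rw [SetLike.mem_coe, mem_weightVectors]
    simpa using hv.cartan_lie
  | succ n ih =>
    refine sup_le ih (Submodule.span_le.mpr ?_)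
    rintro _ ⟨f, hf, s, hs, rfl⟩
    suffices ∀ f ∈ negNilradical b, W ≤ W.comap (LieModule.toEnd ℂ 𝔤 M f) from this f hf (ih hs)
    refine negNilradical_induction (fun s _ => by simp)
      (fun x y hx hy s hs => ?_) fun α hα f hf => iSup_le fun β s hs => ?_
    · change ⁅x + y, s⁆ ∈ W
      rw [add_lie]
      exact W.add_mem (hx hs) (hy hs)
    · refine Submodule.mem_iSup_of_mem (β + ⟨_, root_mem_rootCone hα⟩)
        ⟨S.lie_mem hs.1, ?_⟩
      have := lie_mem_weightVectors_neg hf hs.2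
      rw [sub_sub] at this
      exact this

lemma sub_mem_rootCone (hv : IsHighestWeightVector b ν v) {y : M}
    (hy : y ∈ LieSubmodule.lieSpan ℂ 𝔤 {v}) (hy0 : y ≠ 0) {χ : Module.Dual ℂ 𝔱}
    (hχ : y ∈ weightVectors 𝔱 M χ) : ν - χ ∈ rootCone b := by
  by_contra h
  refine hy0 (Submodule.disjoint_def.mp (iSupIndep_weightVectors 𝔱 M χ) y hχ ?_)
  refine iSup_le (a := ⨆ j, ⨆ (_ : j ≠ χ), weightVectors 𝔱 M j) (fun β => ?_)
    (lieSpan_le_iSup_weightVectors hv hy)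
  refine inf_le_right.trans (le_iSup₂_of_le (ν - (β : Module.Dual ℂ 𝔱)) ?_ le_rfl)
  rintro rfl
  exact h (by simp)

/-! ### The invariant form on weights -/

/-- The real part of the canonical invariant form on weights. -/
def weightForm (χ ψ : Module.Dual ℂ 𝔱) : ℝ :=
  ∑ α, (χ ((rootSystem 𝔱).coroot α)).re * (ψ ((rootSystem 𝔱).coroot α)).re

lemma weightForm_comm (χ ψ : Module.Dual ℂ 𝔱) : weightForm χ ψ = weightForm ψ χ := by
  simp only [weightForm, mul_comm]

lemma weightForm_add_left (χ χ' ψ : Module.Dual ℂ 𝔱) :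
    weightForm (χ + χ') ψ = weightForm χ ψ + weightForm χ' ψ := by
  simp only [weightForm, LinearMap.add_apply, Complex.add_re, add_mul, Finset.sum_add_distrib]

lemma weightForm_smul_left (c : ℝ) (χ ψ : Module.Dual ℂ 𝔱) :
    weightForm ((c : ℂ) • χ) ψ = c * weightForm χ ψ := by
  simp only [weightForm, LinearMap.smul_apply, smul_eq_mul, Complex.re_ofReal_mul, mul_assoc,
    Finset.mul_sum]

lemma weightForm_neg_left (χ ψ : Module.Dual ℂ 𝔱) : weightForm (-χ) ψ = -weightForm χ ψ := by
  simp [weightForm]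

lemma weightForm_smul_right (c : ℝ) (χ ψ : Module.Dual ℂ 𝔱) :
    weightForm χ ((c : ℂ) • ψ) = c * weightForm χ ψ := by
  rw [weightForm_comm, weightForm_smul_left, weightForm_comm]

lemma weightForm_neg_right (χ ψ : Module.Dual ℂ 𝔱) : weightForm χ (-ψ) = -weightForm χ ψ := by
  rw [weightForm_comm, weightForm_neg_left, weightForm_comm]

lemma weightForm_add_self (χ ψ : Module.Dual ℂ 𝔱) :
    weightForm (χ + ψ) (χ + ψ) = weightForm χ χ + 2 * weightForm χ ψ + weightForm ψ ψ := by
  rw [weightForm_add_left, weightForm_comm χ, weightForm_comm ψ, weightForm_add_left,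
    weightForm_add_left, weightForm_comm ψ χ]
  ring

lemma weightForm_neg_self (χ : Module.Dual ℂ 𝔱) : weightForm (-χ) (-χ) = weightForm χ χ := by
  rw [weightForm_neg_left, weightForm_comm, weightForm_neg_left, neg_neg]

lemma weightForm_self_nonneg (χ : Module.Dual ℂ 𝔱) : 0 ≤ weightForm χ χ :=
  Finset.sum_nonneg fun _ _ => mul_self_nonneg _

lemma weightForm_root_pos (i : 𝔱.root) :
    0 < weightForm ((rootSystem 𝔱).root i) ((rootSystem 𝔱).root i) := by
  refine Finset.sum_pos' (fun _ _ => mul_self_nonneg _) ⟨i, Finset.mem_univ i, ?_⟩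
  have : (rootSystem 𝔱).root i ((rootSystem 𝔱).coroot i) = 2 := (rootSystem 𝔱).root_coroot_two i
  rw [this]
  norm_num

lemma weightForm_reflection (i : 𝔱.root) (χ ψ : Module.Dual ℂ 𝔱) :
    weightForm ((rootSystem 𝔱).reflection i χ) ((rootSystem 𝔱).reflection i ψ) =
      weightForm χ ψ := by
  have key : ∀ (χ : Module.Dual ℂ 𝔱) (α : 𝔱.root),
      ((rootSystem 𝔱).reflection i χ) ((rootSystem 𝔱).coroot α) =
        χ ((rootSystem 𝔱).coroot ((rootSystem 𝔱).reflectionPerm i α)) := by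
    intro χ α
    exact (rootSystem 𝔱).coroot'_reflection χ
  simp only [weightForm, key]
  exact Equiv.sum_comp ((rootSystem 𝔱).reflectionPerm i) fun α =>
    (χ ((rootSystem 𝔱).coroot α)).re * (ψ ((rootSystem 𝔱).coroot α)).re

/-- Invariance under the reflection gives `(χ, α) = (χ - cα, -α)`, which rearranges to the claim. -/
lemma two_mul_weightForm_root {χ : Module.Dual ℂ 𝔱} {i : 𝔱.root} {c : ℝ}
    (hc : χ ((rootSystem 𝔱).coroot i) = c) :
    2 * weightForm χ ((rootSystem 𝔱).root i) =
      c * weightForm ((rootSystem 𝔱).root i) ((rootSystem 𝔱).root i) := by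
  have h1 := weightForm_reflection i χ ((rootSystem 𝔱).root i)
  have h2 : (rootSystem 𝔱).reflection i χ = χ + ((-c : ℝ) : ℂ) • (rootSystem 𝔱).root i := by
    rw [RootPairing.reflection_apply, Complex.ofReal_neg, neg_smul, ← hc, sub_eq_add_neg]
    rfl
  rw [RootPairing.reflection_apply_self, h2, weightForm_comm, weightForm_neg_left,
    weightForm_comm, weightForm_add_left, weightForm_smul_left] at h1
  linarith

lemma root_coroot_eq_intCast (i j : 𝔱.root) :
    ∃ n : ℤ, (rootSystem 𝔱).root i ((rootSystem 𝔱).coroot j) = n :=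
  ⟨(rootSystem 𝔱).pairingIn ℤ i j, ((rootSystem 𝔱).algebraMap_pairingIn ℤ i j).symm⟩

lemma rootCone_coroot_eq_intCast {δ : Module.Dual ℂ 𝔱} (hδ : δ ∈ rootCone b) (j : 𝔱.root) :
    ∃ n : ℤ, δ ((rootSystem 𝔱).coroot j) = n := by
  induction hδ using AddSubmonoid.closure_induction with
  | mem x hx =>
    obtain ⟨i, -, rfl⟩ := hx
    exact root_coroot_eq_intCast i j
  | zero => exact ⟨0, by simp⟩
  | add x y _ _ hx hy =>
    obtain ⟨m, hm⟩ := hx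
    obtain ⟨n, hn⟩ := hy
    exact ⟨m + n, by rw [LinearMap.add_apply, hm, hn, Int.cast_add]⟩

lemma weightForm_rootCone_nonneg {χ : Module.Dual ℂ 𝔱} (hχ : χ ∈ dominantWeights b)
    {δ : Module.Dual ℂ 𝔱} (hδ : δ ∈ rootCone b) : 0 ≤ weightForm χ δ := by
  induction hδ using AddSubmonoid.closure_induction with
  | mem x hx =>
    obtain ⟨i, hi, rfl⟩ := hx
    obtain ⟨n, hn⟩ := hχ i hi
    have h1 := two_mul_weightForm_root (χ := χ) (i := i) (c := n) (by simpa using hn)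
    have h2 := mul_nonneg (Nat.cast_nonneg (α := ℝ) n) (weightForm_root_pos i).le
    linarith
  | zero => simp [weightForm]
  | add x y _ _ hx hy =>
    rw [weightForm_comm, weightForm_add_left, weightForm_comm x, weightForm_comm y]
    exact add_nonneg hx hy

lemma weightForm_le_of_sub_mem {χ ν : Module.Dual ℂ 𝔱} (hχ : χ ∈ dominantWeights b)
    (h : ν - χ ∈ rootCone b) : weightForm χ χ ≤ weightForm ν ν := by
  have h1 := weightForm_add_self χ (ν - χ)
  rw [add_sub_cancel] at h1
  have h2 := weightForm_rootCone_nonneg hχ h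
  have h3 := weightForm_self_nonneg (ν - χ)
  linarith

lemma weightForm_lt_of_weightLT {χ ν : Module.Dual ℂ 𝔱} (hχ : χ ∈ dominantWeights b)
    (h : WeightLT b χ ν) : weightForm χ χ < weightForm ν ν := by
  have h1 := weightForm_add_self χ (ν - χ)
  rw [add_sub_cancel] at h1
  have h2 := weightForm_rootCone_nonneg hχ h.2
  refine lt_of_le_of_ne (weightForm_le_of_sub_mem hχ h.2) fun h3 => ?_
  have h4 : weightForm (ν - χ) (ν - χ) = 0 :=
    le_antisymm (by linarith) (weightForm_self_nonneg _)
  refine h.1 (sub_eq_zero.mp (b.toCoweightBasis.ext fun i => ?_ : ν - χ = 0)).symm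
  rw [b.toCoweightBasis_apply, LinearMap.zero_apply]
  -- The form sees only real parts; the values of `ν - χ` on coroots are integers, so length zero
  -- does force `ν = χ`.
  have h5 := (Finset.sum_eq_zero_iff_of_nonneg fun _ _ => mul_self_nonneg _).mp h4 i.1
    (Finset.mem_univ _)
  obtain ⟨n, hn⟩ := rootCone_coroot_eq_intCast h.2 i.1
  rw [hn] at h5 ⊢
  simpa using h5

lemma IsHighestWeightVector.mem_dominantWeights [FiniteDimensional ℂ M]
    (hv : IsHighestWeightVector b ν v) : ν ∈ dominantWeights b := by
  intro i hi
  obtain ⟨e, f, t, he, hf⟩ := exists_sl2Triple 𝔱 i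
  have P : IsSl2Triple.HasPrimitiveVectorWith t v (ν ((rootSystem 𝔱).coroot i)) :=
    ⟨hv.ne_zero, hv.cartan_lie _,
      hv.nilradical_lie e (mem_nilradical (b.isPos_of_mem_support hi) he)⟩
  exact P.exists_nat

lemma pow_lie_mem_weightVectors {i : 𝔱.root} {e : 𝔤} (he : e ∈ rootSpace 𝔱 (i.1 : 𝔱 → ℂ))
    {χ : Module.Dual ℂ 𝔱} {y : M} (hy : y ∈ weightVectors 𝔱 M χ) (n : ℕ) :
    (LieModule.toEnd ℂ 𝔤 M e ^ n) y ∈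
      weightVectors 𝔱 M (χ + (n : ℂ) • (rootSystem 𝔱).root i) := by
  induction n with
  | zero => simpa using hy
  | succ n ih =>
    rw [pow_succ', Module.End.mul_apply, Nat.cast_add, Nat.cast_one, add_smul, one_smul,
      ← add_assoc]
    exact lie_mem_weightVectors he ih

lemma pow_lie_mem {S : LieSubmodule ℂ 𝔤 M} (e : 𝔤) {y : M} (hy : y ∈ S) (n : ℕ) :
    (LieModule.toEnd ℂ 𝔤 M e ^ n) y ∈ S := by
  induction n with
  | zero => simpa using hy
  | succ n ih =>
    rw [pow_succ', Module.End.mul_apply]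
    exact S.lie_mem ih

/-- A longest weight, chosen of maximal height among the longest ones, must be dominant; being `ν`
minus a sum of simple roots, it is then no longer than `ν`. -/
lemma weightForm_le [FiniteDimensional ℂ M] (hv : IsHighestWeightVector b ν v) {y : M}
    (hy : y ∈ LieSubmodule.lieSpan ℂ 𝔤 {v}) (hy0 : y ≠ 0) {χ : Module.Dual ℂ 𝔱}
    (hχ : y ∈ weightVectors 𝔱 M χ) : weightForm χ χ ≤ weightForm ν ν := by
  set S := LieSubmodule.lieSpan ℂ 𝔤 {v}
  let Wt : Set (Module.Dual ℂ 𝔱) := {χ | ∃ y ∈ S, y ≠ 0 ∧ y ∈ weightVectors 𝔱 M χ}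
  have hfin : Wt.Finite := by
    refine (WellFoundedGT.finite_ne_bot_of_iSupIndep (iSupIndep_weightVectors 𝔱 M)).subset ?_
    rintro χ ⟨y, -, hy0, hy⟩ h
    rw [h, Submodule.mem_bot] at hy
    exact hy0 hy
  let ht : Module.Dual ℂ 𝔱 → ℝ := fun χ => (b.toWeightBasis.constr ℂ (fun _ => (1 : ℂ)) χ).re
  have hroot : ∀ i ∈ b.support, b.toWeightBasis.constr ℂ (fun _ => (1 : ℂ))
      ((rootSystem 𝔱).root i) = 1 := by
    intro i hi
    have := b.toWeightBasis.constr_basis ℂ (fun _ => (1 : ℂ)) ⟨i, hi⟩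
    rwa [b.toWeightBasis_apply] at this
  obtain ⟨χ₀, hχ₀, hmax₀⟩ := Set.exists_max_image Wt (fun χ => weightForm χ χ) hfin
    ⟨χ, y, hy, hy0, hχ⟩
  obtain ⟨ψ, ⟨hψ, hψ₀⟩, hmax⟩ := Set.exists_max_image
    {χ ∈ Wt | weightForm χ χ = weightForm χ₀ χ₀} ht (hfin.subset fun _ h => h.1) ⟨χ₀, hχ₀, rfl⟩
  have hle : weightForm χ χ ≤ weightForm ψ ψ := by
    rw [hψ₀]
    exact hmax₀ χ ⟨y, hy, hy0, hχ⟩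
  obtain ⟨z, hzS, hz0, hz⟩ := hψ
  have hcone := sub_mem_rootCone hv hzS hz0 hz
  refine hle.trans (weightForm_le_of_sub_mem (fun i hi => ?_) hcone)
  obtain ⟨m, hm⟩ : ∃ m : ℤ, ψ ((rootSystem 𝔱).coroot i) = m := by
    obtain ⟨k, hk⟩ := hv.mem_dominantWeights i hi
    obtain ⟨l, hl⟩ := rootCone_coroot_eq_intCast hcone i
    refine ⟨k - l, ?_⟩
    rw [LinearMap.sub_apply, hk] at hl
    push_cast
    rw [← hl]
    ring
  rcases le_or_gt 0 m with h0 | h0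
  · lift m to ℕ using h0
    exact ⟨m, by exact_mod_cast hm⟩
  exfalso
  obtain ⟨n, rfl⟩ : ∃ n : ℕ, m = -n := ⟨m.natAbs, by omega⟩
  have hn : 0 < (n : ℝ) := by
    have : 0 < n := by omega
    exact_mod_cast this
  obtain ⟨e, f, t, he, hf⟩ := exists_sl2Triple 𝔱 i
  have hform := two_mul_weightForm_root (χ := ψ) (i := i) (c := -n) (by simpa using hm)
  have hpos := weightForm_root_pos i
  -- With `ψ(α^∨) = -n < 0`, the weight `ψ - α` would be strictly longer than the longest one.
  have hfz : ⁅f, z⁆ = 0 := by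
    by_contra hne
    have h1 : weightForm _ _ ≤ weightForm χ₀ χ₀ :=
      hmax₀ _ ⟨⁅f, z⁆, S.lie_mem hzS, hne, lie_mem_weightVectors_neg hf hz⟩
    rw [← hψ₀, sub_eq_add_neg, weightForm_add_self, weightForm_neg_self,
      weightForm_neg_right] at h1
    nlinarith
  have hez := pow_e_ne_zero t hz0 hfz (n := n) (by
    rw [mem_weightVectors.mp hz, hm]
    simp)
  have hw := pow_lie_mem_weightVectors he hz n
  -- `ψ + n α` is the reflection of `ψ`: it has the same length and is a weight by `pow_e_ne_zero`,
  -- yet its height is larger by `n`.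
  have h2 := hmax _ ⟨⟨_, pow_lie_mem e hzS n, hez, hw⟩, by
    rw [← hψ₀, ← Complex.ofReal_natCast, weightForm_add_self, weightForm_smul_right,
      weightForm_smul_right, weightForm_smul_left]
    linear_combination (n : ℝ) * hform⟩
  simp only [ht, map_add, map_smul, hroot i hi, smul_eq_mul, mul_one, Complex.add_re,
    Complex.natCast_re] at h2
  linarith

/-! ### Highest weight functionals -/

lemma exists_apply_ne_zero_of_mem_iSup {ι : Sort*} {P : ι → Submodule ℂ M} {φ : M →ₗ[ℂ] ℂ} {m : M}
    (hm : m ∈ ⨆ i, P i) (h : φ m ≠ 0) : ∃ i, ∃ y ∈ P i, φ y ≠ 0 := by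
  by_contra! h'
  exact h ((iSup_le fun i y hy => h' i y hy : ⨆ i, P i ≤ LinearMap.ker φ) hm)

lemma weight_eq_neg {η χ : Module.Dual ℂ 𝔱} {φ : M →ₗ[ℂ] ℂ}
    (hφ : φ ∈ weightVectors 𝔱 (M →ₗ[ℂ] ℂ) η) {m : M} (hm : m ∈ weightVectors 𝔱 M χ)
    (h : φ m ≠ 0) : η = -χ := by
  ext k
  have h1 := LinearMap.congr_fun (mem_weightVectors.mp hφ k) m
  rw [Module.Dual.lie_apply, mem_weightVectors.mp hm, map_smul, LinearMap.smul_apply,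
    smul_eq_mul, smul_eq_mul, ← neg_mul] at h1
  exact (mul_right_cancel₀ h h1).symm

lemma weightForm_eq_of_apply_ne_zero {η χ : Module.Dual ℂ 𝔱} {φ : M →ₗ[ℂ] ℂ}
    (hφ : φ ∈ weightVectors 𝔱 (M →ₗ[ℂ] ℂ) η) {m : M} (hm : m ∈ weightVectors 𝔱 M χ)
    (h : φ m ≠ 0) : weightForm η η = weightForm χ χ := by
  rw [weight_eq_neg hφ hm h, weightForm_neg_self]

/-- Some functional in the module generated by `φ` is nonzero on `v`, for otherwise the annihilator
of that module would contain everything generated by `v`. So `-ν` is a weight of a highest weight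
module with top weight `η`, and `weightForm_le` applies in the dual. -/
lemma weightForm_le_of_functional [FiniteDimensional ℂ M] (hv : IsHighestWeightVector b ν v)
    {η : Module.Dual ℂ 𝔱} {φ : M →ₗ[ℂ] ℂ} (hφ : IsHighestWeightVector b η φ)
    (hne : ∃ y ∈ LieSubmodule.lieSpan ℂ 𝔤 {v}, φ y ≠ 0) : weightForm ν ν ≤ weightForm η η := by
  obtain ⟨y, hy, hφy⟩ := hne
  obtain ⟨ψ, hψ, hψv⟩ : ∃ ψ ∈ LieSubmodule.lieSpan ℂ 𝔤 {φ}, ψ v ≠ 0 := by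
    by_contra! h
    let Z : LieSubmodule ℂ 𝔤 M :=
      { carrier := {m | ∀ ψ ∈ LieSubmodule.lieSpan ℂ 𝔤 {φ}, ψ m = 0}
        add_mem' := fun h1 h2 ψ hψ => by rw [map_add, h1 ψ hψ, h2 ψ hψ, add_zero]
        zero_mem' := fun ψ _ => map_zero ψ
        smul_mem' := fun c m hm ψ hψ => by rw [map_smul, hm ψ hψ, smul_zero]
        lie_mem := fun {x m} hm ψ hψ => by
          have := hm ⁅x, ψ⁆ (LieSubmodule.lie_mem _ hψ)
          rwa [Module.Dual.lie_apply, neg_eq_zero] at this }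
    have hZ : LieSubmodule.lieSpan ℂ 𝔤 {v} ≤ Z :=
      LieSubmodule.lieSpan_le.mpr (Set.singleton_subset_iff.mpr h)
    exact hφy (hZ hy φ (LieSubmodule.subset_lieSpan (Set.mem_singleton φ)))
  obtain ⟨β, ψ', ⟨hψ', hw⟩, hψv'⟩ := exists_apply_ne_zero_of_mem_iSup (φ := LinearMap.applyₗ v)
    (lieSpan_le_iSup_weightVectors hφ hψ) hψv
  have h1 : ψ' v ≠ 0 := hψv'
  have h0 : ψ' ≠ 0 := by
    rintro rfl
    exact h1 rfl
  rw [← weightForm_eq_of_apply_ne_zero hw (mem_weightVectors.mpr hv.cartan_lie) h1]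
  exact weightForm_le hφ hψ' h0 hw

/-- If `φ` were nonzero on `N`, then `-η` would be a weight of `N`, whence `|η|² ≤ |μ|² < |ν|²`; but
`|ν|² ≤ |η|²` by `weightForm_le_of_functional`. -/
lemma apply_eq_zero_of_weightLT [FiniteDimensional ℂ M] (hv : IsHighestWeightVector b ν v)
    {η : Module.Dual ℂ 𝔱} {φ : M →ₗ[ℂ] ℂ} (hφ : IsHighestWeightVector b η φ)
    (hne : ∃ y ∈ LieSubmodule.lieSpan ℂ 𝔤 {v}, φ y ≠ 0) {N : LieSubmodule ℂ 𝔤 M}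
    {μ : Module.Dual ℂ 𝔱} (hlt : WeightLT b μ ν) (hN : IsIrrep b N μ) {m : M} (hm : m ∈ N) :
    φ m = 0 := by
  by_contra hφm
  obtain ⟨w, hw⟩ := hN.exists_highestWeightVector
  have htop : LieSubmodule.lieSpan ℂ 𝔤 {w} = ⊤ := by
    have := hN.irreducible
    refine (eq_bot_or_eq_top _).resolve_left fun h => hw.ne_zero ?_
    have h1 := LieSubmodule.subset_lieSpan (R := ℂ) (L := 𝔤) (Set.mem_singleton w)
    rw [h] at h1
    exact h1
  have hm' : (⟨m, hm⟩ : N) ∈ (LieSubmodule.lieSpan ℂ 𝔤 {w}).toSubmodule := by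
    rw [htop]
    trivial
  obtain ⟨β, y, ⟨hy, hyw⟩, hφy⟩ := exists_apply_ne_zero_of_mem_iSup
    (φ := φ ∘ₗ N.toSubmodule.subtype) (lieSpan_le_iSup_weightVectors hw hm') hφm
  have h0 : y ≠ 0 := by
    rintro rfl
    exact hφy (map_zero _)
  have h1 := weightForm_le hw hy h0 hyw
  have h2 : (y : M) ∈ weightVectors 𝔱 M (μ - (β : Module.Dual ℂ 𝔱)) :=
    mem_weightVectors.mpr fun h => congrArg Subtype.val (mem_weightVectors.mp hyw h)
  have h3 := weightForm_eq_of_apply_ne_zero (mem_weightVectors.mpr hφ.cartan_lie) h2 hφy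
  have h4 := weightForm_lt_of_weightLT hw.mem_dominantWeights hlt
  have h5 := weightForm_le_of_functional hv hφ hne
  linarith

end HighestWeight

/-! ### Matrix coefficients -/

section Coefficients

variable {A : Type*} [CommRing A] [HopfAlgebra ℂ A]
  {V : Type*} [AddCommGroup V] [Module ℂ V] (ρ : RatRep A V)

lemma RatRep.counit_coeff (v : V →ₗ[ℂ] ℂ) (ξ : V) :
    Coalgebra.counit (R := ℂ) (ρ.coeff v ξ) = v ξ := by
  have key : ∀ t : V ⊗[ℂ] A, Coalgebra.counit (R := ℂ)
      ((TensorProduct.lid ℂ A) (LinearMap.rTensor A v t)) =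
      v ((TensorProduct.rid ℂ V) (LinearMap.lTensor V (Coalgebra.counit (R := ℂ)) t)) := by
    intro t
    induction t with
    | zero => simp
    | tmul x y => simp [mul_comm]
    | add x y hx hy => simp only [map_add, hx, hy]
  have h := LinearMap.congr_fun ρ.counit ξ
  simp only [LinearMap.comp_apply, LinearEquiv.coe_coe, LinearMap.id_apply] at h
  rw [RatRep.coeff, LinearMap.comp_apply, LinearMap.comp_apply, LinearEquiv.coe_coe, key, h]

lemma RatRep.convLeft_coeff (φ : A →ₗ[ℂ] ℂ) (v : V →ₗ[ℂ] ℂ) (ξ : V) :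
    convLeft φ (ρ.coeff v ξ) =
      ρ.coeff v ((TensorProduct.rid ℂ V) (LinearMap.lTensor V φ (ρ.coact ξ))) := by
  let F : V ⊗[ℂ] (A ⊗[ℂ] A) →ₗ[ℂ] A := (TensorProduct.lid ℂ A).toLinearMap ∘ₗ
    TensorProduct.map v ((TensorProduct.rid ℂ A).toLinearMap ∘ₗ LinearMap.lTensor A φ)
  have h1 : ∀ t : V ⊗[ℂ] A, convLeft φ ((TensorProduct.lid ℂ A) (LinearMap.rTensor A v t)) =
      F (LinearMap.lTensor V (Coalgebra.comul (R := ℂ)) t) := by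
    intro t
    induction t with
    | zero => simp
    | tmul x y => simp [F, convLeft]
    | add x y hx hy => simp only [map_add, hx, hy]
  have h2 : ∀ (s : V ⊗[ℂ] A) (a : A), F ((TensorProduct.assoc ℂ V A A) (s ⊗ₜ[ℂ] a)) =
      φ a • (TensorProduct.lid ℂ A) (LinearMap.rTensor A v s) := by
    intro s a
    induction s with
    | zero => simp
    | tmul x y =>
      change v x • φ a • y = φ a • v x • y
      exact smul_comm _ _ _
    | add x y hx hy => simp only [map_add, TensorProduct.add_tmul, hx, hy, smul_add]
  have h3 : ∀ t : V ⊗[ℂ] A, F ((TensorProduct.assoc ℂ V A A) (LinearMap.rTensor A ρ.coact t)) =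
      ρ.coeff v ((TensorProduct.rid ℂ V) (LinearMap.lTensor V φ t)) := by
    intro t
    induction t with
    | zero => simp
    | tmul x y =>
      rw [LinearMap.rTensor_tmul, h2, LinearMap.lTensor_tmul, TensorProduct.rid_tmul, map_smul]
      rfl
    | add x y hx hy => simp only [map_add, hx, hy]
  have h := LinearMap.congr_fun ρ.coassoc ξ
  simp only [LinearMap.comp_apply, LinearEquiv.coe_coe] at h
  rw [← h3, h, ← h1]
  rfl

lemma RatRep.coeff_smul (c : ℂ) (v : V →ₗ[ℂ] ℂ) (ξ : V) :
    ρ.coeff (c • v) ξ = c • ρ.coeff v ξ := by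
  simp [RatRep.coeff, LinearMap.rTensor_smul]

variable {𝔤 : Type*} [LieRing 𝔤] [LieAlgebra ℂ 𝔤] {e : 𝔤 ≃ₗ⁅ℂ⁆ lieAlg A}
  [LieRingModule 𝔤 V] {ρ}

lemma leftField_coeff (hρ : ρ.Integrates e) (x : 𝔤) (v : V →ₗ[ℂ] ℂ) (ξ : V) :
    leftField e x (ρ.coeff v ξ) = ρ.coeff v ⁅x, ξ⁆ := by
  rw [leftField_eq, ρ.convLeft_coeff, ← hρ]
  rfl

variable [IsDomain A] [Algebra.FiniteType ℂ A]

/-- An equivariant map into the functions whose values vanish at the identity is zero. -/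
lemma eq_zero_of_equivariant (e : 𝔤 ≃ₗ⁅ℂ⁆ lieAlg A) {X : Type*} [AddCommGroup X] [Module ℂ X]
    [LieRingModule 𝔤 X] {G : X →ₗ[ℂ] A} (hG : ∀ x ξ, leftField e x (G ξ) = G ⁅x, ξ⁆)
    (h0 : ∀ ξ, Coalgebra.counit (R := ℂ) (G ξ) = 0) (ξ : X) : G ξ = 0 := by
  refine eq_zero_of_stable (LinearMap.range G) ?_ ?_ _ (LinearMap.mem_range_self G ξ)
  · rintro D _ ⟨ζ, rfl⟩
    have := hG (e.symm D) ζ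
    rw [leftField_apply, LieEquiv.apply_symm_apply] at this
    rw [this]
    exact LinearMap.mem_range_self G _
  · rintro _ ⟨ζ, rfl⟩
    exact h0 ζ

variable [LieModule ℂ 𝔤 V]

/-- Both sides are equivariant in `ξ` for left fields, so they need only be compared at the
identity. -/
lemma rightField_coeff (hρ : ρ.Integrates e) (x : 𝔤) (v : V →ₗ[ℂ] ℂ) (ξ : V) :
    rightField e x (ρ.coeff v ξ) = -ρ.coeff ⁅x, v⁆ ξ := by
  rw [eq_neg_iff_add_eq_zero]
  refine eq_zero_of_equivariant e (G := rightField e x ∘ₗ ρ.coeff v + ρ.coeff ⁅x, v⁆)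
    (fun y ζ => ?_) (fun ζ => ?_) ξ
  · simp only [LinearMap.add_apply, LinearMap.comp_apply, map_add]
    rw [leftField_rightField, leftField_coeff hρ, leftField_coeff hρ]
  · simp only [LinearMap.add_apply, LinearMap.comp_apply, map_add]
    rw [counit_rightField, leftField_coeff hρ, ρ.counit_coeff, ρ.counit_coeff,
      Module.Dual.lie_apply, add_neg_cancel]

/-- The kernel of `ρ.coeff v` is a submodule, and it is proper because the value at the identity
recovers `v`. -/
lemma coeff_ne_zero (hρ : ρ.Integrates e) (hV : LieModule.IsIrreducible ℂ 𝔤 V) {v : V →ₗ[ℂ] ℂ}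
    (hv : v ≠ 0) {ξ : V} (hξ : ξ ≠ 0) : ρ.coeff v ξ ≠ 0 := by
  intro h
  let Z : LieSubmodule ℂ 𝔤 V :=
    { LinearMap.ker (ρ.coeff v) with
      lie_mem := fun {x m} hm => by
        have hm' : ρ.coeff v m = 0 := hm
        change ρ.coeff v ⁅x, m⁆ = 0
        rw [← leftField_coeff hρ, hm', map_zero] }
  have hZ : Z = ⊤ := (eq_bot_or_eq_top Z).resolve_left fun hbot => hξ (by
    have : ξ ∈ Z := h
    rwa [hbot, LieSubmodule.mem_bot] at this)
  refine hv (LinearMap.ext fun ζ => ?_)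
  have : ζ ∈ Z := hZ ▸ LieSubmodule.mem_top ζ
  rw [← ρ.counit_coeff, show ρ.coeff v ζ = 0 from this, map_zero, LinearMap.zero_apply]

end Coefficients

/-! ### The graded ring `ℂ[N\G]` -/

section Graded

open LieAlgebra LieAlgebra.IsKilling

variable {𝔤 : Type*} [LieRing 𝔤] [LieAlgebra ℂ 𝔤] [FiniteDimensional ℂ 𝔤]
  [LieAlgebra.IsSemisimple ℂ 𝔤]
  {𝔱 : LieSubalgebra ℂ 𝔤} [𝔱.IsCartanSubalgebra]
  {b : (rootSystem 𝔱).Base} {ep em : 𝔱.root → 𝔤}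
  {A : Type*} [CommRing A] [HopfAlgebra ℂ A] [IsDomain A] [Algebra.FiniteType ℂ A]
  {e : 𝔤 ≃ₗ⁅ℂ⁆ lieAlg A}

lemma leftField_mem_quotientRing (x : 𝔤) {f : A} (hf : f ∈ quotientRing e b) :
    leftField e x f ∈ quotientRing e b := by
  rw [mem_quotientRing_iff] at *
  intro y hy
  rw [← leftField_rightField, hf y hy, map_zero]

lemma leftField_mem_gradedPiece (x : 𝔤) {ϖ : Module.Dual ℂ 𝔱} {f : A}
    (hf : f ∈ gradedPiece e b ϖ) : leftField e x f ∈ gradedPiece e b ϖ := by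
  rw [mem_gradedPiece_iff] at *
  refine ⟨fun y hy => ?_, fun h => ?_⟩
  · rw [← leftField_rightField, hf.1 y hy, map_zero]
  · rw [← leftField_rightField, hf.2, map_smul]

lemma gradedPiece_le_quotientRing (ϖ : Module.Dual ℂ 𝔱) :
    gradedPiece e b ϖ ≤ Subalgebra.toSubmodule (quotientRing e b) := by
  intro f hf
  rw [mem_gradedPiece_iff] at hf
  exact (mem_quotientRing_iff e b).mpr hf.1

lemma mul_mem_gradedPiece {ϖ ϖ' : Module.Dual ℂ 𝔱} {f g : A} (hf : f ∈ gradedPiece e b ϖ)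
    (hg : g ∈ gradedPiece e b ϖ') : f * g ∈ gradedPiece e b (ϖ + ϖ') := by
  rw [mem_gradedPiece_iff] at *
  refine ⟨fun y hy => ?_, fun h => ?_⟩
  · rw [rightField_mul, hf.1 y hy, hg.1 y hy, mul_zero, mul_zero, add_zero]
  · rw [rightField_mul, hf.2, hg.2, LinearMap.add_apply, mul_smul_comm, mul_smul_comm, mul_comm g,
      ← add_smul]
    congr 1
    ring

lemma rightField_one (x : 𝔤) : rightField e x (1 : A) = 0 := by
  have h := rightField_mul e x (1 : A) 1
  rw [one_mul, one_mul] at h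
  exact left_eq_add.mp h

lemma one_mem_gradedPiece : (1 : A) ∈ gradedPiece e b (0 : Module.Dual ℂ 𝔱) := by
  rw [mem_gradedPiece_iff]
  exact ⟨fun x _ => rightField_one x, fun h => by simp [rightField_one]⟩

lemma bidiff_leftField_mem {P Q R : Submodule ℂ A} (hP : ∀ x, ∀ f ∈ P, leftField e x f ∈ P)
    (hQ : ∀ x, ∀ f ∈ Q, leftField e x f ∈ Q) (hPQ : ∀ f ∈ P, ∀ g ∈ Q, f * g ∈ R)
    (Λ : 𝔤 ⊗[ℂ] 𝔤) {f g : A} (hf : f ∈ P) (hg : g ∈ Q) : bidiff (leftField e) Λ f g ∈ R := by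
  induction Λ with
  | zero => simp
  | tmul x y =>
    rw [bidiff_tmul]
    exact hPQ _ (hP x f hf) _ (hQ y g hg)
  | add s t hs ht =>
    rw [map_add, LinearMap.add_apply, LinearMap.add_apply]
    exact add_mem hs ht

/-- In both `e_{-α} ⊗ e_α` and `e_α ⊗ e_{-α}` one factor lies in `𝔫`, and its right field kills `f`
or `g`. -/
lemma standardBracket_eq_bidiff_leftField (he : IsRootVectors b ep em) {f g : A}
    (hf : f ∈ quotientRing e b) (hg : g ∈ quotientRing e b) :
    standardBracket e (standardLambda b ep em) f g =
      bidiff (leftField e) (standardLambda b ep em) f g := by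
  classical
  rw [mem_quotientRing_iff] at hf hg
  suffices bidiff (rightField e) (standardLambda b ep em) f g = 0 by
    rw [standardBracket, LinearMap.sub_apply, LinearMap.sub_apply, this, sub_zero]
  rw [standardLambda, map_smul, map_sum]
  simp only [LinearMap.smul_apply, LinearMap.sum_apply, map_sub, LinearMap.sub_apply,
    bidiff_tmul]
  rw [Finset.sum_eq_zero, smul_zero]
  intro α hα
  have hα : b.IsPos α := by simpa using hα
  have h := mem_nilradical hα (he α hα).1
  rw [hf _ h, hg _ h, mul_zero, zero_mul, sub_zero]

lemma bidiff_leftField_mem_quotientRing (Λ : 𝔤 ⊗[ℂ] 𝔤) {f g : A}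
    (hf : f ∈ quotientRing e b) (hg : g ∈ quotientRing e b) :
    bidiff (leftField e) Λ f g ∈ quotientRing e b :=
  bidiff_leftField_mem (P := Subalgebra.toSubmodule (quotientRing e b))
    (Q := Subalgebra.toSubmodule (quotientRing e b))
    (R := Subalgebra.toSubmodule (quotientRing e b))
    (fun x _ hf => leftField_mem_quotientRing x hf)
    (fun x _ hf => leftField_mem_quotientRing x hf) 
    (fun _ hf _ hg => (quotientRing e b).mul_mem hf hg) Λ hf hg

lemma standardBracket_mem_quotientRing (he : IsRootVectors b ep em) {f g : A}
    (hf : f ∈ quotientRing e b) (hg : g ∈ quotientRing e b) :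
    standardBracket e (standardLambda b ep em) f g ∈ quotientRing e b := by
  rw [standardBracket_eq_bidiff_leftField he hf hg]
  exact bidiff_leftField_mem_quotientRing _ hf hg

lemma standardBracket_mem_gradedPiece (he : IsRootVectors b ep em) {ϖ ϖ' : Module.Dual ℂ 𝔱}
    {f g : A} (hf : f ∈ gradedPiece e b ϖ) (hg : g ∈ gradedPiece e b ϖ') :
    standardBracket e (standardLambda b ep em) f g ∈ gradedPiece e b (ϖ + ϖ') := by
  rw [standardBracket_eq_bidiff_leftField he (gradedPiece_le_quotientRing ϖ hf)
    (gradedPiece_le_quotientRing ϖ' hg)]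
  exact bidiff_leftField_mem (fun x _ hf => leftField_mem_gradedPiece x hf)
    (fun x _ hf => leftField_mem_gradedPiece x hf) (fun _ hf _ hg => mul_mem_gradedPiece hf hg)
    _ hf hg

variable (e b) in
lemma iSupIndep_gradedPiece : iSupIndep (gradedPiece e b) := by
  refine ((iSupIndep_jointEigenspace (fun h : 𝔱 => -rightField e (h : 𝔤))).comp
    (DFunLike.coe_injective (F := Module.Dual ℂ 𝔱))).mono fun ϖ f hf => ?_
  rw [mem_gradedPiece_iff] at hf
  exact mem_jointEigenspace.mpr fun h => by rw [LinearMap.neg_apply, hf.2, neg_smul, neg_neg]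

variable (e) in
/-- A subspace stable under the right invariant vector fields, as a `𝔤`-module. -/
@[reducible]
def rightModule (F : Submodule ℂ A) (hF : ∀ x, ∀ f ∈ F, rightField e x f ∈ F) :
    LieRingModule 𝔤 F where
  -- The sign turns the anti-homomorphism of right fields into a Lie algebra action.
  bracket x f := ⟨-rightField e x f, neg_mem (hF x f f.2)⟩
  add_lie x y f := Subtype.ext (by simp [add_comm])
  lie_add x f g := Subtype.ext (by simp [add_comm])
  leibniz_lie x y f := Subtype.ext (by simp [rightField_lie])

/-- By local finiteness `f` is an `𝔫`-invariant of a finite-dimensional `𝔤`-module; the sign in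
`rightModule` matches the one in `e^{-ϖ(x)}`, so weight components are graded components. -/
lemma quotientRing_le_iSup :
    Subalgebra.toSubmodule (quotientRing e b) ≤
      ⨆ ϖ : dominantWeights b, gradedPiece e b (ϖ : Module.Dual ℂ 𝔱) := by
  intro f hf
  obtain ⟨F, hfin, hfF, hF⟩ := exists_finiteDimensional_convRight_stable f
  let := rightModule e F fun x => hF _
  have hlie : ∀ (x : 𝔤) (g : F), ((⁅x, g⁆ : F) : A) = -rightField e x g := fun _ _ => rfl
  have : LieModule ℂ 𝔤 F :=
    { smul_lie := fun c x g => Subtype.ext (by simp [hlie])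
      lie_smul := fun c x g => Subtype.ext (by simp [hlie]) }
  have hinv : (⟨f, hfF⟩ : F) ∈ nilInvariants b F := fun x hx => Subtype.ext (by
    rw [hlie, (mem_quotientRing_iff e b).mp hf x hx, neg_zero]
    rfl)
  suffices nilInvariants b F ≤ (⨆ ϖ : dominantWeights b,
      gradedPiece e b (ϖ : Module.Dual ℂ 𝔱)).comap F.subtype from this hinv
  refine nilInvariants_le_iSup.trans (iSup_le fun ϖ g hg => ?_)
  refine Submodule.mem_iSup_of_mem ϖ ((mem_gradedPiece_iff e b).mpr ⟨fun x hx => ?_, fun h => ?_⟩)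
  · have := congrArg Subtype.val (hg.1 x hx)
    rw [hlie] at this
    exact neg_eq_zero.mp this
  · have := congrArg Subtype.val (mem_weightVectors.mp hg.2 h)
    rw [hlie, neg_eq_iff_eq_neg] at this
    rw [neg_smul]
    exact this

theorem isGradedPoissonSubalgebra_quotientRing (he : IsRootVectors b ep em) :
    IsGradedPoissonSubalgebra (standardBracket e (standardLambda b ep em)) (quotientRing e b)
      (fun ϖ : dominantWeights b => gradedPiece e b (ϖ : Module.Dual ℂ 𝔱)) where
  poisson := isPoissonBracket_standardLambda e he
  br_mem _ hf _ hg := standardBracket_mem_quotientRing he hf hg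
  indep := (iSupIndep_gradedPiece b e).comp Subtype.val_injective
  iSup_eq := le_antisymm (iSup_le fun _ => gradedPiece_le_quotientRing _) quotientRing_le_iSup
  one_mem := one_mem_gradedPiece
  mul_mem_add _ _ _ hf _ hg := mul_mem_gradedPiece hf hg
  br_mem_add _ _ _ hf _ hg := standardBracket_mem_gradedPiece he hf hg

theorem exists_isPoissonBracket_quotientRing (he : IsRootVectors b ep em) :
    ∃ br : quotientRing e b →ₗ[ℂ] quotientRing e b →ₗ[ℂ] quotientRing e b,
      IsPoissonBracket br ∧
      ∀ f g, (br f g : A) = standardBracket e (standardLambda b ep em) (f : A) (g : A) := by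
  have hP := isPoissonBracket_standardLambda e he
  refine ⟨LinearMap.mk₂ ℂ (fun f g => ⟨standardBracket e (standardLambda b ep em) (f : A) (g : A),
    standardBracket_mem_quotientRing he f.2 g.2⟩) (fun f f' g => Subtype.ext (by simp))
    (fun c f g => Subtype.ext (by simp)) (fun f g g' => Subtype.ext (by simp))
    (fun c f g => Subtype.ext (by simp)), ⟨fun f => Subtype.ext (hP.self_eq_zero _),
      fun f g h => Subtype.ext (hP.jacobi _ _ _), fun f g h => Subtype.ext (hP.leibniz _ _ _)⟩,
    fun f g => rfl⟩

end Graded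

/-! ### The bracket of matrix coefficients -/

section Product

open LieAlgebra LieAlgebra.IsKilling

variable {𝔤 : Type*} [LieRing 𝔤] [LieAlgebra ℂ 𝔤] [FiniteDimensional ℂ 𝔤]
  [LieAlgebra.IsSemisimple ℂ 𝔤]
  {𝔱 : LieSubalgebra ℂ 𝔤} [𝔱.IsCartanSubalgebra]
  {b : (rootSystem 𝔱).Base} {ep em : 𝔱.root → 𝔤}
  {A : Type*} [CommRing A] [HopfAlgebra ℂ A] [IsDomain A] [Algebra.FiniteType ℂ A]
  {e : 𝔤 ≃ₗ⁅ℂ⁆ lieAlg A}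
  {V W U : Type*} [AddCommGroup V] [Module ℂ V] [LieRingModule 𝔤 V] [LieModule ℂ 𝔤 V]
  [AddCommGroup W] [Module ℂ W] [LieRingModule 𝔤 W] [LieModule ℂ 𝔤 W]
  [AddCommGroup U] [Module ℂ U] [LieRingModule 𝔤 U] [LieModule ℂ 𝔤 U]
  {ρV : RatRep A V} {ρW : RatRep A W} {ρU : RatRep A U}

lemma coeff_mem_gradedPiece (hV : ρV.Integrates e) {v : V →ₗ[ℂ] ℂ} {η : Module.Dual ℂ 𝔱}
    (hv : IsHighestWeightVector b η v) (ξ : V) : ρV.coeff v ξ ∈ gradedPiece e b η := by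
  rw [mem_gradedPiece_iff]
  refine ⟨fun x hx => ?_, fun h => ?_⟩
  · rw [rightField_coeff hV, hv.nilradical_lie x hx, ← zero_smul ℂ v, ρV.coeff_smul, zero_smul,
      neg_zero]
  · rw [rightField_coeff hV, hv.cartan_lie, ρV.coeff_smul, neg_smul]

variable (ρV ρW) in
/-- The product of matrix coefficients. -/
def coeffMul (v : V →ₗ[ℂ] ℂ) (w : W →ₗ[ℂ] ℂ) : V ⊗[ℂ] W →ₗ[ℂ] A :=
  LinearMap.mul' ℂ A ∘ₗ TensorProduct.map (ρV.coeff v) (ρW.coeff w)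

lemma coeffMul_tmul (v : V →ₗ[ℂ] ℂ) (w : W →ₗ[ℂ] ℂ) (ξ : V) (μ : W) :
    coeffMul ρV ρW v w (ξ ⊗ₜ[ℂ] μ) = ρV.coeff v ξ * ρW.coeff w μ := rfl

lemma counit_coeffMul_tmul (v : V →ₗ[ℂ] ℂ) (w : W →ₗ[ℂ] ℂ) (ξ : V) (μ : W) :
    Coalgebra.counit (R := ℂ) (coeffMul ρV ρW v w (ξ ⊗ₜ[ℂ] μ)) = v ξ * w μ := by
  rw [coeffMul_tmul, Bialgebra.counit_mul, ρV.counit_coeff, ρW.counit_coeff]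

lemma leftField_coeffMul (hV : ρV.Integrates e) (hW : ρW.Integrates e) (v : V →ₗ[ℂ] ℂ)
    (w : W →ₗ[ℂ] ℂ) (x : 𝔤) (t : V ⊗[ℂ] W) :
    leftField e x (coeffMul ρV ρW v w t) = coeffMul ρV ρW v w ⁅x, t⁆ := by
  induction t with
  | zero => simp
  | tmul ξ μ =>
    rw [coeffMul_tmul, leftField_mul, leftField_coeff hV, leftField_coeff hW,
      TensorProduct.LieModule.lie_tmul_right, map_add, coeffMul_tmul, coeffMul_tmul]
    ring
  | add s t hs ht => simp only [map_add, lie_add, hs, ht]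

lemma bidiff_leftField_coeff (hV : ρV.Integrates e) (hW : ρW.Integrates e) (v : V →ₗ[ℂ] ℂ)
    (w : W →ₗ[ℂ] ℂ) (Λ : 𝔤 ⊗[ℂ] 𝔤) (ξ : V) (μ : W) :
    bidiff (leftField e) Λ (ρV.coeff v ξ) (ρW.coeff w μ) =
      coeffMul ρV ρW v w (tensorAct 𝔤 V W Λ (ξ ⊗ₜ[ℂ] μ)) := by
  induction Λ with
  | zero => simp
  | tmul x y =>
    rw [bidiff_tmul, leftField_coeff hV, leftField_coeff hW]
    rfl
  | add s t hs ht => simp only [map_add, LinearMap.add_apply, hs, ht]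

lemma IsHighestWeightVector.tmul {ϖ lam : Module.Dual ℂ 𝔱} {m : V} {n : W}
    (hm : IsHighestWeightVector b ϖ m) (hn : IsHighestWeightVector b lam n)
    (h0 : m ⊗ₜ[ℂ] n ≠ 0) : IsHighestWeightVector b (ϖ + lam) (m ⊗ₜ[ℂ] n) where
  ne_zero := h0
  nilradical_lie x hx := by
    rw [TensorProduct.LieModule.lie_tmul_right, hm.nilradical_lie x hx, hn.nilradical_lie x hx,
      TensorProduct.zero_tmul, TensorProduct.tmul_zero, add_zero]
  cartan_lie h := by
    rw [TensorProduct.LieModule.lie_tmul_right, hm.cartan_lie, hn.cartan_lie,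
      TensorProduct.tmul_smul, ← TensorProduct.smul_tmul', ← add_smul]
    rfl

/-- A functional on `V ⊗ W` that is the product of highest weight functionals. -/
lemma isHighestWeightVector_of_tmul {η θ : Module.Dual ℂ 𝔱} {v : V →ₗ[ℂ] ℂ} {w : W →ₗ[ℂ] ℂ}
    (hv : IsHighestWeightVector b η v) (hw : IsHighestWeightVector b θ w)
    {φ : V ⊗[ℂ] W →ₗ[ℂ] ℂ} (hφ : ∀ ξ μ, φ (ξ ⊗ₜ[ℂ] μ) = v ξ * w μ) :
    IsHighestWeightVector b (η + θ) φ where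
  ne_zero := by
    rintro rfl
    obtain ⟨ξ, hξ⟩ := DFunLike.ne_iff.mp hv.ne_zero
    obtain ⟨μ, hμ⟩ := DFunLike.ne_iff.mp hw.ne_zero
    exact mul_ne_zero hξ hμ (hφ ξ μ).symm
  nilradical_lie x hx := by
    refine TensorProduct.ext' fun ξ μ => ?_
    have h1 := LinearMap.congr_fun (hv.nilradical_lie x hx) ξ
    have h2 := LinearMap.congr_fun (hw.nilradical_lie x hx) μ
    rw [Module.Dual.lie_apply, LinearMap.zero_apply, neg_eq_zero] at h1 h2
    rw [Module.Dual.lie_apply, TensorProduct.LieModule.lie_tmul_right, map_add, hφ, hφ, h1, h2]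
    simp
  cartan_lie h := by
    refine TensorProduct.ext' fun ξ μ => ?_
    have h1 := LinearMap.congr_fun (hv.cartan_lie h) ξ
    have h2 := LinearMap.congr_fun (hw.cartan_lie h) μ
    rw [Module.Dual.lie_apply, LinearMap.smul_apply, smul_eq_mul] at h1 h2
    rw [Module.Dual.lie_apply, TensorProduct.LieModule.lie_tmul_right, map_add, hφ, hφ,
      LinearMap.smul_apply, LinearMap.add_apply, hφ, smul_eq_mul]
    linear_combination w μ * h1 + v ξ * h2

lemma IsHighestWeightVector.of_comp {X : Type*} [AddCommGroup X] [Module ℂ X] [LieRingModule 𝔤 X]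
    [LieModule ℂ 𝔤 X] {p : X →ₗ⁅ℂ,𝔤⁆ U} (hp : Function.Surjective p) {η : Module.Dual ℂ 𝔱}
    {φ : X →ₗ[ℂ] ℂ} (hφ : IsHighestWeightVector b η φ) {u : U →ₗ[ℂ] ℂ} (hu : ∀ t, u (p t) = φ t) :
    IsHighestWeightVector b η u := by
  have hlie : ∀ (x : 𝔤) (t : X), ⁅x, u⁆ (p t) = ⁅x, φ⁆ t := by
    intro x t
    rw [Module.Dual.lie_apply, Module.Dual.lie_apply, ← LieModuleHom.map_lie, hu]
  refine ⟨?_, fun x hx => ?_, fun h => ?_⟩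
  · rintro rfl
    exact hφ.ne_zero (LinearMap.ext fun t => (hu t).symm)
  · refine LinearMap.ext fun y => ?_
    obtain ⟨t, rfl⟩ := hp y
    rw [hlie, hφ.nilradical_lie x hx]
    rfl
  · refine LinearMap.ext fun y => ?_
    obtain ⟨t, rfl⟩ := hp y
    rw [hlie, hφ.cartan_lie, LinearMap.smul_apply, LinearMap.smul_apply, hu]

variable [FiniteDimensional ℂ V] [FiniteDimensional ℂ W]
  {ϖ lam η θ : Module.Dual ℂ 𝔱} {v : V →ₗ[ℂ] ℂ} {w : W →ₗ[ℂ] ℂ} {p : V ⊗[ℂ] W →ₗ⁅ℂ,𝔤⁆ U}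

/-- The functional `v ⊗ w`, obtained as the value of `coeffMul` at the identity, descends along `p`
because it vanishes on every lower irreducible submodule. -/
lemma exists_functional_comp_eq (hV : ρV.Integrates e) (hW : ρW.Integrates e)
    (hVirr : IsIrrep b V ϖ) (hWirr : IsIrrep b W lam)
    (hp : IsProjectionAlongLower b (ϖ + lam) p)
    (hv : IsHighestWeightVector b η v) (hw : IsHighestWeightVector b θ w) :
    ∃ u : U →ₗ[ℂ] ℂ, ∀ t,
      u (p t) = Coalgebra.counit (R := ℂ) (coeffMul ρV ρW v w t) := by
  let φ : V ⊗[ℂ] W →ₗ[ℂ] ℂ := Coalgebra.counit (R := ℂ) ∘ₗ coeffMul ρV ρW v w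
  have hφ : IsHighestWeightVector b (η + θ) φ :=
    isHighestWeightVector_of_tmul hv hw (counit_coeffMul_tmul v w)
  obtain ⟨m, hm⟩ := hVirr.exists_highestWeightVector
  obtain ⟨n, hn⟩ := hWirr.exists_highestWeightVector
  -- A product of two nonzero functions in a domain. Equivariance then makes `φ` nonzero somewhere
  -- on the submodule generated by `m ⊗ n`, as the length comparison requires.
  have hmn : coeffMul ρV ρW v w (m ⊗ₜ[ℂ] n) ≠ 0 :=
    mul_ne_zero (coeff_ne_zero hV hVirr.irreducible hv.ne_zero hm.ne_zero)
      (coeff_ne_zero hW hWirr.irreducible hw.ne_zero hn.ne_zero)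
  have hx := hm.tmul hn (fun h => hmn (by rw [h, map_zero]))
  have hne : ∃ y ∈ LieSubmodule.lieSpan ℂ 𝔤 {m ⊗ₜ[ℂ] n}, φ y ≠ 0 := by
    by_contra! h
    exact hmn (eq_zero_of_equivariant e (X := LieSubmodule.lieSpan ℂ 𝔤 {m ⊗ₜ[ℂ] n})
      (G := coeffMul ρV ρW v w ∘ₗ (LieSubmodule.lieSpan ℂ 𝔤 {m ⊗ₜ[ℂ] n}).toSubmodule.subtype)
      (fun x ξ => leftField_coeffMul hV hW v w x ξ) (fun ξ => h ξ ξ.2)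
      ⟨m ⊗ₜ[ℂ] n, LieSubmodule.subset_lieSpan (Set.mem_singleton _)⟩)
  have hker : p.ker.toSubmodule ≤ LinearMap.ker φ := by
    rw [hp.ker_eq, LieSubmodule.sSup_toSubmodule]
    refine sSup_le ?_
    rintro _ ⟨N, ⟨μ, hlt, hN⟩, rfl⟩ t ht
    exact apply_eq_zero_of_weightLT hx hφ hne hlt hN ht
  obtain ⟨s, hs⟩ := LinearMap.exists_rightInverse_of_surjective (p : V ⊗[ℂ] W →ₗ[ℂ] U)
    (LinearMap.range_eq_top.mpr hp.surjective)
  refine ⟨φ ∘ₗ s, fun t => ?_⟩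
  have h1 : s (p t) - t ∈ p.ker := by
    rw [LieModuleHom.mem_ker, map_sub, sub_eq_zero]
    exact LinearMap.congr_fun hs (p t)
  have h2 : φ (s (p t) - t) = 0 := hker h1
  rw [map_sub, sub_eq_zero] at h2
  exact h2

/-- Both sides are equivariant in `t` and have the same value at the identity. Applied to `Λ_st · (ξ
⊗ μ)`, this is the bracket formula. -/
lemma coeff_comp_eq_coeffMul (hV : ρV.Integrates e) (hW : ρW.Integrates e) (hU : ρU.Integrates e)
    {u : U →ₗ[ℂ] ℂ} (hu : ∀ t, u (p t) = Coalgebra.counit (R := ℂ) (coeffMul ρV ρW v w t))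
    (t : V ⊗[ℂ] W) : coeffMul ρV ρW v w t = ρU.coeff u (p t) := by
  rw [← sub_eq_zero]
  refine eq_zero_of_equivariant e
    (G := coeffMul ρV ρW v w - ρU.coeff u ∘ₗ (p : V ⊗[ℂ] W →ₗ[ℂ] U)) (fun x s => ?_)
    (fun s => ?_) t
  · simp only [LinearMap.sub_apply, LinearMap.comp_apply, map_sub, LieModuleHom.coe_toLinearMap]
    rw [leftField_coeffMul hV hW, leftField_coeff hU, LieModuleHom.map_lie]
  · simp only [LinearMap.sub_apply, LinearMap.comp_apply, map_sub, LieModuleHom.coe_toLinearMap]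
    rw [ρU.counit_coeff, hu, sub_self]

theorem exists_highestWeight_functional_bracket (he : IsRootVectors b ep em)
    (hV : ρV.Integrates e) (hW : ρW.Integrates e) (hU : ρU.Integrates e)
    (hVirr : IsIrrep b V ϖ) (hWirr : IsIrrep b W lam)
    (hp : IsProjectionAlongLower b (ϖ + lam) p)
    (hv : IsHighestWeightVector b η v) (hw : IsHighestWeightVector b θ w) :
    ∃ u : U →ₗ[ℂ] ℂ, IsHighestWeightVector b (η + θ) u ∧
      (∀ ξ μ, u (p (ξ ⊗ₜ[ℂ] μ)) = v ξ * w μ) ∧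
      ∀ ξ μ, standardBracket e (standardLambda b ep em) (ρV.coeff v ξ) (ρW.coeff w μ) =
        ρU.coeff u (p (tensorAct 𝔤 V W (standardLambda b ep em) (ξ ⊗ₜ[ℂ] μ))) := by
  obtain ⟨u, hu⟩ := exists_functional_comp_eq hV hW hVirr hWirr hp hv hw
  refine ⟨u, (isHighestWeightVector_of_tmul hv hw (counit_coeffMul_tmul v w)).of_comp
    (φ := Coalgebra.counit (R := ℂ) ∘ₗ coeffMul ρV ρW v w) hp.surjective hu,
    fun ξ μ => by rw [hu, counit_coeffMul_tmul], fun ξ μ => ?_⟩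
  rw [standardBracket_eq_bidiff_leftField he
      (gradedPiece_le_quotientRing η (coeff_mem_gradedPiece hV hv ξ))
      (gradedPiece_le_quotientRing θ (coeff_mem_gradedPiece hW hw μ)),
    bidiff_leftField_coeff hV hW, coeff_comp_eq_coeffMul hV hW hU hu]

end Product

end PoissonLieGroup

end

open PoissonLieGroup in
theorem mainTheorem11
    -- a complex semisimple Lie algebra, a Cartan subalgebra, a system of positive roots
    {𝔤 : Type*} [LieRing 𝔤] [LieAlgebra ℂ 𝔤] [FiniteDimensional ℂ 𝔤] [LieAlgebra.IsSemisimple ℂ 𝔤]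
    {𝔱 : LieSubalgebra ℂ 𝔤} [𝔱.IsCartanSubalgebra]
    (b : (LieAlgebra.IsKilling.rootSystem 𝔱).Base)
    (ep em : 𝔱.root → 𝔤) (he : IsRootVectors b ep em)
    -- the connected and simply connected algebraic group with Lie algebra `𝔤`
    {A : Type*} [CommRing A] [IsDomain A] [HopfAlgebra ℂ A] [Algebra.FiniteType ℂ A]
    (hA : IsSimplyConnectedGroup A) (e : 𝔤 ≃ₗ⁅ℂ⁆ lieAlg A) :
    -- the bracket restricts to `ℂ[N\G]`, and is given there by `Λ_st^L`
    (∀ f ∈ quotientRing e b, ∀ g ∈ quotientRing e b,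
      standardBracket e (standardLambda b ep em) f g =
        bidiff (leftField e) (standardLambda b ep em) f g ∧
      bidiff (leftField e) (standardLambda b ep em) f g ∈ quotientRing e b) ∧
    (∃ br : quotientRing e b →ₗ[ℂ] quotientRing e b →ₗ[ℂ] quotientRing e b,
      IsPoissonBracket br ∧
      ∀ f g, (br f g : A) = standardBracket e (standardLambda b ep em) (f : A) (g : A)) ∧
    -- the formula on matrix coefficients
    (∀ (ϖ lam : dominantWeights b)
      (V W U : Type*)
      [AddCommGroup V] [Module ℂ V] [LieRingModule 𝔤 V] [LieModule ℂ 𝔤 V] [FiniteDimensional ℂ V]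
      [AddCommGroup W] [Module ℂ W] [LieRingModule 𝔤 W] [LieModule ℂ 𝔤 W] [FiniteDimensional ℂ W]
      [AddCommGroup U] [Module ℂ U] [LieRingModule 𝔤 U] [LieModule ℂ 𝔤 U] [FiniteDimensional ℂ U]
      (_ : IsIrrep b V (ϖ : Module.Dual ℂ 𝔱)) (_ : IsIrrep b W (lam : Module.Dual ℂ 𝔱))
      (_ : IsIrrep b U (ϖ + lam : Module.Dual ℂ 𝔱))
      (ρV : RatRep A V) (ρW : RatRep A W) (ρU : RatRep A U)
      (_ : ρV.Integrates e) (_ : ρW.Integrates e) (_ : ρU.Integrates e)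
      (p : V ⊗[ℂ] W →ₗ⁅ℂ,𝔤⁆ U)
      (_ : IsProjectionAlongLower b (ϖ + lam : Module.Dual ℂ 𝔱) p)
      (v : V →ₗ[ℂ] ℂ) (w : W →ₗ[ℂ] ℂ) (η θ : Module.Dual ℂ 𝔱)
      (_ : IsHighestWeightVector b η v) (_ : IsHighestWeightVector b θ w),
      (∀ ξ, ρV.coeff v ξ ∈ gradedPiece e b η) ∧
      ∃ u : U →ₗ[ℂ] ℂ, IsHighestWeightVector b (η + θ) u ∧
        (∀ ξ μ, u (p (ξ ⊗ₜ[ℂ] μ)) = v ξ * w μ) ∧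
        ∀ ξ μ, standardBracket e (standardLambda b ep em) (ρV.coeff v ξ) (ρW.coeff w μ) =
          ρU.coeff u (p (tensorAct 𝔤 V W (standardLambda b ep em) (ξ ⊗ₜ[ℂ] μ)))) ∧
    -- `ℂ[N\G]` is a `𝒫₊`-graded Poisson subalgebra
    IsGradedPoissonSubalgebra (standardBracket e (standardLambda b ep em)) (quotientRing e b)
      (fun ϖ : dominantWeights b => gradedPiece e b (ϖ : Module.Dual ℂ 𝔱)) := by
  refine ⟨fun f hf g hg => ⟨standardBracket_eq_bidiff_leftField he hf hg,
    bidiff_leftField_mem_quotientRing _ hf hg⟩, exists_isPoissonBracket_quotientRing he, ?_,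
    isGradedPoissonSubalgebra_quotientRing he⟩
  intro ϖ lam V W U _ _ _ _ _ _ _ _ _ _ _ _ _ _ _ hVirr hWirr _ ρV ρW ρU hV hW hU p hp v w η θ
    hv hw
  exact ⟨coeff_mem_gradedPiece hV hv,
    exists_highestWeight_functional_bracket he hV hW hU hVirr hWirr hp hv hw⟩
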